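/- Let $N\ge 1$ and let $\Omega\subset\mathbb R^N$ be a bounded domain (nonempty, open, connected) of Lebesgue measure $|\Omega|$. Put $$c_N=\pi^{-N/2}\,\Gamma(\tfrac N2),\qquad \rho_N=2\ln 2+\psi(\tfrac N2)-\gamma,\qquad d_N=\frac{2\,\omega_{N-1}}{N^2(2\pi)^N},$$ where $\psi=\Gamma'/\Gamma$, $\gamma$ is the Euler–Mascheroni constant and $\omega_{N-1}$ is the surface measure of the unit sphere of $\mathbb R^N$. Let $\mathbb H(\Omega)$ be the space of measurable functions $u:\mathbb R^N\to\mathbb R$ with $u=0$ outside $\Omega$ and $$\iint_{|x-y|\le 1}\frac{(u(x)-u(y))^2}{|x-y|^N}\,dx\,dy<\infty ,$$ and for $u,w\in\mathbb H(\Omega)$ let $$\mathcal E_L(u,w)=\frac{c_N}{2}\iint_{|x-y|\le 1}\frac{(u(x)-u(y))(w(x)-w(y))}{|x-y|^N}\,dx\,dy-c_N\iint_{|x-y|\ge 1}\frac{u(x)w(y)}{|x-y|^N}\,dx\,dy+\rho_N\int_{\mathbb R^N}uw\,dx$$ be the bilinear form of the logarithmic Laplacian (the operator with Fourier symbol $2\ln|\xi|$).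 A function $u\in\mathbb H(\Omega)$, not a.e. zero, is a Dirichlet eigenfunction with eigenvalue $\lambda\in\mathbb R$ if $\mathcal E_L(u,\varphi)=\lambda\int_\Omega u\varphi\,dx$ for all $\varphi\in\mathbb H(\Omega)$. Let $\lambda_1(\Omega)\le\lambda_2(\Omega)\le\cdots$ be these eigenvalues in nondecreasing order, counted with multiplicity; that is, $\lambda_k(\Omega)$ is the least $t$ such that there are $k$ eigenfunctions, orthonormal in $L^2(\Omega)$, with eigenvalues at most $t$. Then for every integer $k\ge 1$: 1. if $k\ge \dfrac{e N d_N}{2}|\Omega|$, then $\lambda_k(\Omega)>0$; 2. if $k\ge \dfrac{e^{e+1} N d_N}{2}|\Omega|$, then $$\lambda_k(\Omega)\ \ge\ \frac2N\left(\ln k+\ln\Big(\frac{2}{eNd_N|\Omega|}\Big)-\ln\ln\Big(\frac{2k}{eNd_N|\Omega|}\Big)\right).$$ -/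

import Mathlib

open MeasureTheory

noncomputable section

namespace LogLaplacian

/-- The surface measure of the unit sphere of `ℝ^N`, usually written `ω_{N-1}`. -/
def sphereArea (N : ℕ) : ℝ :=
  ((volume : Measure (EuclideanSpace ℝ (Fin N))).toSphere).real Set.univ

/-- `c_N = π^{-N/2} Γ(N/2)`. -/
def cN (N : ℕ) : ℝ := Real.pi ^ (-((N : ℝ) / 2)) * Real.Gamma ((N : ℝ) / 2)

/-- `ρ_N = 2 ln 2 + ψ(N/2) - γ`, where `ψ = Γ'/Γ`. -/
def rhoN (N : ℕ) : ℝ :=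
  2 * Real.log 2 + logDeriv Real.Gamma ((N : ℝ) / 2) - Real.eulerMascheroniConstant

/-- `d_N = 2 ω_{N-1} / (N² (2π)^N)`. -/
def dN (N : ℕ) : ℝ := 2 * sphereArea N / ((N : ℝ) ^ 2 * (2 * Real.pi) ^ N)

/-- The pairs of points at distance at most `1`. -/
def nearPairs (N : ℕ) : Set (EuclideanSpace ℝ (Fin N) × EuclideanSpace ℝ (Fin N)) :=
  {p | ‖p.1 - p.2‖ ≤ 1}

/-- The pairs of points at distance at least `1`. -/
def farPairs (N : ℕ) : Set (EuclideanSpace ℝ (Fin N) × EuclideanSpace ℝ (Fin N)) :=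
  {p | 1 ≤ ‖p.1 - p.2‖}

/-- Membership in the energy space `ℍ(Ω)`: measurable functions on `ℝ^N` that vanish outside `Ω`
and satisfy `∬_{|x-y| ≤ 1} (u(x)-u(y))² / |x-y|^N dx dy < ∞`. -/
structure MemH {N : ℕ} (Ω : Set (EuclideanSpace ℝ (Fin N)))
    (u : EuclideanSpace ℝ (Fin N) → ℝ) : Prop where
  measurable : Measurable u
  eq_zero : ∀ x ∉ Ω, u x = 0
  finite_energy :
    IntegrableOn (fun p : EuclideanSpace ℝ (Fin N) × EuclideanSpace ℝ (Fin N) =>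
      (u p.1 - u p.2) ^ 2 / ‖p.1 - p.2‖ ^ N) (nearPairs N)

/-- The inner product `ℰ(u,w)` of `ℍ(Ω)`. -/
def energy {N : ℕ} (u w : EuclideanSpace ℝ (Fin N) → ℝ) : ℝ :=
  cN N / 2 * ∫ p in nearPairs N, (u p.1 - u p.2) * (w p.1 - w p.2) / ‖p.1 - p.2‖ ^ N

/-- The bilinear form `ℰ_L(u,w)` of the logarithmic Laplacian. -/
def logForm {N : ℕ} (u w : EuclideanSpace ℝ (Fin N) → ℝ) : ℝ :=
  energy u w - cN N * (∫ p in farPairs N, u p.1 * w p.2 / ‖p.1 - p.2‖ ^ N)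
    + rhoN N * ∫ x, u x * w x

/-- `u` is an eigenfunction, with eigenvalue `lam`, of the Dirichlet problem in `Ω` for the
logarithmic Laplacian: `u ∈ ℍ(Ω)` is not a.e. zero, and `ℰ_L(u,φ) = lam ∫_Ω u φ` for all
`φ ∈ ℍ(Ω)`. -/
structure IsEigenfunction {N : ℕ} (Ω : Set (EuclideanSpace ℝ (Fin N))) (lam : ℝ)
    (u : EuclideanSpace ℝ (Fin N) → ℝ) : Prop where
  memH : MemH Ω u
  ne_zero : ¬ u =ᵐ[volume] 0
  weak_eq : ∀ φ : EuclideanSpace ℝ (Fin N) → ℝ, MemH Ω φ →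
    logForm u φ = lam * ∫ x in Ω, u x * φ x

/-- There are at least `k` Dirichlet eigenvalues in `(-∞, t]`, counted with multiplicity: there are
`k` eigenfunctions, orthonormal in `L²(Ω)`, with eigenvalues at most `t`. -/
def HasEigenvaluesBelow {N : ℕ} (Ω : Set (EuclideanSpace ℝ (Fin N))) (k : ℕ) (t : ℝ) : Prop :=
  ∃ (lam : Fin k → ℝ) (u : Fin k → EuclideanSpace ℝ (Fin N) → ℝ),
    (∀ i, IsEigenfunction Ω (lam i) (u i)) ∧ (∀ i, lam i ≤ t) ∧
    ∀ i j, ∫ x in Ω, u i x * u j x = if i = j then 1 else 0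

/-- The `k`-th Dirichlet eigenvalue `λ_k(Ω)`, `k ≥ 1`: the `k`-th term of the nondecreasing
enumeration, with multiplicity, of the eigenvalues of the logarithmic Laplacian in `Ω`. -/
def eigenvalue {N : ℕ} (Ω : Set (EuclideanSpace ℝ (Fin N))) (k : ℕ) : ℝ :=
  sInf {t : ℝ | HasEigenvaluesBelow Ω k t}

end LogLaplacian

end

noncomputable section

namespace LogLaplacian

open Set Filter Topology

/-! The bound comes from a Berezin–Li–Yau argument, made strict: the sum of `logForm (u i) (u i)`
over a family of `k` functions in ℍ(Ω) orthonormal in L²(Ω) exceeds `k · (2/N) log (2k / (e N d_N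
|Ω|))` (`lt_sum_logForm`). For eigenfunctions the sum is that of the eigenvalues, so λ_k, which is
at least their mean, exceeds `(2/N) log (2k / (e N d_N |Ω|))`. At the first threshold this logarithm
is nonnegative, so strictness gives λ_k > 0. At the second threshold the subtracted iterated
logarithm is nonnegative, so the second claim is weaker than this bound.

The sum is estimated on the Fourier side. The key inequality
`MemH.integral_fourierSq_mul_log_le_logForm` says that the form dominates ∫ 2 log(2π|ξ|) |û|² dξ. It
rests on the subordination c_N |z|^{-N} = ∫₀^∞ q_s(z) ds/s, where q_s is a Gaussian of mass one
whose Fourier transform is exp(-π²|ξ|²/s). The deficit ∫u² - ∬ u(x)u(y) q_s(x-y) is integrated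
against ds/s over s > ε. In space this produces the energy, the far interaction and a Gamma tail of
size -log ε + ψ(N/2); on the Fourier side it produces log(π²|ξ|²/ε) + γ. The terms log ε cancel and
ε → 0 gives the claim. Only one-sided estimates of the two Gamma integrals are needed. Plancherel
for ℍ(Ω) falls out of the same computation.

By Bessel's inequality Σ|û_i|² ≤ |Ω| pointwise, and its total mass is k. Among such densities the
bathtub principle makes the integral against log|ξ| least for |Ω| times the indicator of a ball. A
continuous density is never of that form, hence strictness (`bathtub_log_lt`).

It remains to see that λ_k, defined as an infimum, is attained. Orthonormal eigenfunctions of any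
finite number exist because ℍ(Ω) embeds compactly in L² with infinite-dimensional range
(`isCompactOperator_formEmbedding`, `exists_hasEigenvaluesBelow`). The lower bound itself shows that
only finitely many distinct eigenvalues lie below any level (`finite_eigenvalues_le`). -/

/-! ### One-sided estimates of logarithmic Gamma integrals. -/

theorem log_le_rpow_sub_one_div {x α : ℝ} (hx : 0 < x) (hα : 0 < α) :
    Real.log x ≤ (x ^ α - 1) / α := by
  rw [le_div_iff₀ hα, mul_comm, ← Real.log_rpow hx]
  exact Real.log_le_sub_one_of_pos (Real.rpow_pos_of_pos hx α)

theorem abs_log_le_rpow {x α : ℝ} (hx : 0 < x) (hα : 0 < α) :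
    |Real.log x| ≤ (x ^ α + x ^ (-α)) / α := by
  have h1 := log_le_rpow_sub_one_div hx hα
  have h2 := log_le_rpow_sub_one_div (inv_pos.2 hx) hα
  rw [Real.log_inv, Real.inv_rpow hx.le, ← Real.rpow_neg hx.le] at h2
  have p1 := Real.rpow_pos_of_pos hx α
  have p2 := Real.rpow_pos_of_pos hx (-α)
  rw [abs_le]
  constructor
  · have : (x ^ (-α) - 1) / α ≤ (x ^ α + x ^ (-α)) / α := by gcongr; linarith
    linarith
  · refine h1.trans ?_
    gcongr; linarith

theorem integrableOn_gammaWeight_mul_log {a : ℝ} (ha : 0 < a) :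
    IntegrableOn (fun v : ℝ => Real.exp (-v) * v ^ (a - 1) * Real.log v) (Ioi 0) := by
  have h1 := Real.GammaIntegral_convergent (s := a + a / 2) (by linarith)
  have h2 := Real.GammaIntegral_convergent (s := a - a / 2) (by linarith)
  refine Integrable.mono' ((h1.add h2).div_const (a / 2)) ?_ ?_
  · exact Measurable.aestronglyMeasurable (by fun_prop)
  · refine (ae_restrict_iff' measurableSet_Ioi).2 (.of_forall fun v hv => ?_)
    have hv : 0 < v := hv
    have h := abs_log_le_rpow hv (half_pos ha)
    have e1 : v ^ (a + a / 2 - 1) = v ^ (a - 1) * v ^ (a / 2) := by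
      rw [← Real.rpow_add hv]; ring_nf
    have e2 : v ^ (a - a / 2 - 1) = v ^ (a - 1) * v ^ (-(a / 2)) := by
      rw [← Real.rpow_add hv]; ring_nf
    rw [norm_mul, Real.norm_of_nonneg (by positivity), Real.norm_eq_abs]
    calc _ ≤ Real.exp (-v) * v ^ (a - 1) * ((v ^ (a / 2) + v ^ (-(a / 2))) / (a / 2)) := by gcongr
      _ = _ := by simp only [Pi.add_apply]; rw [e1, e2]; ring

/-- Since log v ≤ (v^α - 1)/α, every right difference quotient of Γ at `a` dominates the integral.
Passing to the limit in the quotients alone avoids differentiation under the integral sign, and this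
direction suffices. -/
theorem integral_gammaWeight_mul_log_le {a : ℝ} (ha : 0 < a) :
    ∫ v in Ioi (0 : ℝ), Real.exp (-v) * v ^ (a - 1) * Real.log v ≤ deriv Real.Gamma a := by
  have hd : HasDerivAt Real.Gamma (deriv Real.Gamma a) a :=
    (Real.differentiableAt_Gamma fun m => by
      have : (0 : ℝ) ≤ m := m.cast_nonneg
      linarith).hasDerivAt
  refine ge_of_tendsto hd.tendsto_slope_zero_right ?_
  filter_upwards [self_mem_nhdsWithin] with α hα
  have hα : 0 < α := hα
  rw [smul_eq_mul, Real.Gamma_eq_integral ha, Real.Gamma_eq_integral (by linarith : 0 < a + α)]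
  have h1 := Real.GammaIntegral_convergent (s := a + α) (by linarith)
  have h2 := Real.GammaIntegral_convergent ha
  rw [← integral_sub h1 h2, ← integral_const_mul]
  refine setIntegral_mono_on (integrableOn_gammaWeight_mul_log ha) ((h1.sub h2).const_mul _)
    measurableSet_Ioi fun v hv => ?_
  have hv : 0 < v := hv
  have e1 : v ^ (a + α - 1) = v ^ (a - 1) * v ^ α := by
    rw [← Real.rpow_add hv]; ring_nf
  calc _ ≤ Real.exp (-v) * v ^ (a - 1) * ((v ^ α - 1) / α) := by
        gcongr; exact log_le_rpow_sub_one_div hv hα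
    _ = _ := by rw [e1]; field_simp

theorem lintegral_Ioc_inv {ε b : ℝ} (hε : 0 < ε) (hb : 0 < b) :
    ∫⁻ s in Ioc ε b, ENNReal.ofReal s⁻¹ = ENNReal.ofReal (Real.log (b / ε)) := by
  rcases le_total b ε with h | h
  · rw [Ioc_eq_empty (by linarith)]
    have : Real.log (b / ε) ≤ 0 :=
      Real.log_nonpos (by positivity) ((div_le_one hε).2 h)
    simp [ENNReal.ofReal_of_nonpos this]
  · rw [← integral_inv_of_pos hε hb, intervalIntegral.integral_of_le h,
      ofReal_integral_eq_lintegral_ofReal]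
    · have := intervalIntegral.intervalIntegrable_inv (μ := volume) (a := ε) (b := b)
        (f := fun x => x) (by
        intro x hx
        rw [uIcc_of_le h] at hx
        exact (hε.trans_le hx.1).ne') continuousOn_id
      exact this.1
    · refine (ae_restrict_iff' measurableSet_Ioc).2 (.of_forall fun s hs => ?_)
      exact inv_nonneg.2 (hε.trans hs.1).le

theorem ofReal_integral_le_lintegral {X : Type*} [MeasurableSpace X] {μ : Measure X} {f : X → ℝ}
    (hf : Integrable f μ) : ENNReal.ofReal (∫ x, f x ∂μ) ≤ ∫⁻ x, ENNReal.ofReal (f x) ∂μ := by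
  calc ENNReal.ofReal (∫ x, f x ∂μ) ≤ ENNReal.ofReal (∫ x, max (f x) 0 ∂μ) :=
        ENNReal.ofReal_le_ofReal (integral_mono hf hf.pos_part fun x => le_max_left _ _)
    _ = ∫⁻ x, ENNReal.ofReal (max (f x) 0) ∂μ :=
        ofReal_integral_eq_lintegral_ofReal hf.pos_part (.of_forall fun x => le_max_right _ _)
    _ = _ := by simp [ENNReal.ofReal_max]

/-- Tonelli for the layers `{s ≤ m v}` with respect to the measure `ds / s`. -/
theorem lintegral_inv_mul_lintegral_layer {ε : ℝ} (hε : 0 < ε) {W : ℝ → ENNReal} {m : ℝ → ℝ}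
    (hW : Measurable W) (hm : Measurable m) (hm0 : ∀ v, 0 < v → 0 < m v) :
    ∫⁻ s in Ioi ε, ENNReal.ofReal s⁻¹ * ∫⁻ v in Ioi 0, {v | s ≤ m v}.indicator W v =
      ∫⁻ v in Ioi 0, W v * ENNReal.ofReal (Real.log (m v / ε)) := by
  have hmeas : Measurable (fun p : ℝ × ℝ => {v | p.1 ≤ m v}.indicator W p.2) := by
    have : (fun p : ℝ × ℝ => {v | p.1 ≤ m v}.indicator W p.2) =
        {p : ℝ × ℝ | p.1 ≤ m p.2}.indicator (fun p => W p.2) := by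
      ext p; simp [indicator]
    rw [this]
    exact (hW.comp measurable_snd).indicator
      (measurableSet_le measurable_fst (hm.comp measurable_snd))
  have h1 : ∀ s : ℝ, ENNReal.ofReal s⁻¹ * ∫⁻ v in Ioi 0, {v | s ≤ m v}.indicator W v =
      ∫⁻ v in Ioi 0, ENNReal.ofReal s⁻¹ * {v | s ≤ m v}.indicator W v := fun s => by
    rw [lintegral_const_mul]
    exact hmeas.comp (by fun_prop : Measurable fun v : ℝ => (s, v))
  simp_rw [h1]
  rw [lintegral_lintegral_swap]
  · refine setLIntegral_congr_fun measurableSet_Ioi fun v hv => ?_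
    have hv : 0 < v := hv
    calc ∫⁻ s in Ioi ε, ENNReal.ofReal s⁻¹ * {v | s ≤ m v}.indicator W v
        = ∫⁻ s in Ioi ε, W v * (Iic (m v)).indicator (fun s => ENNReal.ofReal s⁻¹) s := by
          refine lintegral_congr fun s => ?_
          by_cases h : s ≤ m v <;> simp [indicator, h, mul_comm]
      _ = W v * ∫⁻ s in Ioc ε (m v), ENNReal.ofReal s⁻¹ := by
          rw [lintegral_const_mul _ (by measurability), lintegral_indicator measurableSet_Iic,
            Measure.restrict_restrict measurableSet_Iic, Iic_inter_Ioi]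
      _ = _ := by rw [lintegral_Ioc_inv hε (hm0 v hv)]
  · refine Measurable.aemeasurable ?_
    exact (by fun_prop : Measurable fun p : ℝ × ℝ => ENNReal.ofReal p.1⁻¹).mul hmeas

theorem integral_exp_mul_log_le :
    ∫ v in Ioi (0 : ℝ), Real.exp (-v) * Real.log v ≤ -Real.eulerMascheroniConstant := by
  have h := integral_gammaWeight_mul_log_le one_pos
  rw [Real.eulerMascheroniConstant_eq_neg_deriv, neg_neg]
  simpa using h

/-- The lower bound `log (c/ε) + γ` for `∫_ε^∞ (1 - e^{-c/s}) ds/s`. -/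
theorem ofReal_log_add_euler_le {c ε : ℝ} (hc : 0 < c) (hε : 0 < ε) :
    ENNReal.ofReal (Real.log (c / ε) + Real.eulerMascheroniConstant) ≤
      ∫⁻ s in Ioi ε, ENNReal.ofReal (s⁻¹ * (1 - Real.exp (-c / s))) := by
  -- Write 1 - e^{-c/s} as the integral of e^{-v} over 0 < v ≤ c/s, a condition equivalent to s ≤
  -- c/v, so that the layer formula applies.
  have h1 : ∫⁻ s in Ioi ε, ENNReal.ofReal (s⁻¹ * (1 - Real.exp (-c / s))) =
      ∫⁻ s in Ioi ε, ENNReal.ofReal s⁻¹ * ∫⁻ v in Ioi 0,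
        {v | s ≤ c / v}.indicator (fun v => ENNReal.ofReal (Real.exp (-v))) v := by
    refine setLIntegral_congr_fun measurableSet_Ioi fun s hs => ?_
    have hs : 0 < s := hε.trans hs
    rw [ENNReal.ofReal_mul (inv_nonneg.2 hs.le)]
    congr 1
    have hset : ∫⁻ v in Ioi (0 : ℝ),
        {v | s ≤ c / v}.indicator (fun v => ENNReal.ofReal (Real.exp (-v))) v =
        ∫⁻ v in Ioc (0 : ℝ) (c / s), ENNReal.ofReal (Real.exp (-v)) := by
      have : Ioc (0 : ℝ) (c / s) = Iic (c / s) ∩ Ioi 0 := Iic_inter_Ioi.symm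
      rw [this, ← Measure.restrict_restrict measurableSet_Iic,
        ← lintegral_indicator measurableSet_Iic]
      refine setLIntegral_congr_fun measurableSet_Ioi fun v hv => ?_
      have hv : 0 < v := hv
      have : s ≤ c / v ↔ v ≤ c / s := by
        rw [le_div_iff₀ hv, le_div_iff₀ hs, mul_comm]
      simp [indicator, this]
    rw [hset, ← ofReal_integral_eq_lintegral_ofReal]
    · rw [← intervalIntegral.integral_of_le (by positivity)]
      congr 1
      have : ∫ v in (0 : ℝ)..(c / s), Real.exp (-v) = 1 - Real.exp (-(c / s)) := by
        rw [intervalIntegral.integral_comp_neg (fun v => Real.exp v)]; simp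
      rw [this, neg_div]
    · exact (Continuous.integrableOn_Ioc (by fun_prop))
    · exact .of_forall fun v => (Real.exp_pos _).le
  rw [h1, lintegral_inv_mul_lintegral_layer hε (by fun_prop) (by fun_prop)
    (fun v hv => by positivity)]
  have hint : IntegrableOn (fun v : ℝ => Real.exp (-v) * Real.log v) (Ioi 0) := by
    simpa using integrableOn_gammaWeight_mul_log one_pos
  have hexp : IntegrableOn (fun v : ℝ => Real.exp (-v)) (Ioi 0) := integrableOn_exp_neg_Ioi 0
  -- Tonelli leaves the positive part of log(c/(vε)), because `ENNReal.ofReal` truncates. Removing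
  -- the truncation only lowers the integral, and -∫ e^{-v} log v ≥ γ.
  have key : Real.log (c / ε) + Real.eulerMascheroniConstant ≤
      ∫ v in Ioi (0 : ℝ), Real.exp (-v) * Real.log (c / v / ε) := by
    have : ∫ v in Ioi (0 : ℝ), Real.exp (-v) * Real.log (c / v / ε) =
        ∫ v in Ioi (0 : ℝ), (Real.exp (-v) * Real.log (c / ε) - Real.exp (-v) * Real.log v) := by
      refine setIntegral_congr_fun measurableSet_Ioi fun v hv => ?_
      have hv : 0 < v := hv
      rw [div_right_comm, Real.log_div (by positivity) hv.ne']; ring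
    rw [this, integral_sub (hexp.mul_const _) hint, integral_mul_const,
      integral_exp_neg_Ioi_zero]
    linarith [integral_exp_mul_log_le]
  refine (ENNReal.ofReal_le_ofReal key).trans ?_
  refine (ofReal_integral_le_lintegral ?_).trans ?_
  · refine (integrable_congr ((ae_restrict_iff' measurableSet_Ioi).2
      (.of_forall fun v hv => ?_))).1 ((hexp.mul_const (Real.log (c / ε))).sub hint)
    have hv : 0 < v := hv
    simp only [Pi.sub_apply]
    rw [div_right_comm, Real.log_div (x := c / ε) (by positivity) hv.ne']; ring
  refine lintegral_mono fun v => ?_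
  rw [ENNReal.ofReal_mul (Real.exp_pos _).le]

/-- The tail `Γ(a)⁻¹ ∫_s^∞ v^{a-1} e^{-v} dv`. -/
def gammaTail (a s : ℝ) : ℝ :=
  (Real.Gamma a)⁻¹ * ∫ v in Ici s, Real.exp (-v) * v ^ (a - 1)

theorem gammaTail_nonneg {a : ℝ} (ha : 0 < a) {s : ℝ} (hs : 0 < s) : 0 ≤ gammaTail a s := by
  refine mul_nonneg (inv_nonneg.2 (Real.Gamma_pos_of_pos ha).le) ?_
  refine setIntegral_nonneg measurableSet_Ici fun v hv => ?_
  have : 0 < v := hs.trans_le hv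
  positivity

/-- Tonelli gives Γ(a)⁻¹ ∫ e^{-v} v^{a-1} log⁺(v/ε) dv, and log⁺ t ≤ log t + 4 t^{-1/4}. The
logarithm contributes -log ε + ψ(a) at most, and the correction vanishes as ε → 0. The exponent 1/4
keeps a - 1/4 positive for every a = N/2 ≥ 1/2. -/
theorem lintegral_inv_mul_gammaTail_le {a ε : ℝ} (ha : 1 / 4 < a) (hε : 0 < ε) :
    ∫⁻ s in Ioi ε, ENNReal.ofReal (s⁻¹ * gammaTail a s) ≤
      ENNReal.ofReal (-Real.log ε + logDeriv Real.Gamma a +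
        4 * ε ^ (1 / 4 : ℝ) * Real.Gamma (a - 1 / 4) / Real.Gamma a) := by
  have ha0 : 0 < a := by linarith
  have hG := Real.Gamma_pos_of_pos ha0
  set W : ℝ → ENNReal := fun v => ENNReal.ofReal (Real.exp (-v) * v ^ (a - 1)) with hW
  have h1 : ∫⁻ s in Ioi ε, ENNReal.ofReal (s⁻¹ * gammaTail a s) =
      ENNReal.ofReal (Real.Gamma a)⁻¹ * ∫⁻ s in Ioi ε, ENNReal.ofReal s⁻¹ * ∫⁻ v in Ioi 0,
        {v | s ≤ id v}.indicator W v := by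
    rw [← lintegral_const_mul' _ _ ENNReal.ofReal_ne_top]
    refine setLIntegral_congr_fun measurableSet_Ioi fun s hs => ?_
    have hs : 0 < s := hε.trans hs
    have hset : ∫⁻ v in Ioi (0 : ℝ), {v | s ≤ id v}.indicator W v = ∫⁻ v in Ici s, W v := by
      have : {v : ℝ | s ≤ id v} = Ici s := rfl
      rw [this, lintegral_indicator measurableSet_Ici, Measure.restrict_restrict measurableSet_Ici,
        inter_eq_left.2 (show Ici s ⊆ Ioi 0 from fun v (hv : s ≤ v) => hs.trans_le hv)]
    rw [hset, hW, ← ofReal_integral_eq_lintegral_ofReal, ← ENNReal.ofReal_mul (by positivity),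
      ← ENNReal.ofReal_mul (by positivity), gammaTail]
    · congr 1; ring
    · exact (Real.GammaIntegral_convergent ha0).mono_set fun v (hv : s ≤ v) => hs.trans_le hv
    · refine (ae_restrict_iff' measurableSet_Ici).2 (.of_forall fun v hv => ?_)
      have : 0 < v := hs.trans_le hv
      positivity
  rw [h1, lintegral_inv_mul_lintegral_layer hε (by fun_prop) measurable_id (fun v hv => hv)]
  have i1 := integrableOn_gammaWeight_mul_log ha0
  have i2 := Real.GammaIntegral_convergent ha0
  have i3 := Real.GammaIntegral_convergent (s := a - 1 / 4) (by linarith)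
  have hint : IntegrableOn (fun v : ℝ => Real.exp (-v) * v ^ (a - 1) * Real.log v
      - Real.exp (-v) * v ^ (a - 1) * Real.log ε
      + Real.exp (-v) * v ^ (a - 1 / 4 - 1) * (4 * ε ^ (1 / 4 : ℝ))) (Ioi 0) :=
    (i1.sub (i2.mul_const _)).add (i3.mul_const _)
  have hle : ∀ v ∈ Ioi (0 : ℝ), W v * ENNReal.ofReal (Real.log (id v / ε)) ≤
      ENNReal.ofReal (Real.exp (-v) * v ^ (a - 1) * Real.log v
      - Real.exp (-v) * v ^ (a - 1) * Real.log ε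
      + Real.exp (-v) * v ^ (a - 1 / 4 - 1) * (4 * ε ^ (1 / 4 : ℝ))) ∧
      0 ≤ Real.exp (-v) * v ^ (a - 1) * Real.log v
      - Real.exp (-v) * v ^ (a - 1) * Real.log ε
      + Real.exp (-v) * v ^ (a - 1 / 4 - 1) * (4 * ε ^ (1 / 4 : ℝ)) := by
    intro v hv
    have hv : 0 < v := hv
    have e1 : v ^ (a - 1 / 4 - 1) = v ^ (a - 1) * v ^ (-(1 / 4) : ℝ) := by
      rw [← Real.rpow_add hv]; ring_nf
    have hw : 0 ≤ Real.exp (-v) * v ^ (a - 1) := by positivity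
    have e2 : Real.exp (-v) * v ^ (a - 1) * Real.log v
      - Real.exp (-v) * v ^ (a - 1) * Real.log ε
      + Real.exp (-v) * v ^ (a - 1 / 4 - 1) * (4 * ε ^ (1 / 4 : ℝ)) =
      Real.exp (-v) * v ^ (a - 1) * (Real.log (v / ε) + 4 * (ε / v) ^ (1 / 4 : ℝ)) := by
      rw [e1, Real.log_div hv.ne' hε.ne', Real.div_rpow hε.le hv.le, Real.rpow_neg hv.le]; ring
    -- This is log x ≤ 4(x^{1/4} - 1) at x = ε/v.
    have h0 : 0 ≤ Real.log (v / ε) + 4 * (ε / v) ^ (1 / 4 : ℝ) := by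
      have := log_le_rpow_sub_one_div (x := ε / v) (α := 1 / 4) (by positivity) (by norm_num)
      rw [← inv_div v ε, Real.log_inv, inv_div] at this
      linarith
    rw [e2]
    refine ⟨?_, mul_nonneg hw h0⟩
    rw [hW, ← ENNReal.ofReal_mul hw]
    refine ENNReal.ofReal_le_ofReal ?_
    rw [id]
    gcongr
    have : 0 ≤ 4 * (ε / v) ^ (1 / 4 : ℝ) := by positivity
    linarith
  refine (mul_le_mul_right (setLIntegral_mono' measurableSet_Ioi fun v hv => (hle v hv).1) _).trans ?_
  rw [← ofReal_integral_eq_lintegral_ofReal hint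
    ((ae_restrict_iff' measurableSet_Ioi).2 (.of_forall fun v hv => (hle v hv).2)),
    ← ENNReal.ofReal_mul (by positivity)]
  refine ENNReal.ofReal_le_ofReal ?_
  have i12 : Integrable (fun v : ℝ => Real.exp (-v) * v ^ (a - 1) * Real.log v
      - Real.exp (-v) * v ^ (a - 1) * Real.log ε) (volume.restrict (Ioi 0)) :=
    i1.sub (i2.mul_const _)
  rw [integral_add i12 (i3.mul_const _), integral_sub i1 (i2.mul_const _),
    integral_mul_const, integral_mul_const, ← Real.Gamma_eq_integral ha0,
    ← Real.Gamma_eq_integral (by linarith : 0 < a - 1 / 4), logDeriv_apply]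
  have := integral_gammaWeight_mul_log_le ha0
  rw [inv_mul_le_iff₀ hG]
  have e : Real.Gamma a * (-Real.log ε + deriv Real.Gamma a / Real.Gamma a +
      4 * ε ^ (1 / 4 : ℝ) * Real.Gamma (a - 1 / 4) / Real.Gamma a) =
      - Real.Gamma a * Real.log ε + deriv Real.Gamma a +
      4 * ε ^ (1 / 4 : ℝ) * Real.Gamma (a - 1 / 4) := by
    field_simp
  rw [e]
  linarith

/-! ### Gaussian kernels: mass, tails, subordination and Fourier transform. -/

/-- The Gaussian kernel `(s/π)^{N/2} e^{-s|z|²}`. -/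
def gaussKernel (N : ℕ) (s : ℝ) (z : EuclideanSpace ℝ (Fin N)) : ℝ :=
  (s / Real.pi) ^ ((N : ℝ) / 2) * Real.exp (-s * ‖z‖ ^ 2)

section GaussKernel

variable {N : ℕ}

theorem gaussKernel_nonneg {s : ℝ} (hs : 0 ≤ s) (z : EuclideanSpace ℝ (Fin N)) :
    0 ≤ gaussKernel N s z := by
  unfold gaussKernel
  have := Real.pi_pos
  positivity

theorem gaussKernel_le {s : ℝ} (hs : 0 ≤ s) (z : EuclideanSpace ℝ (Fin N)) :
    gaussKernel N s z ≤ (s / Real.pi) ^ ((N : ℝ) / 2) := by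
  have := Real.pi_pos
  refine mul_le_of_le_one_right (by positivity) (Real.exp_le_one_iff.2 ?_)
  nlinarith [sq_nonneg ‖z‖]

theorem gaussKernel_neg (s : ℝ) (z : EuclideanSpace ℝ (Fin N)) :
    gaussKernel N s (-z) = gaussKernel N s z := by
  simp [gaussKernel]

theorem integrable_gaussKernel {s : ℝ} (hs : 0 < s) :
    Integrable (gaussKernel N s) := by
  have h := GaussianFourier.integrable_cexp_neg_mul_sq_norm_add
    (V := EuclideanSpace ℝ (Fin N)) (b := (s : ℂ)) (by simpa using hs) 0 0
  have h2 : Integrable fun z : EuclideanSpace ℝ (Fin N) => Real.exp (-s * ‖z‖ ^ 2) := by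
    refine (integrable_congr (.of_forall fun z => ?_)).1 h.norm
    simp only [Complex.norm_exp]
    congr 1
    simp
    left
    norm_cast
  exact h2.const_mul _

theorem integral_gaussKernel {s : ℝ} (hs : 0 < s) : ∫ z, gaussKernel N s z = 1 := by
  have := Real.pi_pos
  simp only [gaussKernel]
  rw [integral_const_mul, GaussianFourier.integral_rexp_neg_mul_sq_norm hs,
    finrank_euclideanSpace_fin, ← Real.mul_rpow (by positivity) (by positivity)]
  have : s / Real.pi * (Real.pi / s) = 1 := by field_simp
  rw [this, Real.one_rpow]

theorem sphereArea_eq (N : ℕ) :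
    sphereArea N = N * volume.real (Metric.ball (0 : EuclideanSpace ℝ (Fin N)) 1) := by
  rw [sphereArea, Measure.toSphere_real_apply_univ, finrank_euclideanSpace_fin]

theorem sphereArea_mul_rpow_pi (hN : 1 ≤ N) :
    N * volume.real (Metric.ball (0 : EuclideanSpace ℝ (Fin N)) 1) =
      2 * Real.pi ^ ((N : ℝ) / 2) / Real.Gamma ((N : ℝ) / 2) := by
  have : Nonempty (Fin N) := ⟨⟨0, hN⟩⟩
  have hN' : (0 : ℝ) < N := by exact_mod_cast hN
  have hG := Real.Gamma_pos_of_pos (half_pos hN')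
  rw [Measure.real, EuclideanSpace.volume_ball, Fintype.card_fin, Real.Gamma_add_one (by positivity)]
  have hpi : Real.sqrt Real.pi ^ N = Real.pi ^ ((N : ℝ) / 2) := by
    rw [Real.sqrt_eq_rpow, ← Real.rpow_natCast, ← Real.rpow_mul Real.pi_pos.le]; ring_nf
  rw [hpi]
  simp only [ENNReal.ofReal_one, one_pow, one_mul]
  rw [ENNReal.toReal_ofReal (by have := Real.pi_pos; positivity)]
  field_simp

/-- Polar coordinates followed by the substitution v = s y², which sends y ≥ 1 to v ≥ s. This is the
source of ψ(N/2) in ρ_N. -/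
theorem setIntegral_gaussKernel_far (hN : 1 ≤ N) {s : ℝ} (hs : 0 < s) :
    ∫ z in {z : EuclideanSpace ℝ (Fin N) | 1 ≤ ‖z‖}, gaussKernel N s z =
      gammaTail ((N : ℝ) / 2) s := by
  have : Nonempty (Fin N) := ⟨⟨0, hN⟩⟩
  have hN' : (0 : ℝ) < N := by exact_mod_cast hN
  have hpi := Real.pi_pos
  set a : ℝ := (N : ℝ) / 2 with ha
  have hG : 0 < Real.Gamma a := Real.Gamma_pos_of_pos (half_pos hN')
  have hS : MeasurableSet {z : EuclideanSpace ℝ (Fin N) | 1 ≤ ‖z‖} :=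
    measurableSet_le measurable_const measurable_norm
  set f : ℝ → ℝ := (Ici 1).indicator fun y => (s / Real.pi) ^ a * Real.exp (-s * y ^ 2) with hf
  have h1 : ∫ z in {z : EuclideanSpace ℝ (Fin N) | 1 ≤ ‖z‖}, gaussKernel N s z =
      ∫ z : EuclideanSpace ℝ (Fin N), f ‖z‖ := by
    rw [← integral_indicator hS]
    refine integral_congr_ae (.of_forall fun z => ?_)
    by_cases h : 1 ≤ ‖z‖ <;> simp [hf, indicator, gaussKernel, h, ha]
  set g : ℝ → ℝ := (Ici s).indicator fun v => Real.exp (-v) * v ^ (a - 1) with hg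
  have h2 : ∫ v in Ici s, Real.exp (-v) * v ^ (a - 1) = ∫ v in Ioi (0 : ℝ), g v := by
    rw [hg, integral_indicator measurableSet_Ici, Measure.restrict_restrict measurableSet_Ici,
        inter_eq_left.2 (show Ici s ⊆ Ioi 0 from fun v (hv : s ≤ v) => hs.trans_le hv)]
  have h3 : ∫ v in Ioi (0 : ℝ), g v =
      ∫ y in Ioi (0 : ℝ), (2 * Real.pi ^ a) * (y ^ (N - 1) * f y) := by
    have e1 := integral_comp_mul_left_Ioi' g 0 hs
    rw [mul_zero, ← integral_comp_rpow_Ioi_of_pos (p := 2) two_pos, smul_eq_mul,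
      ← integral_const_mul] at e1
    rw [← e1]
    refine setIntegral_congr_fun measurableSet_Ioi fun y hy => ?_
    have hy : 0 < y := hy
    have e2 : y ^ (N - 1) = y ^ ((N : ℝ) - 1) := by
      rw [← Real.rpow_natCast, Nat.cast_sub hN, Nat.cast_one]
    simp only [smul_eq_mul, hg, hf, indicator, mem_Ici, Real.rpow_two]
    have hiff : s ≤ s * y ^ 2 ↔ 1 ≤ y := by
      rw [le_mul_iff_one_le_right hs, one_le_sq_iff₀ hy.le]
    by_cases h : 1 ≤ y
    · rw [if_pos h, if_pos (hiff.2 h), e2, Real.div_rpow hs.le hpi.le,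
        Real.mul_rpow hs.le (by positivity), ← Real.rpow_two, ← Real.rpow_mul hy.le]
      have e3 : y ^ ((N : ℝ) - 1) = y ^ (2 - 1 : ℝ) * y ^ (2 * (a - 1)) := by
        rw [← Real.rpow_add hy]; congr 1; rw [ha]; ring
      have e4 : s ^ a = s * s ^ (a - 1) := by
        rw [Real.rpow_sub_one hs.ne']; field_simp
      rw [e3, e4, neg_mul]
      have := Real.rpow_pos_of_pos hpi a
      field_simp
    · rw [if_neg h, if_neg (fun h' => h (hiff.1 h'))]; ring
  rw [h1, integral_fun_norm_addHaar volume f, gammaTail, h2, h3, finrank_euclideanSpace_fin,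
    integral_const_mul, nsmul_eq_mul, smul_eq_mul, ← mul_assoc, sphereArea_mul_rpow_pi hN, ← ha]
  simp only [smul_eq_mul]
  ring

theorem cN_pos (hN : 1 ≤ N) : 0 < cN N := by
  have hN' : (0 : ℝ) < N := by exact_mod_cast hN
  have := Real.Gamma_pos_of_pos (half_pos hN')
  have := Real.pi_pos
  unfold cN; positivity

/-- The subordination formula: the singular kernel is a positive superposition of Gaussians, so
questions about the form reduce to Gaussian convolutions. -/
theorem integral_inv_mul_gaussKernel (hN : 1 ≤ N) {z : EuclideanSpace ℝ (Fin N)} (hz : z ≠ 0) :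
    IntegrableOn (fun s => s⁻¹ * gaussKernel N s z) (Ioi 0) ∧
      ∫ s in Ioi (0 : ℝ), s⁻¹ * gaussKernel N s z = cN N / ‖z‖ ^ N := by
  have hN' : (0 : ℝ) < N := by exact_mod_cast hN
  have hpi := Real.pi_pos
  have hz' : 0 < ‖z‖ := norm_pos_iff.2 hz
  set a : ℝ := (N : ℝ) / 2 with ha
  have ha0 : 0 < a := by positivity
  have hG : 0 < Real.Gamma a := Real.Gamma_pos_of_pos ha0
  have hcongr : EqOn (fun s => Real.pi ^ (-a) * (s ^ (a - 1) * Real.exp (-(‖z‖ ^ 2 * s))))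
      (fun s => s⁻¹ * gaussKernel N s z) (Ioi 0) := by
    intro s hs
    have hs : 0 < s := hs
    simp only [gaussKernel]
    rw [← ha, Real.div_rpow hs.le hpi.le, Real.rpow_neg hpi.le, Real.rpow_sub_one hs.ne']
    have : -s * ‖z‖ ^ 2 = -(‖z‖ ^ 2 * s) := by ring
    rw [this]; field_simp
  have hI := Real.integral_rpow_mul_exp_neg_mul_Ioi (a := a) (r := ‖z‖ ^ 2) ha0 (by positivity)
  have hval : ∫ s in Ioi (0 : ℝ), s⁻¹ * gaussKernel N s z = cN N / ‖z‖ ^ N := by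
    rw [← setIntegral_congr_fun measurableSet_Ioi hcongr, integral_const_mul, hI, cN, ← ha,
      Real.div_rpow zero_le_one (by positivity), Real.one_rpow]
    have : (‖z‖ ^ 2) ^ a = ‖z‖ ^ N := by
      rw [← Real.rpow_two, ← Real.rpow_mul hz'.le, ha, mul_div_cancel₀ _ two_ne_zero,
        Real.rpow_natCast]
    rw [this]; ring
  refine ⟨?_, hval⟩
  -- A nonintegrable function has Bochner integral 0, whereas the value just computed is positive;
  -- integrability follows from the value.
  by_contra hcon
  rw [integral_undef hcon] at hval
  have := cN_pos hN
  have : 0 < cN N / ‖z‖ ^ N := by positivity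
  linarith

/-- The real part of the Fourier transform of a Gaussian; working with cosines keeps the Fourier
side real. -/
theorem integral_exp_mul_cos {s : ℝ} (hs : 0 < s) (z : EuclideanSpace ℝ (Fin N)) :
    ∫ ξ : EuclideanSpace ℝ (Fin N), Real.exp (-(Real.pi ^ 2 * ‖ξ‖ ^ 2) / s) *
      Real.cos (2 * Real.pi * inner ℝ z ξ) = gaussKernel N s z := by
  have hpi := Real.pi_pos
  have hb : 0 < Real.pi ^ 2 / s := by positivity
  have h := fourier_gaussian_innerProductSpace (V := EuclideanSpace ℝ (Fin N))
    (b := ((Real.pi ^ 2 / s : ℝ) : ℂ)) (by rwa [Complex.ofReal_re]) z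
  rw [Real.fourier_eq'] at h
  have h' := congrArg Complex.re h
  rw [← RCLike.re_eq_complex_re, ← integral_re] at h'
  · convert h' using 1
    · refine integral_congr_ae (.of_forall fun ξ => ?_)
      simp only [smul_eq_mul, RCLike.re_eq_complex_re]
      have e1 : (-((Real.pi ^ 2 / s : ℝ) : ℂ) * (‖ξ‖ : ℂ) ^ 2) =
          ((-(Real.pi ^ 2 * ‖ξ‖ ^ 2) / s : ℝ) : ℂ) := by
        push_cast; ring
      rw [e1, ← Complex.ofReal_exp, mul_comm (Complex.exp _),
        Complex.re_ofReal_mul, Complex.exp_ofReal_mul_I_re]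
      rw [real_inner_comm, mul_comm (-2 * Real.pi) , ← Real.cos_neg]
      congr 2; ring_nf
    · have e1 : ((Real.pi : ℂ) / ((Real.pi ^ 2 / s : ℝ) : ℂ)) = ((s / Real.pi : ℝ) : ℂ) := by
        push_cast; field_simp
      have e2 : (-(Real.pi : ℂ) ^ 2 * (‖z‖ : ℂ) ^ 2 / ((Real.pi ^ 2 / s : ℝ) : ℂ)) =
          ((-s * ‖z‖ ^ 2 : ℝ) : ℂ) := by
        push_cast; field_simp
      have e3 : ((Module.finrank ℝ (EuclideanSpace ℝ (Fin N)) : ℂ) / 2) =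
          (((N : ℝ) / 2 : ℝ) : ℂ) := by
        rw [finrank_euclideanSpace_fin]; push_cast; rfl
      rw [e1, e2, e3, ← Complex.ofReal_cpow (by positivity), ← Complex.ofReal_exp,
        ← Complex.ofReal_mul, RCLike.re_eq_complex_re, Complex.ofReal_re, gaussKernel]
  · have hi := GaussianFourier.integrable_cexp_neg_mul_sq_norm_add
      (V := EuclideanSpace ℝ (Fin N)) (b := ((Real.pi ^ 2 / s : ℝ) : ℂ)) (by rwa [Complex.ofReal_re])
      (-2 * Real.pi * Complex.I) z
    refine (integrable_congr (.of_forall fun ξ => ?_)).1 hi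
    simp only [smul_eq_mul]
    rw [← Complex.exp_add, real_inner_comm]
    congr 1
    push_cast; ring

theorem integrable_exp_neg_sq_div {s : ℝ} (hs : 0 < s) :
    Integrable fun ξ : EuclideanSpace ℝ (Fin N) =>
      Real.exp (-(Real.pi ^ 2 * ‖ξ‖ ^ 2) / s) := by
  have hpi := Real.pi_pos
  have hb : 0 < Real.pi ^ 2 / s := by positivity
  have h := (integrable_gaussKernel (N := N) hb).const_mul
    ((Real.pi ^ 2 / s / Real.pi) ^ ((N : ℝ) / 2))⁻¹
  refine (integrable_congr (.of_forall fun ξ => ?_)).1 h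
  have : (Real.pi ^ 2 / s / Real.pi) ^ ((N : ℝ) / 2) ≠ 0 := by positivity
  simp only [gaussKernel]
  rw [inv_mul_cancel_left₀ this]
  congr 1; ring

end GaussKernel

/-! ### The energy space is contained in L² and in L¹. -/

variable {N : ℕ} {Ω : Set (EuclideanSpace ℝ (Fin N))} {u w : EuclideanSpace ℝ (Fin N) → ℝ}

theorem measurableSet_nearPairs (N : ℕ) : MeasurableSet (nearPairs N) :=
  measurableSet_le (by fun_prop) measurable_const

theorem measurableSet_farPairs (N : ℕ) : MeasurableSet (farPairs N) :=
  measurableSet_le measurable_const (by fun_prop)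

theorem sq_sub_le_div_norm_pow {p : EuclideanSpace ℝ (Fin N) × EuclideanSpace ℝ (Fin N)}
    (hp : p ∈ nearPairs N) :
    (u p.1 - u p.2) ^ 2 ≤ (u p.1 - u p.2) ^ 2 / ‖p.1 - p.2‖ ^ N := by
  rcases eq_or_ne p.1 p.2 with h | h
  · simp [h]
  · have h0 : 0 < ‖p.1 - p.2‖ := norm_pos_iff.2 (sub_ne_zero.2 h)
    have h1 : ‖p.1 - p.2‖ ^ N ≤ 1 := pow_le_one₀ h0.le hp
    rw [le_div_iff₀ (by positivity)]
    nlinarith [sq_nonneg (u p.1 - u p.2)]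

/-- For some small `z ≠ 0` the difference `u - u(· + z)` is square integrable. -/
theorem MemH.exists_memLp_sub_translate (hN : 1 ≤ N) (hu : MemH Ω u) :
    ∃ z : EuclideanSpace ℝ (Fin N), z ≠ 0 ∧ MemLp (fun x => u x - u (x + z)) 2 := by
  have : Nonempty (Fin N) := ⟨⟨0, hN⟩⟩
  have hmeas := hu.measurable
  set F : EuclideanSpace ℝ (Fin N) × EuclideanSpace ℝ (Fin N) → ENNReal :=
    (nearPairs N).indicator fun p => ENNReal.ofReal ((u p.1 - u p.2) ^ 2) with hF
  have hFm : Measurable F :=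
    Measurable.indicator (by fun_prop) (measurableSet_nearPairs N)
  have hfin : ∫⁻ p, F p < ⊤ := by
    rw [hF, lintegral_indicator (measurableSet_nearPairs N)]
    refine lt_of_le_of_lt ?_ hu.finite_energy.lintegral_lt_top
    exact setLIntegral_mono' (measurableSet_nearPairs N) fun p hp =>
      ENNReal.ofReal_le_ofReal (sq_sub_le_div_norm_pow hp)
  -- In the coordinates (x, y - x), Tonelli makes the integral in x finite for almost every shift z.
  -- The punctured unit ball has positive measure, so it contains such a z.
  have hsh : ∫⁻ p : EuclideanSpace ℝ (Fin N) × EuclideanSpace ℝ (Fin N), F (p.1, p.1 + p.2) < ⊤ := by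
    have := (measurePreserving_prod_add (volume : Measure (EuclideanSpace ℝ (Fin N)))
      (volume : Measure (EuclideanSpace ℝ (Fin N)))).lintegral_comp hFm
    rw [Measure.volume_eq_prod, this]
    exact hfin
  rw [Measure.volume_eq_prod, lintegral_prod_symm _ (by fun_prop)] at hsh
  have hae := ae_lt_top (by
    exact Measurable.lintegral_prod_left (by fun_prop :
      Measurable fun p : EuclideanSpace ℝ (Fin N) × EuclideanSpace ℝ (Fin N) =>
        F (p.1, p.1 + p.2))) hsh.ne
  have hpos : volume (Metric.ball (0 : EuclideanSpace ℝ (Fin N)) 1 \ {0}) ≠ 0 := by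
    rw [measure_sdiff_null (measure_singleton _)]
    exact (Metric.measure_ball_pos _ _ one_pos).ne'
  obtain ⟨z, hz, hzfin⟩ : ∃ z ∈ Metric.ball (0 : EuclideanSpace ℝ (Fin N)) 1 \ {0},
      ∫⁻ x, F (x, x + z) < ⊤ := by
    by_contra! hcon
    refine hpos (measure_mono_null (fun z hz => ?_) (ae_iff.1 hae))
    exact not_lt.2 (hcon z hz)
  refine ⟨z, hz.2, (memLp_two_iff_integrable_sq (by fun_prop)).2 ⟨by fun_prop, ?_⟩⟩
  rw [hasFiniteIntegral_iff_ofReal (.of_forall fun x => sq_nonneg _)]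
  refine lt_of_eq_of_lt (lintegral_congr fun x => ?_) hzfin
  have : (x, x + z) ∈ nearPairs N := by
    have := hz.1
    rw [mem_ball_zero_iff] at this
    simpa [nearPairs] using this.le
  rw [hF, indicator_of_mem this]

/-- Square integrability is not part of `MemH`. With v = u - u(· + z) in L², telescoping gives u(x)
= Σ_{j<m} v(x + jz) + u(x + mz). When m|z| exceeds twice a bound for the norms on Ω, the last term
vanishes for x in Ω. -/
theorem MemH.memLp (hN : 1 ≤ N) (hu : MemH Ω u) (hΩ : MeasurableSet Ω)
    (hb : Bornology.IsBounded Ω) : MemLp u 2 := by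
  obtain ⟨z, hz, hv⟩ := hu.exists_memLp_sub_translate hN
  set v := fun x => u x - u (x + z) with hvdef
  obtain ⟨D, hD⟩ := hb.exists_norm_le
  have hz0 : 0 < ‖z‖ := norm_pos_iff.2 hz
  obtain ⟨m, hm⟩ := exists_nat_gt (2 * D / ‖z‖)
  have htel : ∀ m : ℕ, ∀ x, u x = ∑ j ∈ Finset.range m, v (x + (j : ℝ) • z) + u (x + (m : ℝ) • z) := by
    intro m x
    induction m with
    | zero => simp
    | succ m ih =>
      rw [Finset.sum_range_succ, ih, hvdef]
      push_cast
      rw [add_smul, one_smul, ← add_assoc]; ring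
  have hmem : MemLp (Ω.indicator fun x => ∑ j ∈ Finset.range m, v (x + (j : ℝ) • z)) 2 := by
    refine MemLp.indicator hΩ (memLp_finsetSum _ fun j _ => ?_)
    exact hv.comp_measurePreserving (measurePreserving_add_right volume ((j : ℝ) • z))
  refine (memLp_congr_ae (.of_forall fun x => ?_)).1 hmem
  by_cases hx : x ∈ Ω
  · rw [indicator_of_mem hx, htel m x, hu.eq_zero (x + (m : ℝ) • z), add_zero]
    intro hx'
    have h1 := hD _ hx
    have h2 := hD _ hx'
    have h3 : ‖(m : ℝ) • z‖ ≤ 2 * D := by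
      calc ‖(m : ℝ) • z‖ = ‖x + (m : ℝ) • z - x‖ := by rw [add_sub_cancel_left]
        _ ≤ _ := (norm_sub_le _ _).trans (by linarith)
    rw [norm_smul, Real.norm_natCast] at h3
    rw [div_lt_iff₀ hz0] at hm
    linarith
  · rw [indicator_of_notMem hx, hu.eq_zero x hx]

theorem integrable_of_memLp_two (hb : Bornology.IsBounded Ω)
    (hu : MemLp u 2) (h0 : ∀ x ∉ Ω, u x = 0) : Integrable u := by
  have : IsFiniteMeasure (volume.restrict Ω) :=
    ⟨by simpa using hb.measure_lt_top⟩
  have h1 : IntegrableOn u Ω := ((hu.restrict Ω).mono_exponent one_le_two).integrable le_rfl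
  exact (integrableOn_iff_integrable_of_support_subset fun x hx => by
    by_contra h; exact hx (h0 x h)).1 h1

theorem MemH.integrable (hN : 1 ≤ N) (hu : MemH Ω u) (hΩ : MeasurableSet Ω)
    (hb : Bornology.IsBounded Ω) : Integrable u :=
  integrable_of_memLp_two hb (hu.memLp hN hΩ hb) hu.eq_zero

/-! ### Integration over pairs and subordination of double integrals. -/

theorem integral_mul_comp_sub {f g : EuclideanSpace ℝ (Fin N) → ℝ} (hf : Integrable f)
    (hg : Integrable g) :
    Integrable (fun p : EuclideanSpace ℝ (Fin N) × EuclideanSpace ℝ (Fin N) =>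
      f p.1 * g (p.1 - p.2)) ∧
    ∫ p : EuclideanSpace ℝ (Fin N) × EuclideanSpace ℝ (Fin N), f p.1 * g (p.1 - p.2) =
      (∫ x, f x) * ∫ z, g z := by
  have hmp := measurePreserving_prod_sub (volume : Measure (EuclideanSpace ℝ (Fin N)))
      (volume : Measure (EuclideanSpace ℝ (Fin N)))
  have hg' : Integrable (fun z => g (-z)) := hg.comp_neg
  have hi := hf.mul_prod hg'
  have e : (fun p : EuclideanSpace ℝ (Fin N) × EuclideanSpace ℝ (Fin N) =>
      f p.1 * g (p.1 - p.2)) = (fun q : EuclideanSpace ℝ (Fin N) × EuclideanSpace ℝ (Fin N) =>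
      f q.1 * g (-q.2)) ∘ fun p => (p.1, p.2 - p.1) := by
    ext p; simp
  constructor
  · rw [e]
    exact hmp.integrable_comp_of_integrable hi
  · calc _ = ∫ p, (fun q : EuclideanSpace ℝ (Fin N) × EuclideanSpace ℝ (Fin N) =>
          f q.1 * g (-q.2)) (p.1, p.2 - p.1) ∂(volume.prod volume) := by
          refine integral_congr_ae (.of_forall fun p => ?_)
          simp
      _ = ∫ q : EuclideanSpace ℝ (Fin N) × EuclideanSpace ℝ (Fin N),
          f q.1 * g (-q.2) ∂(volume.prod volume) := by
          conv_rhs => rw [← hmp.map_eq]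
          rw [integral_map hmp.aemeasurable (by rw [hmp.map_eq]; exact hi.aestronglyMeasurable)]
      _ = (∫ x, f x) * ∫ z, g (-z) := integral_prod_mul f fun z => g (-z)
      _ = _ := by rw [integral_neg_eq_self g volume]

/-- Both sets of pairs contain those at distance exactly 1; this overlap is null because spheres
are. -/
theorem compl_nearPairs_ae_eq (hN : 1 ≤ N) :
    ((nearPairs N)ᶜ : Set _) =ᵐ[volume] farPairs N := by
  have : Nonempty (Fin N) := ⟨⟨0, hN⟩⟩
  have hmp := measurePreserving_prod_sub (volume : Measure (EuclideanSpace ℝ (Fin N)))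
      (volume : Measure (EuclideanSpace ℝ (Fin N)))
  have h0 : (volume : Measure (EuclideanSpace ℝ (Fin N) × EuclideanSpace ℝ (Fin N)))
      {p | ‖p.1 - p.2‖ = 1} = 0 := by
    have hs : MeasurableSet ((univ : Set (EuclideanSpace ℝ (Fin N))) ×ˢ
        Metric.sphere (0 : EuclideanSpace ℝ (Fin N)) 1) :=
      MeasurableSet.univ.prod Metric.isClosed_sphere.measurableSet
    have := hmp.measure_preimage hs.nullMeasurableSet
    rw [Measure.prod_prod, Measure.addHaar_sphere, mul_zero] at this
    rw [← this, Measure.volume_eq_prod]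
    congr 1
    ext p
    simp [norm_sub_rev]
  refine (ae_eq_set).2 ⟨?_, measure_mono_null (fun p hp => ?_) h0⟩
  · refine measure_mono_null (fun p hp => ?_) (measure_empty (μ := volume))
    simp only [nearPairs, farPairs, Set.mem_sdiff, mem_compl_iff, mem_ofPred_eq] at hp
    rw [not_le, not_le] at hp
    linarith [hp.1, hp.2]
  · simp only [nearPairs, farPairs, Set.mem_sdiff, mem_compl_iff, mem_ofPred_eq, not_not] at hp
    exact le_antisymm hp.2 hp.1

/-- Fubini for the representation of `c_N |z|^{-N}` as a superposition of Gaussian kernels. -/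
theorem integral_inv_mul_setIntegral_gaussKernel (hN : 1 ≤ N)
    {S : Set (EuclideanSpace ℝ (Fin N) × EuclideanSpace ℝ (Fin N))} (hS : MeasurableSet S)
    {Φ : EuclideanSpace ℝ (Fin N) × EuclideanSpace ℝ (Fin N) → ℝ} (hΦ : Measurable Φ)
    (h0 : ∀ p ∈ S, p.1 = p.2 → Φ p = 0)
    (hint : IntegrableOn (fun p => Φ p / ‖p.1 - p.2‖ ^ N) S) :
    IntegrableOn (fun s : ℝ => s⁻¹ * ∫ p in S, Φ p * gaussKernel N s (p.1 - p.2)) (Ioi 0) ∧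
    ∫ s in Ioi (0 : ℝ), s⁻¹ * ∫ p in S, Φ p * gaussKernel N s (p.1 - p.2) =
      cN N * ∫ p in S, Φ p / ‖p.1 - p.2‖ ^ N := by
  have hmeas : Measurable fun q : ℝ × (EuclideanSpace ℝ (Fin N) × EuclideanSpace ℝ (Fin N)) =>
      q.1⁻¹ * (Φ q.2 * gaussKernel N q.1 (q.2.1 - q.2.2)) := by
    have : Measurable fun q : ℝ × (EuclideanSpace ℝ (Fin N) × EuclideanSpace ℝ (Fin N)) =>
      gaussKernel N q.1 (q.2.1 - q.2.2) := by unfold gaussKernel; fun_prop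
    fun_prop
  have hsec : ∀ p ∈ S, IntegrableOn (fun s : ℝ => s⁻¹ * (Φ p * gaussKernel N s (p.1 - p.2))) (Ioi 0)
      ∧ ∫ s in Ioi (0 : ℝ), s⁻¹ * (Φ p * gaussKernel N s (p.1 - p.2)) =
        cN N * (Φ p / ‖p.1 - p.2‖ ^ N) := by
    intro p hp
    -- The subordination formula needs a nonzero argument; on the diagonal the numerator Φ vanishes
    -- instead.
    rcases eq_or_ne p.1 p.2 with h | h
    · simp [h0 p hp h]
    · obtain ⟨h1, h2⟩ := integral_inv_mul_gaussKernel hN (sub_ne_zero.2 h)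
      have e : (fun s : ℝ => s⁻¹ * (Φ p * gaussKernel N s (p.1 - p.2))) =
          fun s => Φ p * (s⁻¹ * gaussKernel N s (p.1 - p.2)) := by ext s; ring
      rw [e]
      refine ⟨h1.const_mul _, ?_⟩
      rw [integral_const_mul, h2]; ring
  have hnorm : ∀ p ∈ S, ∫ s in Ioi (0 : ℝ), ‖s⁻¹ * (Φ p * gaussKernel N s (p.1 - p.2))‖ =
      cN N * ‖Φ p / ‖p.1 - p.2‖ ^ N‖ := by
    intro p hp
    rcases eq_or_ne p.1 p.2 with h | h
    · simp [h0 p hp h]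
    · obtain ⟨h1, h2⟩ := integral_inv_mul_gaussKernel hN (sub_ne_zero.2 h)
      have e : EqOn (fun s : ℝ => ‖s⁻¹ * (Φ p * gaussKernel N s (p.1 - p.2))‖)
          (fun s => |Φ p| * (s⁻¹ * gaussKernel N s (p.1 - p.2))) (Ioi 0) := by
        intro s hs
        have hs : 0 < s := hs
        simp only [Real.norm_eq_abs, abs_mul]
        rw [abs_of_nonneg (gaussKernel_nonneg hs.le _), abs_of_pos (inv_pos.2 hs)]; ring
      rw [setIntegral_congr_fun measurableSet_Ioi e, integral_const_mul, h2, Real.norm_eq_abs,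
        abs_div, abs_of_nonneg (pow_nonneg (norm_nonneg (p.1 - p.2)) N)]; ring
  have hprod : Integrable (fun q : ℝ × (EuclideanSpace ℝ (Fin N) × EuclideanSpace ℝ (Fin N)) =>
      q.1⁻¹ * (Φ q.2 * gaussKernel N q.1 (q.2.1 - q.2.2)))
      ((volume.restrict (Ioi 0)).prod (volume.restrict S)) := by
    rw [integrable_prod_iff' hmeas.aestronglyMeasurable]
    refine ⟨(ae_restrict_iff' hS).2 (.of_forall fun p hp => (hsec p hp).1), ?_⟩
    refine (integrable_congr ((ae_restrict_iff' hS).2 (.of_forall fun p hp => ?_))).1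
      (hint.norm.const_mul (cN N))
    exact (hnorm p hp).symm
  have e : ∀ s : ℝ, s⁻¹ * ∫ p in S, Φ p * gaussKernel N s (p.1 - p.2) =
      ∫ p in S, s⁻¹ * (Φ p * gaussKernel N s (p.1 - p.2)) := fun s =>
    (integral_const_mul _ _).symm
  simp_rw [e]
  refine ⟨hprod.integral_prod_left, ?_⟩
  rw [integral_integral_swap hprod, ← integral_const_mul]
  exact setIntegral_congr_fun hS fun p hp => (hsec p hp).2

/-! ### The Fourier side and the Gaussian deficit. -/

/-- The squared modulus of the Fourier transform of a real function. -/
def fourierSq (u : EuclideanSpace ℝ (Fin N) → ℝ) (ξ : EuclideanSpace ℝ (Fin N)) : ℝ :=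
  (∫ x, u x * Real.cos (2 * Real.pi * inner ℝ x ξ)) ^ 2 +
    (∫ x, u x * Real.sin (2 * Real.pi * inner ℝ x ξ)) ^ 2

theorem integrable_mul_cos (hu : Integrable u) (ξ : EuclideanSpace ℝ (Fin N)) :
    Integrable fun x => u x * Real.cos (2 * Real.pi * inner ℝ x ξ) := by
  refine hu.mul_bdd (c := 1) (Measurable.aestronglyMeasurable (by fun_prop)) (.of_forall fun x => ?_)
  exact Real.abs_cos_le_one _

theorem integrable_mul_sin (hu : Integrable u) (ξ : EuclideanSpace ℝ (Fin N)) :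
    Integrable fun x => u x * Real.sin (2 * Real.pi * inner ℝ x ξ) := by
  refine hu.mul_bdd (c := 1) (Measurable.aestronglyMeasurable (by fun_prop)) (.of_forall fun x => ?_)
  exact Real.abs_sin_le_one _

theorem fourierSq_nonneg (u : EuclideanSpace ℝ (Fin N) → ℝ) (ξ : EuclideanSpace ℝ (Fin N)) :
    0 ≤ fourierSq u ξ := by
  unfold fourierSq; positivity

theorem continuous_fourierSq (hu : Integrable u) : Continuous (fourierSq u) := by
  refine Continuous.add (Continuous.pow ?_ 2) (Continuous.pow ?_ 2)
  · refine continuous_of_dominated (bound := fun x => ‖u x‖)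
      (fun ξ => (integrable_mul_cos hu ξ).aestronglyMeasurable)
      (fun ξ => .of_forall fun x => ?_) hu.norm (.of_forall fun x => by fun_prop)
    rw [norm_mul]
    exact mul_le_of_le_one_right (norm_nonneg _) (Real.abs_cos_le_one _)
  · refine continuous_of_dominated (bound := fun x => ‖u x‖)
      (fun ξ => (integrable_mul_sin hu ξ).aestronglyMeasurable)
      (fun ξ => .of_forall fun x => ?_) hu.norm (.of_forall fun x => by fun_prop)
    rw [norm_mul]
    exact mul_le_of_le_one_right (norm_nonneg _) (Real.abs_sin_le_one _)

theorem fourierSq_eq_integral (hu : Integrable u) (ξ : EuclideanSpace ℝ (Fin N)) :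
    fourierSq u ξ = ∫ p : EuclideanSpace ℝ (Fin N) × EuclideanSpace ℝ (Fin N),
      u p.1 * u p.2 * Real.cos (2 * Real.pi * inner ℝ (p.1 - p.2) ξ) := by
  have hc := integrable_mul_cos hu ξ
  have hs := integrable_mul_sin hu ξ
  rw [fourierSq, sq, sq, ← integral_prod_mul, ← integral_prod_mul,
    ← integral_add (hc.mul_prod hc) (hs.mul_prod hs), Measure.volume_eq_prod]
  refine integral_congr_ae (.of_forall fun p => ?_)
  simp only
  rw [inner_sub_left, mul_sub, Real.cos_sub]; ring

theorem fourierSq_le (hu : Integrable u) (ξ : EuclideanSpace ℝ (Fin N)) :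
    fourierSq u ξ ≤ (∫ x, ‖u x‖) ^ 2 := by
  rw [fourierSq_eq_integral hu, sq, ← integral_prod_mul, Measure.volume_eq_prod]
  refine (le_abs_self _).trans ((abs_integral_le_integral_abs).trans ?_)
  refine integral_mono_of_nonneg (.of_forall fun p => abs_nonneg _) (hu.norm.mul_prod hu.norm)
    (.of_forall fun p => ?_)
  simp only [abs_mul, Real.norm_eq_abs]
  exact mul_le_of_le_one_right (by positivity) (Real.abs_cos_le_one _)

theorem integrable_fourierSq_mul_exp (hu : Integrable u) {s : ℝ} (hs : 0 < s) :
    Integrable fun ξ => fourierSq u ξ * Real.exp (-(Real.pi ^ 2 * ‖ξ‖ ^ 2) / s) := by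
  refine (integrable_exp_neg_sq_div hs).bdd_mul (c := (∫ x, ‖u x‖) ^ 2)
    (continuous_fourierSq hu).aestronglyMeasurable (.of_forall fun ξ => ?_)
  rw [Real.norm_of_nonneg (fourierSq_nonneg u ξ)]
  exact fourierSq_le hu ξ

/-- Fubini and the Gaussian transform suffice for an integrable `u`: the Gaussian weight makes
everything absolutely convergent, so no Plancherel theorem is involved. -/
theorem integral_fourierSq_mul_exp (hu : Integrable u) {s : ℝ} (hs : 0 < s) :
    ∫ ξ, fourierSq u ξ * Real.exp (-(Real.pi ^ 2 * ‖ξ‖ ^ 2) / s) =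
      ∫ p : EuclideanSpace ℝ (Fin N) × EuclideanSpace ℝ (Fin N),
        u p.1 * u p.2 * gaussKernel N s (p.1 - p.2) := by
  have huu : Integrable (fun p : EuclideanSpace ℝ (Fin N) × EuclideanSpace ℝ (Fin N) =>
      u p.1 * u p.2) := hu.mul_prod hu
  have hprod : Integrable (fun q : EuclideanSpace ℝ (Fin N) ×
      (EuclideanSpace ℝ (Fin N) × EuclideanSpace ℝ (Fin N)) =>
      (Real.exp (-(Real.pi ^ 2 * ‖q.1‖ ^ 2) / s) * (u q.2.1 * u q.2.2)) *
        Real.cos (2 * Real.pi * inner ℝ (q.2.1 - q.2.2) q.1)) (volume.prod volume) := by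
    refine ((integrable_exp_neg_sq_div hs).mul_prod huu).mul_bdd (c := 1)
      (Measurable.aestronglyMeasurable (by fun_prop)) (.of_forall fun q => ?_)
    exact Real.abs_cos_le_one _
  calc _ = ∫ ξ, ∫ p : EuclideanSpace ℝ (Fin N) × EuclideanSpace ℝ (Fin N),
        (Real.exp (-(Real.pi ^ 2 * ‖ξ‖ ^ 2) / s) * (u p.1 * u p.2)) *
        Real.cos (2 * Real.pi * inner ℝ (p.1 - p.2) ξ) := by
        refine integral_congr_ae (.of_forall fun ξ => ?_)
        simp only
        rw [fourierSq_eq_integral hu, mul_comm, ← integral_const_mul]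
        simp only [mul_assoc]
    _ = _ := by
        rw [integral_integral_swap hprod]
        refine integral_congr_ae (.of_forall fun p => ?_)
        simp only
        rw [← integral_exp_mul_cos hs, ← integral_const_mul]
        refine integral_congr_ae (.of_forall fun ξ => ?_)
        simp only
        ring

theorem integrable_mul_mul_gaussKernel (hu : Integrable u) {s : ℝ} (hs : 0 < s) :
    Integrable fun p : EuclideanSpace ℝ (Fin N) × EuclideanSpace ℝ (Fin N) =>
      u p.1 * u p.2 * gaussKernel N s (p.1 - p.2) := by
  have huu : Integrable (fun p : EuclideanSpace ℝ (Fin N) × EuclideanSpace ℝ (Fin N) =>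
      u p.1 * u p.2) := hu.mul_prod hu
  refine huu.mul_bdd (c := (s / Real.pi) ^ ((N : ℝ) / 2))
    (Measurable.aestronglyMeasurable (by unfold gaussKernel; fun_prop)) (.of_forall fun p => ?_)
  rw [Real.norm_of_nonneg (gaussKernel_nonneg hs.le _)]
  exact gaussKernel_le hs.le _

/-- Splitting the deficit `∫ u² - ∬ u(x) u(y) q_s(x - y)` along near and far pairs. -/
theorem sub_integral_gaussKernel_eq (hN : 1 ≤ N) (hu : Integrable u)
    (hu2 : Integrable fun x => u x ^ 2) {s : ℝ} (hs : 0 < s) :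
    (∫ x, u x ^ 2) - ∫ p : EuclideanSpace ℝ (Fin N) × EuclideanSpace ℝ (Fin N),
        u p.1 * u p.2 * gaussKernel N s (p.1 - p.2) =
      1 / 2 * (∫ p in nearPairs N, (u p.1 - u p.2) ^ 2 * gaussKernel N s (p.1 - p.2))
      - (∫ p in farPairs N, u p.1 * u p.2 * gaussKernel N s (p.1 - p.2))
      + (∫ x, u x ^ 2) * gammaTail ((N : ℝ) / 2) s := by
  set K : EuclideanSpace ℝ (Fin N) × EuclideanSpace ℝ (Fin N) → ℝ :=
    fun p => gaussKernel N s (p.1 - p.2) with hK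
  have hB : Integrable fun p : EuclideanSpace ℝ (Fin N) × EuclideanSpace ℝ (Fin N) =>
      u p.1 * u p.2 * K p := integrable_mul_mul_gaussKernel hu hs
  obtain ⟨hA, hAint⟩ := integral_mul_comp_sub hu2 (integrable_gaussKernel hs)
  rw [integral_gaussKernel hs, mul_one] at hAint
  have hswap : MeasurePreserving (Prod.swap : EuclideanSpace ℝ (Fin N) × EuclideanSpace ℝ (Fin N) →
      _) volume volume := Measure.measurePreserving_swap
  have hemb : MeasurableEmbedding (Prod.swap : EuclideanSpace ℝ (Fin N) × EuclideanSpace ℝ (Fin N) →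
      EuclideanSpace ℝ (Fin N) × EuclideanSpace ℝ (Fin N)) :=
    MeasurableEquiv.prodComm.measurableEmbedding
  have hKs : ∀ p, K p.swap = K p := fun p => by
    simp only [hK, Prod.fst_swap, Prod.snd_swap]
    rw [← neg_sub, gaussKernel_neg]
  have hA' : Integrable fun p : EuclideanSpace ℝ (Fin N) × EuclideanSpace ℝ (Fin N) =>
      u p.2 ^ 2 * K p := by
    refine (integrable_congr (.of_forall fun p => ?_)).1 (hswap.integrable_comp_of_integrable hA)
    simp only [Function.comp_apply, Prod.fst_swap]
    exact congrArg _ (hKs p)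
  have hsymm : ∫ p in nearPairs N, u p.2 ^ 2 * K p = ∫ p in nearPairs N, u p.1 ^ 2 * K p := by
    have := hswap.setIntegral_preimage_emb hemb (fun p => u p.1 ^ 2 * K p) (nearPairs N)
    have hpre : Prod.swap ⁻¹' nearPairs N = nearPairs N := by
      ext p; simp [nearPairs, norm_sub_rev]
    rw [hpre] at this
    simpa only [hKs, Prod.fst_swap] using this
  have hfar : ∫ p in farPairs N, u p.1 ^ 2 * K p =
      (∫ x, u x ^ 2) * gammaTail ((N : ℝ) / 2) s := by
    have hS : MeasurableSet {z : EuclideanSpace ℝ (Fin N) | 1 ≤ ‖z‖} :=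
      measurableSet_le measurable_const measurable_norm
    rw [← setIntegral_gaussKernel_far hN hs, ← integral_indicator hS,
      ← (integral_mul_comp_sub hu2 ((integrable_gaussKernel hs).indicator hS)).2,
      ← integral_indicator (measurableSet_farPairs N)]
    refine integral_congr_ae (.of_forall fun p => ?_)
    by_cases h : 1 ≤ ‖p.1 - p.2‖ <;> simp [farPairs, indicator, h, hK]
  -- Near pairs are symmetric under exchange, so averaging u(x)² and u(y)² completes the square. Far
  -- pairs are left unsymmetrised, because their u(x)² part integrates to the Gaussian tail.
  have hnear : ∫ p in nearPairs N, (u p.1 ^ 2 * K p - u p.1 * u p.2 * K p) =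
      1 / 2 * ∫ p in nearPairs N, (u p.1 - u p.2) ^ 2 * K p := by
    have e : ∫ p in nearPairs N, (u p.1 - u p.2) ^ 2 * K p =
        ∫ p in nearPairs N, (u p.1 ^ 2 * K p + u p.2 ^ 2 * K p - 2 * (u p.1 * u p.2 * K p)) :=
      integral_congr_ae (.of_forall fun p => by ring)
    have hAA : IntegrableOn (fun p => u p.1 ^ 2 * K p + u p.2 ^ 2 * K p) (nearPairs N) :=
      hA.integrableOn.add hA'.integrableOn
    rw [e, integral_sub hAA (hB.integrableOn.const_mul 2),
      integral_add hA.integrableOn hA'.integrableOn, hsymm, integral_const_mul,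
      integral_sub hA.integrableOn hB.integrableOn]
    ring
  have hAB : Integrable fun p : EuclideanSpace ℝ (Fin N) × EuclideanSpace ℝ (Fin N) =>
      u p.1 ^ 2 * K p - u p.1 * u p.2 * K p := hA.sub hB
  calc _ = ∫ p : EuclideanSpace ℝ (Fin N) × EuclideanSpace ℝ (Fin N),
        (u p.1 ^ 2 * K p - u p.1 * u p.2 * K p) := by rw [integral_sub hA hB, hAint]
    _ = (∫ p in nearPairs N, (u p.1 ^ 2 * K p - u p.1 * u p.2 * K p)) +
        ∫ p in farPairs N, (u p.1 ^ 2 * K p - u p.1 * u p.2 * K p) := by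
        rw [← integral_add_compl (measurableSet_nearPairs N) hAB,
          setIntegral_congr_set (compl_nearPairs_ae_eq hN)]
    _ = _ := by
        rw [hnear, integral_sub (f := fun p => u p.1 ^ 2 * K p) hA.integrableOn hB.integrableOn,
          hfar]
        ring

theorem integrableOn_farPairs (hu : Integrable u) (hw : Integrable w) :
    IntegrableOn (fun p : EuclideanSpace ℝ (Fin N) × EuclideanSpace ℝ (Fin N) =>
      u p.1 * w p.2 / ‖p.1 - p.2‖ ^ N) (farPairs N) := by
  have huw : Integrable (fun p : EuclideanSpace ℝ (Fin N) × EuclideanSpace ℝ (Fin N) =>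
      u p.1 * w p.2) := hu.mul_prod hw
  have hd : Measurable fun p : EuclideanSpace ℝ (Fin N) × EuclideanSpace ℝ (Fin N) =>
    ‖p.1 - p.2‖ ^ N := by fun_prop
  have hm : AEMeasurable (fun p : EuclideanSpace ℝ (Fin N) × EuclideanSpace ℝ (Fin N) =>
      u p.1 * w p.2 / ‖p.1 - p.2‖ ^ N) (volume.restrict (farPairs N)) :=
    huw.aemeasurable.restrict.div hd.aemeasurable
  refine Integrable.mono (huw.integrableOn (s := farPairs N)) hm.aestronglyMeasurable ?_
  refine (ae_restrict_iff' (measurableSet_farPairs N)).2 (.of_forall fun p hp => ?_)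
  have hp : 1 ≤ ‖p.1 - p.2‖ := hp
  rw [norm_div, norm_pow, norm_norm]
  exact div_le_self (norm_nonneg _) (one_le_pow₀ hp)

/-! ### Integrated deficit, Plancherel, and domination of the logarithmic symbol. -/

/-- An antitone function integrable at infinity for `ds/s` tends to `0`. -/
theorem tendsto_zero_of_antitone_of_integrableOn {f : ℝ → ℝ} (hf : AntitoneOn f (Ioi 0))
    (hint : IntegrableOn (fun s => s⁻¹ * f s) (Ioi 1)) : Tendsto f atTop (𝓝 0) := by
  have key : ∀ c > 0, ∀ s₀ ≥ (1 : ℝ), ¬ ∀ s > s₀, c ≤ |f s| := by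
    intro c hc s₀ hs₀ h
    refine not_integrableOn_Ioi_inv (a := s₀) ?_
    refine ((hint.mono_set (Ioi_subset_Ioi hs₀)).const_mul c⁻¹).mono
      (Measurable.aestronglyMeasurable (by fun_prop)) ?_
    refine (ae_restrict_iff' measurableSet_Ioi).2 (.of_forall fun s hs => ?_)
    have hs' : 0 < s := by have : s₀ < s := hs; linarith
    rw [norm_mul, norm_mul, Real.norm_eq_abs (f s), norm_inv, norm_inv, Real.norm_of_nonneg hc.le]
    have := h s hs
    rw [mul_left_comm]
    refine le_mul_of_one_le_right (by positivity) ?_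
    rwa [← div_eq_inv_mul, one_le_div hc]
  rw [Metric.tendsto_atTop]
  intro c hc
  obtain ⟨s₁, hs₁, h₁⟩ : ∃ s₁ > (1 : ℝ), |f s₁| < c := by
    by_contra! hcon
    exact key c hc 1 le_rfl hcon
  refine ⟨s₁, fun s hs => ?_⟩
  rw [Real.dist_eq, sub_zero, abs_lt]
  have hs0 : 0 < s₁ := by linarith
  refine ⟨?_, (hf hs0 (hs0.trans_le hs) hs).trans_lt (abs_lt.1 h₁).2⟩
  -- Once f drops to -c it stays below by monotonicity, which is excluded by `key` just as |f| ≥ c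
  -- on a half-line is.
  by_contra! hcon
  refine key c hc s (hs₁.le.trans hs) fun t ht => ?_
  have : f t ≤ f s := hf (hs0.trans_le hs) (hs0.trans_le (hs.trans ht.le)) (le_of_lt ht)
  rw [abs_of_nonpos (by linarith)]
  linarith

theorem integrableOn_inv_mul_gammaTail {a ε : ℝ} (ha : 1 / 4 < a) (hε : 0 < ε) :
    IntegrableOn (fun s => s⁻¹ * gammaTail a s) (Ioi ε) := by
  have ha0 : 0 < a := by linarith
  have hanti : AntitoneOn (gammaTail a) (Ioi ε) := by
    intro s hs t ht hst
    refine mul_le_mul_of_nonneg_left ?_ (inv_nonneg.2 (Real.Gamma_pos_of_pos ha0).le)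
    have hpos : ∀ v ∈ Ici s, 0 < v := fun v hv => hε.trans (lt_of_lt_of_le hs hv)
    refine setIntegral_mono_set ((Real.GammaIntegral_convergent ha0).mono_set fun v hv => hpos v hv)
      ((ae_restrict_iff' measurableSet_Ici).2 (.of_forall fun v hv => ?_))
      (Ici_subset_Ici.2 hst).eventuallyLE
    have := hpos v hv
    simp only [Pi.zero_apply]
    positivity
  have hm : AEMeasurable (fun s => s⁻¹ * gammaTail a s) (volume.restrict (Ioi ε)) :=
    (Measurable.aemeasurable (by fun_prop)).mul
      (aemeasurable_restrict_of_antitoneOn measurableSet_Ioi hanti)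
  refine ⟨hm.aestronglyMeasurable, ?_⟩
  rw [hasFiniteIntegral_iff_ofReal]
  · exact (lintegral_inv_mul_gammaTail_le ha hε).trans_lt ENNReal.ofReal_lt_top
  · refine (ae_restrict_iff' measurableSet_Ioi).2 (.of_forall fun s hs => ?_)
    have hs : 0 < s := hε.trans hs
    exact mul_nonneg (inv_nonneg.2 hs.le) (gammaTail_nonneg ha0 hs)

/-- The upper bound for `∫_ε^∞ gammaTail a s ds/s`. -/
def tailBound (a ε : ℝ) : ℝ :=
  -Real.log ε + logDeriv Real.Gamma a + 4 * ε ^ (1 / 4 : ℝ) * Real.Gamma (a - 1 / 4) / Real.Gamma a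

theorem setIntegral_inv_mul_gammaTail_le {a ε : ℝ} (ha : 1 / 4 < a) (hε : 0 < ε)
    (h0 : 0 ≤ tailBound a ε) :
    ∫ s in Ioi ε, s⁻¹ * gammaTail a s ≤ tailBound a ε := by
  have ha0 : 0 < a := by linarith
  have hnn : 0 ≤ᵐ[volume.restrict (Ioi ε)] fun s => s⁻¹ * gammaTail a s := by
    refine (ae_restrict_iff' measurableSet_Ioi).2 (.of_forall fun s hs => ?_)
    have hs : 0 < s := hε.trans hs
    exact mul_nonneg (inv_nonneg.2 hs.le) (gammaTail_nonneg ha0 hs)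
  have := lintegral_inv_mul_gammaTail_le ha hε
  rw [← ofReal_integral_eq_lintegral_ofReal (integrableOn_inv_mul_gammaTail ha hε) hnn] at this
  exact (ENNReal.ofReal_le_ofReal_iff h0).1 this

theorem tendsto_tailBound_add_log (a : ℝ) :
    Tendsto (fun ε => tailBound a ε + Real.log ε) (𝓝[>] 0) (𝓝 (logDeriv Real.Gamma a)) := by
  have h : Tendsto (fun ε : ℝ => ε ^ (1 / 4 : ℝ)) (𝓝[>] 0) (𝓝 0) := by
    have := (Real.continuousAt_rpow_const 0 (1 / 4 : ℝ) (Or.inr (by norm_num))).tendsto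
    rw [Real.zero_rpow (by norm_num)] at this
    exact this.mono_left nhdsWithin_le_nhds
  have h2 := ((h.const_mul 4).mul_const (Real.Gamma (a - 1 / 4))).div_const (Real.Gamma a)
  have h3 := h2.const_add (logDeriv Real.Gamma a)
  simp only [mul_zero, zero_mul, zero_div, add_zero] at h3
  refine h3.congr fun ε => ?_
  unfold tailBound; ring

theorem eventually_tailBound_nonneg (a : ℝ) : ∀ᶠ ε in 𝓝[>] 0, 0 ≤ tailBound a ε := by
  have h1 : Tendsto (fun ε => (tailBound a ε + Real.log ε) + -Real.log ε) (𝓝[>] 0) atTop :=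
    (tendsto_tailBound_add_log a).add_atTop
      (tendsto_neg_atBot_atTop.comp Real.tendsto_log_nhdsGT_zero)
  filter_upwards [h1.eventually_ge_atTop 0] with ε hε
  linarith

/-- The deficit `∫ u² - ∫ |û|² e^{-π²|ξ|²/s} dξ`. -/
def deficit (u : EuclideanSpace ℝ (Fin N) → ℝ) (s : ℝ) : ℝ :=
  (∫ x, u x ^ 2) - ∫ ξ, fourierSq u ξ * Real.exp (-(Real.pi ^ 2 * ‖ξ‖ ^ 2) / s)

theorem exp_neg_div_mono {c s t : ℝ} (hc : 0 ≤ c) (hs : 0 < s) (hst : s ≤ t) :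
    Real.exp (-c / s) ≤ Real.exp (-c / t) := by
  rw [Real.exp_le_exp, neg_div, neg_div, neg_le_neg_iff]
  gcongr

theorem antitoneOn_deficit (hu : Integrable u) : AntitoneOn (deficit u) (Ioi 0) := by
  intro s hs t ht hst
  refine sub_le_sub_left (integral_mono (integrable_fourierSq_mul_exp hu hs)
    (integrable_fourierSq_mul_exp hu ht) fun ξ => ?_) _
  exact mul_le_mul_of_nonneg_left (exp_neg_div_mono (by positivity) hs hst) (fourierSq_nonneg u ξ)

/-- The integrals over `s > ε` of the near and far parts of the deficit. -/
theorem MemH.integral_inv_mul_deficit (hN : 1 ≤ N) (hu : MemH Ω u) (hu1 : Integrable u)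
    (hu2 : Integrable fun x => u x ^ 2) {ε : ℝ} (hε : 0 < ε) :
    IntegrableOn (fun s => s⁻¹ * deficit u s) (Ioi ε) ∧
    ∫ s in Ioi ε, s⁻¹ * deficit u s ≤ energy u u
      - (∫ s in Ioi ε, s⁻¹ * ∫ p in farPairs N, u p.1 * u p.2 * gaussKernel N s (p.1 - p.2))
      + (∫ x, u x ^ 2) * ∫ s in Ioi ε, s⁻¹ * gammaTail ((N : ℝ) / 2) s := by
  have hmeas := hu.measurable
  have ha : 1 / 4 < (N : ℝ) / 2 := by
    have : (1 : ℝ) ≤ N := by exact_mod_cast hN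
    linarith
  have hsub : Ioi ε ⊆ Ioi 0 := Ioi_subset_Ioi hε.le
  obtain ⟨n1, n2⟩ := integral_inv_mul_setIntegral_gaussKernel hN (measurableSet_nearPairs N)
    (Φ := fun p => (u p.1 - u p.2) ^ 2) (by fun_prop) (fun p _ h => by simp [h]) hu.finite_energy
  obtain ⟨f1, f2⟩ := integral_inv_mul_setIntegral_gaussKernel hN (measurableSet_farPairs N)
    (Φ := fun p => u p.1 * u p.2) (by fun_prop)
    (fun p hp h => by
      have hp : 1 ≤ ‖p.1 - p.2‖ := hp
      simp [h] at hp
      linarith) (integrableOn_farPairs hu1 hu1)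
  have g1 := integrableOn_inv_mul_gammaTail ha hε
  have e : EqOn (fun s => 1 / 2 * (s⁻¹ * ∫ p in nearPairs N,
        (u p.1 - u p.2) ^ 2 * gaussKernel N s (p.1 - p.2))
      - (s⁻¹ * ∫ p in farPairs N, u p.1 * u p.2 * gaussKernel N s (p.1 - p.2))
      + (∫ x, u x ^ 2) * (s⁻¹ * gammaTail ((N : ℝ) / 2) s)) (fun s => s⁻¹ * deficit u s) (Ioi ε) := by
    intro s hs
    have hs : 0 < s := hε.trans hs
    simp only [deficit]
    rw [integral_fourierSq_mul_exp hu1 hs, sub_integral_gaussKernel_eq hN hu1 hu2 hs]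
    ring
  have i1 := (n1.mono_set hsub).const_mul (1 / 2)
  have i2 := f1.mono_set hsub
  have i3 := g1.const_mul (∫ x, u x ^ 2)
  have i12 : IntegrableOn (fun s => 1 / 2 * (s⁻¹ * ∫ p in nearPairs N,
        (u p.1 - u p.2) ^ 2 * gaussKernel N s (p.1 - p.2))
      - (s⁻¹ * ∫ p in farPairs N, u p.1 * u p.2 * gaussKernel N s (p.1 - p.2))) (Ioi ε) := i1.sub i2
  refine ⟨(integrableOn_congr_fun e measurableSet_Ioi).1 (i12.add i3), ?_⟩
  rw [← setIntegral_congr_fun measurableSet_Ioi e, integral_add i12 i3, integral_sub i1 i2,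
    integral_const_mul, integral_const_mul]
  -- The near integrand is nonnegative, so the range may be enlarged to s > 0, where subordination
  -- returns the energy. The far integrand has no sign and keeps the range s > ε until the limit.
  have hle : 1 / 2 * ∫ s in Ioi ε, s⁻¹ * ∫ p in nearPairs N,
      (u p.1 - u p.2) ^ 2 * gaussKernel N s (p.1 - p.2) ≤ energy u u := by
    have : ∫ s in Ioi ε, s⁻¹ * ∫ p in nearPairs N,
        (u p.1 - u p.2) ^ 2 * gaussKernel N s (p.1 - p.2) ≤
        ∫ s in Ioi 0, s⁻¹ * ∫ p in nearPairs N,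
        (u p.1 - u p.2) ^ 2 * gaussKernel N s (p.1 - p.2) := by
      refine setIntegral_mono_set n1 ((ae_restrict_iff' measurableSet_Ioi).2
        (.of_forall fun s hs => ?_)) hsub.eventuallyLE
      have hs : 0 < s := hs
      refine mul_nonneg (inv_nonneg.2 hs.le) (integral_nonneg fun p => ?_)
      exact mul_nonneg (sq_nonneg _) (gaussKernel_nonneg hs.le _)
    rw [n2] at this
    rw [energy]
    simp only [← sq]
    linarith
  linarith

/-- Plancherel's identity, for functions of finite energy. -/
theorem MemH.integral_fourierSq (hN : 1 ≤ N) (hu : MemH Ω u) (hu1 : Integrable u)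
    (hu2 : Integrable fun x => u x ^ 2) :
    Integrable (fourierSq u) ∧ ∫ ξ, fourierSq u ξ = ∫ x, u x ^ 2 := by
  have hn : 0 ≤ ∫ x, u x ^ 2 := integral_nonneg fun x => sq_nonneg _
  -- The deficit is antitone and integrable at infinity for ds/s, hence tends to 0. Monotone
  -- convergence of the Gaussian weights to 1 then yields Plancherel's identity.
  have h0 := tendsto_zero_of_antitone_of_integrableOn (antitoneOn_deficit hu1)
    (hu.integral_inv_mul_deficit hN hu1 hu2 one_pos).1
  have hseq : Tendsto (fun m : ℕ => (m : ℝ) + 1) atTop atTop :=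
    tendsto_atTop_add_const_right _ _ tendsto_natCast_atTop_atTop
  have h1 : Tendsto (fun m : ℕ => ∫ ξ, fourierSq u ξ *
      Real.exp (-(Real.pi ^ 2 * ‖ξ‖ ^ 2) / ((m : ℝ) + 1))) atTop (𝓝 (∫ x, u x ^ 2)) := by
    have := (h0.comp hseq).const_sub (∫ x, u x ^ 2)
    rw [sub_zero] at this
    refine this.congr fun m => ?_
    simp [deficit]
  have hexp : ∀ ξ : EuclideanSpace ℝ (Fin N), Tendsto (fun m : ℕ => ENNReal.ofReal (fourierSq u ξ *
      Real.exp (-(Real.pi ^ 2 * ‖ξ‖ ^ 2) / ((m : ℝ) + 1)))) atTop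
      (𝓝 (ENNReal.ofReal (fourierSq u ξ))) := by
    intro ξ
    refine ENNReal.tendsto_ofReal ?_
    have h := (tendsto_const_nhds (x := -(Real.pi ^ 2 * ‖ξ‖ ^ 2))).div_atTop hseq
    have := ((Real.continuous_exp.tendsto 0).comp h).const_mul (fourierSq u ξ)
    simpa using this
  have hlim := lintegral_tendsto_of_tendsto_of_monotone (μ := volume)
    (fun m => (integrable_fourierSq_mul_exp hu1 (s := (m : ℝ) + 1)
      (by positivity)).aestronglyMeasurable.aemeasurable.ennreal_ofReal)
    (.of_forall fun ξ => fun m l hml => ENNReal.ofReal_le_ofReal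
      (mul_le_mul_of_nonneg_left (exp_neg_div_mono (by positivity) (by positivity)
        (by have : (m : ℝ) ≤ l := by exact_mod_cast hml
            linarith)) (fourierSq_nonneg u ξ)))
    (.of_forall hexp)
  have hval : ∫⁻ ξ, ENNReal.ofReal (fourierSq u ξ) = ENNReal.ofReal (∫ x, u x ^ 2) := by
    refine tendsto_nhds_unique hlim ((ENNReal.tendsto_ofReal h1).congr fun m => ?_)
    exact ofReal_integral_eq_lintegral_ofReal
      (integrable_fourierSq_mul_exp hu1 (by positivity))
      (.of_forall fun ξ => mul_nonneg (fourierSq_nonneg u ξ) (Real.exp_pos _).le)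
  have hint : Integrable (fourierSq u) := by
    refine ⟨(continuous_fourierSq hu1).aestronglyMeasurable, ?_⟩
    rw [hasFiniteIntegral_iff_ofReal (.of_forall (fourierSq_nonneg u)), hval]
    exact ENNReal.ofReal_lt_top
  refine ⟨hint, ?_⟩
  rw [integral_eq_lintegral_of_nonneg_ae (.of_forall (fourierSq_nonneg u))
    hint.aestronglyMeasurable, hval, ENNReal.toReal_ofReal hn]

/-- The weighted integral of `|û|²` against `log (π²|ξ|²/ε) + γ`. -/
theorem MemH.lintegral_fourierSq_mul_log_le (hN : 1 ≤ N) (hu : MemH Ω u) (hu1 : Integrable u)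
    (hu2 : Integrable fun x => u x ^ 2) {ε : ℝ} (hε : 0 < ε) :
    ∫⁻ ξ, ENNReal.ofReal (fourierSq u ξ *
      (Real.log (Real.pi ^ 2 * ‖ξ‖ ^ 2 / ε) + Real.eulerMascheroniConstant)) ≤
    ENNReal.ofReal (∫ s in Ioi ε, s⁻¹ * deficit u s) := by
  have : Nonempty (Fin N) := ⟨⟨0, hN⟩⟩
  have hpi := Real.pi_pos
  obtain ⟨hF, hFint⟩ := hu.integral_fourierSq hN hu1 hu2
  have hFm : Measurable (fourierSq u) := (continuous_fourierSq hu1).measurable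
  have hdef : ∀ s, 0 < s → Integrable (fun ξ => fourierSq u ξ *
        (1 - Real.exp (-(Real.pi ^ 2 * ‖ξ‖ ^ 2) / s))) ∧
      deficit u s = ∫ ξ, fourierSq u ξ * (1 - Real.exp (-(Real.pi ^ 2 * ‖ξ‖ ^ 2) / s)) := by
    intro s hs
    have e : (fun ξ => fourierSq u ξ * (1 - Real.exp (-(Real.pi ^ 2 * ‖ξ‖ ^ 2) / s))) =
        fun ξ => fourierSq u ξ - fourierSq u ξ * Real.exp (-(Real.pi ^ 2 * ‖ξ‖ ^ 2) / s) := by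
      ext ξ; ring
    rw [e]
    refine ⟨hF.sub (integrable_fourierSq_mul_exp hu1 hs), ?_⟩
    rw [integral_sub hF (integrable_fourierSq_mul_exp hu1 hs), deficit, hFint]
  have hnn : ∀ s, 0 < s → ∀ ξ : EuclideanSpace ℝ (Fin N),
      0 ≤ 1 - Real.exp (-(Real.pi ^ 2 * ‖ξ‖ ^ 2) / s) := by
    intro s hs ξ
    rw [sub_nonneg, Real.exp_le_one_iff, neg_div]
    have : 0 ≤ Real.pi ^ 2 * ‖ξ‖ ^ 2 / s := by positivity
    linarith
  have hae : ∀ᵐ ξ : EuclideanSpace ℝ (Fin N), ξ ≠ 0 := by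
    simp [ae_iff]
  calc _ ≤ ∫⁻ ξ, ENNReal.ofReal (fourierSq u ξ) * ∫⁻ s in Ioi ε,
        ENNReal.ofReal (s⁻¹ * (1 - Real.exp (-(Real.pi ^ 2 * ‖ξ‖ ^ 2) / s))) := by
        refine lintegral_mono_ae ?_
        filter_upwards [hae] with ξ hξ
        rw [ENNReal.ofReal_mul (fourierSq_nonneg u ξ)]
        have : 0 < ‖ξ‖ := norm_pos_iff.2 hξ
        gcongr
        exact ofReal_log_add_euler_le (by positivity) hε
    _ = ∫⁻ ξ, ∫⁻ s in Ioi ε, ENNReal.ofReal (fourierSq u ξ) *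
        ENNReal.ofReal (s⁻¹ * (1 - Real.exp (-(Real.pi ^ 2 * ‖ξ‖ ^ 2) / s))) := by
        refine lintegral_congr fun ξ => ?_
        rw [lintegral_const_mul _ (by fun_prop)]
    _ = ∫⁻ s in Ioi ε, ∫⁻ ξ, ENNReal.ofReal (fourierSq u ξ) *
        ENNReal.ofReal (s⁻¹ * (1 - Real.exp (-(Real.pi ^ 2 * ‖ξ‖ ^ 2) / s))) :=
        lintegral_lintegral_swap (Measurable.aemeasurable (by fun_prop))
    _ = ∫⁻ s in Ioi ε, ENNReal.ofReal (s⁻¹ * deficit u s) := by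
        refine setLIntegral_congr_fun measurableSet_Ioi fun s hs => ?_
        have hs : 0 < s := hε.trans hs
        obtain ⟨h1, h2⟩ := hdef s hs
        rw [h2, ← integral_const_mul, ofReal_integral_eq_lintegral_ofReal (h1.const_mul _)]
        · refine lintegral_congr fun ξ => ?_
          rw [← ENNReal.ofReal_mul (fourierSq_nonneg u ξ)]
          congr 1; ring
        · exact .of_forall fun ξ => mul_nonneg (inv_nonneg.2 hs.le)
            (mul_nonneg (fourierSq_nonneg u ξ) (hnn s hs ξ))
    _ = _ := by
        refine (ofReal_integral_eq_lintegral_ofReal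
          (hu.integral_inv_mul_deficit hN hu1 hu2 hε).1 ?_).symm
        refine (ae_restrict_iff' measurableSet_Ioi).2 (.of_forall fun s hs => ?_)
        have hs : 0 < s := hε.trans hs
        refine mul_nonneg (inv_nonneg.2 hs.le) ?_
        rw [(hdef s hs).2]
        exact integral_nonneg fun ξ => mul_nonneg (fourierSq_nonneg u ξ) (hnn s hs ξ)

theorem integrableOn_ball_log_norm (hN : 1 ≤ N) (r : ℝ) :
    IntegrableOn (fun ξ : EuclideanSpace ℝ (Fin N) => Real.log ‖ξ‖) (Metric.ball 0 r) := by
  have : Nonempty (Fin N) := ⟨⟨0, hN⟩⟩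
  rw [integrableOn_fun_norm_addHaar volume (f := Real.log)]
  rcases le_or_gt r 0 with hr | hr
  · rw [Ioo_eq_empty (not_lt.2 hr)]; exact integrableOn_empty
  have h : IntegrableOn Real.log (Ioo 0 r) :=
    (intervalIntegral.intervalIntegrable_log'.1 : IntegrableOn Real.log (Ioc 0 r)).mono_set
      Ioo_subset_Ioc_self
  simp only [smul_eq_mul]
  refine h.bdd_mul (c := r ^ (Module.finrank ℝ (EuclideanSpace ℝ (Fin N)) - 1))
    (Measurable.aestronglyMeasurable (by fun_prop)) ?_
  refine (ae_restrict_iff' measurableSet_Ioo).2 (.of_forall fun y hy => ?_)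
  rw [norm_pow, Real.norm_of_nonneg hy.1.le]
  exact pow_le_pow_left₀ hy.1.le hy.2.le _

/-- Inside the unit ball |û|² is bounded and log|ξ| is integrable. Outside it the weight log(π²|ξ|²)
+ γ is nonnegative, so the truncated bound with ε = 1 controls the whole integral. -/
theorem MemH.integrable_fourierSq_mul_log (hN : 1 ≤ N) (hu : MemH Ω u) (hu1 : Integrable u)
    (hu2 : Integrable fun x => u x ^ 2) :
    Integrable fun ξ => fourierSq u ξ * Real.log ‖ξ‖ := by
  have : Nonempty (Fin N) := ⟨⟨0, hN⟩⟩
  have hpi := Real.pi_pos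
  obtain ⟨hF, hFint⟩ := hu.integral_fourierSq hN hu1 hu2
  have hFm : Measurable (fourierSq u) := (continuous_fourierSq hu1).measurable
  rw [← integrableOn_univ, ← union_compl_self (Metric.ball (0 : EuclideanSpace ℝ (Fin N)) 1)]
  refine IntegrableOn.union ?_ ?_
  · refine (integrableOn_ball_log_norm hN 1).bdd_mul (c := (∫ x, ‖u x‖) ^ 2)
      hFm.aestronglyMeasurable (.of_forall fun ξ => ?_)
    rw [Real.norm_of_nonneg (fourierSq_nonneg u ξ)]
    exact fourierSq_le hu1 ξ
  · set G : EuclideanSpace ℝ (Fin N) → ℝ := fun ξ => fourierSq u ξ *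
      (Real.log (Real.pi ^ 2 * ‖ξ‖ ^ 2 / 1) + Real.eulerMascheroniConstant) with hG
    have hmS : MeasurableSet (Metric.ball (0 : EuclideanSpace ℝ (Fin N)) 1)ᶜ :=
      measurableSet_ball.compl
    have hlog : ∀ ξ ∈ (Metric.ball (0 : EuclideanSpace ℝ (Fin N)) 1)ᶜ,
        0 ≤ Real.log ‖ξ‖ ∧ Real.log (Real.pi ^ 2 * ‖ξ‖ ^ 2 / 1) =
          2 * Real.log Real.pi + 2 * Real.log ‖ξ‖ := by
      intro ξ hξ
      have h1 : 1 ≤ ‖ξ‖ := by simpa using hξ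
      refine ⟨Real.log_nonneg h1, ?_⟩
      rw [div_one, Real.log_mul (by positivity) (by positivity), Real.log_pow, Real.log_pow]
      push_cast; ring
    have hGint : IntegrableOn G (Metric.ball (0 : EuclideanSpace ℝ (Fin N)) 1)ᶜ := by
      refine ⟨Measurable.aestronglyMeasurable (by fun_prop), ?_⟩
      rw [hasFiniteIntegral_iff_ofReal]
      · refine (setLIntegral_le_lintegral _ _).trans_lt ?_
        exact (hu.lintegral_fourierSq_mul_log_le hN hu1 hu2 one_pos).trans_lt ENNReal.ofReal_lt_top
      · refine (ae_restrict_iff' hmS).2 (.of_forall fun ξ hξ => ?_)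
        obtain ⟨h1, h2⟩ := hlog ξ hξ
        have h3 : 0 ≤ Real.log Real.pi := Real.log_nonneg (by linarith [Real.pi_gt_three])
        have h4 := Real.one_half_lt_eulerMascheroniConstant
        simp only [hG]
        rw [h2]
        exact mul_nonneg (fourierSq_nonneg u ξ) (by linarith)
    refine (integrableOn_congr_fun (fun ξ hξ => ?_) hmS).1 ((hGint.const_mul (1 / 2)).sub
      (hF.integrableOn.mul_const (Real.log Real.pi + Real.eulerMascheroniConstant / 2)))
    simp only [hG, Pi.sub_apply]
    rw [(hlog ξ hξ).2]; ring

/-- The quadratic form of the logarithmic Laplacian dominates `∫ 2 log (2π|ξ|) |û|²`. -/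
theorem MemH.integral_fourierSq_mul_log_le_logForm (hN : 1 ≤ N) (hu : MemH Ω u)
    (hu1 : Integrable u) (hu2 : Integrable fun x => u x ^ 2) :
    ∫ ξ, fourierSq u ξ * (2 * Real.log (2 * Real.pi) + 2 * Real.log ‖ξ‖) ≤ logForm u u := by
  have : Nonempty (Fin N) := ⟨⟨0, hN⟩⟩
  have hpi := Real.pi_pos
  have ha : 1 / 4 < (N : ℝ) / 2 := by
    have : (1 : ℝ) ≤ N := by exact_mod_cast hN
    linarith
  obtain ⟨hF, hFint⟩ := hu.integral_fourierSq hN hu1 hu2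
  have hL := hu.integrable_fourierSq_mul_log hN hu1 hu2
  set n := ∫ x, u x ^ 2 with hn
  have hn0 : 0 ≤ n := integral_nonneg fun x => sq_nonneg _
  set J := ∫ ξ, fourierSq u ξ * Real.log ‖ξ‖ with hJ
  have hlin : ∀ α β : ℝ, Integrable (fun ξ => fourierSq u ξ * (α + β * Real.log ‖ξ‖)) ∧
      ∫ ξ, fourierSq u ξ * (α + β * Real.log ‖ξ‖) = α * n + β * J := by
    intro α β
    have e : (fun ξ => fourierSq u ξ * (α + β * Real.log ‖ξ‖)) =
        fun ξ => α * fourierSq u ξ + β * (fourierSq u ξ * Real.log ‖ξ‖) := by ext ξ; ring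
    rw [e]
    refine ⟨(hF.const_mul _).add (hL.const_mul _), ?_⟩
    rw [integral_add (hF.const_mul _) (hL.const_mul _), integral_const_mul, integral_const_mul,
      hFint]
  set P2 : ℝ → ℝ := fun s => s⁻¹ * ∫ p in farPairs N,
    u p.1 * u p.2 * gaussKernel N s (p.1 - p.2) with hP2
  have hmeas := hu.measurable
  obtain ⟨f1, f2⟩ := integral_inv_mul_setIntegral_gaussKernel hN (measurableSet_farPairs N)
    (Φ := fun p => u p.1 * u p.2) (by fun_prop)
    (fun p hp h => by
      have hp : 1 ≤ ‖p.1 - p.2‖ := hp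
      simp [h] at hp
      linarith) (integrableOn_farPairs hu1 hu1)
  -- The Fourier lower bound and the tail upper bound both carry -log ε times ∫u². Once these are
  -- cancelled, every ε-dependent term has a limit as ε → 0⁺.
  have hstep : ∀ ε, 0 < ε → 0 ≤ tailBound ((N : ℝ) / 2) ε →
      (2 * Real.log Real.pi + Real.eulerMascheroniConstant) * n + 2 * J ≤
        energy u u - (∫ s in Ioi ε, P2 s) +
          n * (tailBound ((N : ℝ) / 2) ε + Real.log ε) := by
    intro ε hε h0
    have h1 := hu.lintegral_fourierSq_mul_log_le hN hu1 hu2 hε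
    obtain ⟨i1, v1⟩ := hlin (2 * Real.log Real.pi - Real.log ε + Real.eulerMascheroniConstant) 2
    have hae : ∀ᵐ ξ : EuclideanSpace ℝ (Fin N), fourierSq u ξ *
        (Real.log (Real.pi ^ 2 * ‖ξ‖ ^ 2 / ε) + Real.eulerMascheroniConstant) = fourierSq u ξ *
        (2 * Real.log Real.pi - Real.log ε + Real.eulerMascheroniConstant
          + 2 * Real.log ‖ξ‖) := by
      have : ∀ᵐ ξ : EuclideanSpace ℝ (Fin N), ξ ≠ 0 := by simp [ae_iff]
      filter_upwards [this] with ξ hξ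
      have : 0 < ‖ξ‖ := norm_pos_iff.2 hξ
      rw [Real.log_div (by positivity) hε.ne', Real.log_mul (by positivity) (by positivity),
        Real.log_pow, Real.log_pow]
      push_cast; ring
    have hnonneg : 0 ≤ ∫ s in Ioi ε, s⁻¹ * deficit u s := by
      refine setIntegral_nonneg measurableSet_Ioi fun s hs => ?_
      have hs : 0 < s := hε.trans hs
      refine mul_nonneg (inv_nonneg.2 hs.le) ?_
      rw [deficit, ← hn, ← hFint, sub_nonneg]
      refine integral_mono (integrable_fourierSq_mul_exp hu1 hs) hF fun ξ => ?_
      refine mul_le_of_le_one_right (fourierSq_nonneg u ξ) ?_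
      rw [Real.exp_le_one_iff, neg_div]
      have : 0 ≤ Real.pi ^ 2 * ‖ξ‖ ^ 2 / s := by positivity
      linarith
    rw [lintegral_congr_ae (hae.mono fun ξ h => by rw [h])] at h1
    have h2 := (ENNReal.ofReal_le_ofReal_iff hnonneg).1
      ((ofReal_integral_le_lintegral i1).trans h1)
    rw [v1] at h2
    have h3 := (hu.integral_inv_mul_deficit hN hu1 hu2 hε).2
    have h4 := mul_le_mul_of_nonneg_left (setIntegral_inv_mul_gammaTail_le ha hε h0) hn0
    rw [← hn] at h3
    have h5 : (2 * Real.log Real.pi - Real.log ε + Real.eulerMascheroniConstant) * n + 2 * J ≤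
      energy u u - (∫ s in Ioi ε, P2 s) + n * tailBound ((N : ℝ) / 2) ε :=
        h2.trans (h3.trans (by linarith))
    linarith
  have hlimP : Tendsto (fun ε => ∫ s in Ioi ε, P2 s) (𝓝[>] 0) (𝓝 (∫ s in Ioi 0, P2 s)) := by
    have hcov : AECover (volume.restrict (Ioi (0 : ℝ))) (𝓝[>] 0) fun ε => Ioi ε :=
      aecover_Ioi_of_Ioi (tendsto_id.mono_right nhdsWithin_le_nhds)
    refine (hcov.integral_tendsto_of_countably_generated f1).congr' ?_
    filter_upwards [self_mem_nhdsWithin] with ε hε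
    have hε : 0 < ε := hε
    rw [Measure.restrict_restrict measurableSet_Ioi, inter_eq_left.2 (Ioi_subset_Ioi hε.le)]
  have hlim := (hlimP.const_sub (energy u u)).add
    ((tendsto_tailBound_add_log ((N : ℝ) / 2)).const_mul n)
  have hfinal := ge_of_tendsto hlim (by
    filter_upwards [self_mem_nhdsWithin, eventually_tailBound_nonneg ((N : ℝ) / 2)] with ε hε h0
    exact hstep ε hε h0)
  rw [f2] at hfinal
  -- Adding (2 log 2 - γ)∫u² to both sides turns 2 log π + γ into 2 log(2π), and ψ(N/2) into ρ_N.
  rw [(hlin _ _).2, logForm, rhoN, Real.log_mul two_ne_zero hpi.ne']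
  simp only [← sq]
  rw [← hn]
  linarith

/-! ### Bessel, bathtub and the strict Berezin–Li–Yau inequality. -/

theorem inner_toLp_eq_integral {X : Type*} [MeasurableSpace X] {μ : Measure X} {f g : X → ℝ}
    (hf : MemLp f 2 μ) (hg : MemLp g 2 μ) :
    inner ℝ (hf.toLp f) (hg.toLp g) = ∫ x, f x * g x ∂μ := by
  rw [L2.inner_def]
  refine integral_congr_ae ?_
  filter_upwards [hf.coeFn_toLp, hg.coeFn_toLp] with x h1 h2
  rw [h1, h2]
  simp [mul_comm]

theorem sum_sq_integral_mul_le {X : Type*} [MeasurableSpace X] {μ : Measure X} {k : ℕ}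
    {u : Fin k → X → ℝ} (hu : ∀ i, MemLp (u i) 2 μ)
    (horth : ∀ i j, ∫ x, u i x * u j x ∂μ = if i = j then 1 else 0) {g : X → ℝ}
    (hg : MemLp g 2 μ) : ∑ i, (∫ x, u i x * g x ∂μ) ^ 2 ≤ ∫ x, g x ^ 2 ∂μ := by
  have ho : Orthonormal ℝ fun i => (hu i).toLp (u i) := by
    rw [orthonormal_iff_ite]
    intro i j
    rw [inner_toLp_eq_integral, horth]
  have h := ho.sum_inner_products_le (hg.toLp g) (s := Finset.univ)
  rw [← real_inner_self_eq_norm_sq, inner_toLp_eq_integral] at h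
  simp only [inner_toLp_eq_integral, Real.norm_eq_abs, sq_abs] at h
  simpa only [← sq] using h

theorem setIntegral_eq_of_eq_zero {f : EuclideanSpace ℝ (Fin N) → ℝ} (h : ∀ x ∉ Ω, f x = 0) :
    ∫ x in Ω, f x = ∫ x, f x :=
  setIntegral_eq_integral_of_forall_compl_eq_zero h

/-- Bessel's inequality for the cosine and the sine of frequency ξ restricted to Ω; the squares of
these two functions add up to 1. -/
theorem sum_fourierSq_le (hb : Bornology.IsBounded Ω) {k : ℕ}
    {u : Fin k → EuclideanSpace ℝ (Fin N) → ℝ} (hu : ∀ i, MemLp (u i) 2)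
    (h0 : ∀ i, ∀ x ∉ Ω, u i x = 0)
    (horth : ∀ i j, ∫ x in Ω, u i x * u j x = if i = j then 1 else 0)
    (ξ : EuclideanSpace ℝ (Fin N)) : ∑ i, fourierSq (u i) ξ ≤ volume.real Ω := by
  have : IsFiniteMeasure (volume.restrict Ω) := ⟨by simpa using hb.measure_lt_top⟩
  have hc : MemLp (fun x : EuclideanSpace ℝ (Fin N) => Real.cos (2 * Real.pi * inner ℝ x ξ)) 2
      (volume.restrict Ω) :=
    MemLp.of_bound (Measurable.aestronglyMeasurable (by fun_prop)) 1
      (.of_forall fun x => Real.abs_cos_le_one _)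
  have hs : MemLp (fun x : EuclideanSpace ℝ (Fin N) => Real.sin (2 * Real.pi * inner ℝ x ξ)) 2
      (volume.restrict Ω) :=
    MemLp.of_bound (Measurable.aestronglyMeasurable (by fun_prop)) 1
      (.of_forall fun x => Real.abs_sin_le_one _)
  have h1 := sum_sq_integral_mul_le (fun i => (hu i).restrict Ω) horth hc
  have h2 := sum_sq_integral_mul_le (fun i => (hu i).restrict Ω) horth hs
  have h3 : (∫ x in Ω, Real.cos (2 * Real.pi * inner ℝ x ξ) ^ 2) +
      ∫ x in Ω, Real.sin (2 * Real.pi * inner ℝ x ξ) ^ 2 = volume.real Ω := by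
    rw [← integral_add hc.integrable_sq hs.integrable_sq]
    simp
  have h4 : ∀ i, fourierSq (u i) ξ = (∫ x in Ω, u i x * Real.cos (2 * Real.pi * inner ℝ x ξ)) ^ 2 +
      (∫ x in Ω, u i x * Real.sin (2 * Real.pi * inner ℝ x ξ)) ^ 2 := fun i => by
    rw [setIntegral_eq_of_eq_zero fun x hx => by rw [h0 i x hx, zero_mul],
      setIntegral_eq_of_eq_zero fun x hx => by rw [h0 i x hx, zero_mul], fourierSq]
  simp only [h4, Finset.sum_add_distrib]
  linarith

theorem setIntegral_ball_log_norm (hN : 1 ≤ N) {R : ℝ} (hR : 0 < R) :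
    ∫ ξ in Metric.ball (0 : EuclideanSpace ℝ (Fin N)) R, Real.log ‖ξ‖ =
      volume.real (Metric.ball (0 : EuclideanSpace ℝ (Fin N)) 1) * R ^ N *
        (Real.log R - 1 / N) := by
  have : Nonempty (Fin N) := ⟨⟨0, hN⟩⟩
  have hN' : (N : ℝ) ≠ 0 := by
    have : N ≠ 0 := by omega
    exact_mod_cast this
  have h1 : ∫ ξ in Metric.ball (0 : EuclideanSpace ℝ (Fin N)) R, Real.log ‖ξ‖ =
      ∫ ξ : EuclideanSpace ℝ (Fin N), (Iio R).indicator Real.log ‖ξ‖ := by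
    rw [← integral_indicator measurableSet_ball]
    refine integral_congr_ae (.of_forall fun ξ => ?_)
    simp [indicator]
  have hderiv : ∀ y ∈ Ioo 0 R, HasDerivAt (fun y : ℝ => y ^ N * Real.log y / N - y ^ N / N ^ 2)
      (y ^ (N - 1) * Real.log y) y := by
    intro y hy
    have hy0 : y ≠ 0 := hy.1.ne'
    have := (((hasDerivAt_pow N y).mul (Real.hasDerivAt_log hy0)).div_const (N : ℝ)).sub
      ((hasDerivAt_pow N y).div_const ((N : ℝ) ^ 2))
    refine this.congr_deriv ?_
    have : y ^ N = y ^ (N - 1) * y := by rw [← pow_succ, Nat.sub_add_cancel hN]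
    rw [this]
    field_simp
    ring
  -- Writing y^N log y as y^{N-1} · (y log y) shows continuity up to y = 0, so the fundamental
  -- theorem applies on the closed interval although log is singular there.
  have hcont : Continuous fun y : ℝ => y ^ N * Real.log y / N - y ^ N / N ^ 2 := by
    have e : (fun y : ℝ => y ^ N * Real.log y / N - y ^ N / N ^ 2) =
        fun y : ℝ => y ^ (N - 1) * (y * Real.log y) / N - y ^ N / N ^ 2 := by
      ext y
      rw [← mul_assoc, ← pow_succ, Nat.sub_add_cancel hN]
    rw [e]
    have := Real.continuous_mul_log
    fun_prop
  have hint : IntervalIntegrable (fun y : ℝ => y ^ (N - 1) * Real.log y) volume 0 R :=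
    intervalIntegral.intervalIntegrable_log'.continuousOn_mul (by fun_prop)
  have h2 : ∫ y in Ioi (0 : ℝ), y ^ (N - 1) • (Iio R).indicator Real.log y =
      R ^ N * Real.log R / N - R ^ N / N ^ 2 := by
    have e : ∀ y : ℝ, y ^ (N - 1) • (Iio R).indicator Real.log y =
        (Iio R).indicator (fun y => y ^ (N - 1) * Real.log y) y := fun y => by
      by_cases h : y < R <;> simp [indicator, h]
    simp only [e]
    rw [setIntegral_indicator measurableSet_Iio, Ioi_inter_Iio, ← integral_Ioc_eq_integral_Ioo,
      ← intervalIntegral.integral_of_le hR.le,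
      intervalIntegral.integral_eq_sub_of_hasDerivAt_of_le hR.le hcont.continuousOn hderiv hint]
    have : N ≠ 0 := by omega
    simp [this]
  rw [h1, integral_fun_norm_addHaar volume, finrank_euclideanSpace_fin, h2, nsmul_eq_mul,
    smul_eq_mul]
  field_simp

/-- The strict bathtub inequality for the weight `log |ξ|`. -/
theorem bathtub_log_lt (hN : 1 ≤ N) {F : EuclideanSpace ℝ (Fin N) → ℝ} (hc : Continuous F)
    (hF0 : ∀ ξ, 0 ≤ F ξ) {V : ℝ} (hV : 0 < V) (hFV : ∀ ξ, F ξ ≤ V) (hF : Integrable F)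
    (hFlog : Integrable fun ξ => F ξ * Real.log ‖ξ‖) {R : ℝ} (hR : 0 < R)
    (hmass : ∫ ξ, F ξ = V * volume.real (Metric.ball (0 : EuclideanSpace ℝ (Fin N)) R)) :
    V * ∫ ξ in Metric.ball (0 : EuclideanSpace ℝ (Fin N)) R, Real.log ‖ξ‖ <
      ∫ ξ, F ξ * Real.log ‖ξ‖ := by
  have : Nonempty (Fin N) := ⟨⟨0, hN⟩⟩
  set B := Metric.ball (0 : EuclideanSpace ℝ (Fin N)) R with hB
  have hBm : MeasurableSet B := measurableSet_ball
  have i1 : Integrable (B.indicator fun ξ => Real.log ‖ξ‖) :=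
    (integrable_indicator_iff hBm).2 (integrableOn_ball_log_norm hN R)
  have i2 : Integrable (B.indicator fun _ => (1 : ℝ)) :=
    (integrable_indicator_iff hBm).2 (integrableOn_const Metric.isBounded_ball.measure_lt_top.ne)
  -- D equals (F - V·1_B)(log|ξ| - log R), whose factors have the same sign inside and outside the
  -- ball. The log R term integrates to zero because the masses agree.
  set D : EuclideanSpace ℝ (Fin N) → ℝ := fun ξ =>
    (F ξ * Real.log ‖ξ‖ - V * B.indicator (fun ξ => Real.log ‖ξ‖) ξ)
      - Real.log R * (F ξ - V * B.indicator (fun _ => (1 : ℝ)) ξ) with hD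
  have iD1 := hFlog.sub (i1.const_mul V)
  have iD2 := (hF.sub (i2.const_mul V)).const_mul (Real.log R)
  have hDint : Integrable D := iD1.sub iD2
  have hDval : ∫ ξ, D ξ = (∫ ξ, F ξ * Real.log ‖ξ‖) - V * ∫ ξ in B, Real.log ‖ξ‖ := by
    have e1 : ∫ ξ, D ξ = (∫ ξ, (F ξ * Real.log ‖ξ‖ - V * B.indicator (fun ξ => Real.log ‖ξ‖) ξ))
      - ∫ ξ, Real.log R * (F ξ - V * B.indicator (fun _ => (1 : ℝ)) ξ) := integral_sub iD1 iD2
    rw [e1, integral_sub hFlog (i1.const_mul V), integral_const_mul, integral_const_mul,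
      integral_sub hF (i2.const_mul V), integral_const_mul, integral_indicator hBm,
      integral_indicator hBm, hmass]
    simp
  have hDeq : ∀ ξ, D ξ = (F ξ - B.indicator (fun _ => V) ξ) * (Real.log ‖ξ‖ - Real.log R) := by
    intro ξ
    by_cases h : ξ ∈ B <;> simp [hD, h] <;> ring
  have hDnn : ∀ᵐ ξ, 0 ≤ D ξ := by
    have : ∀ᵐ ξ : EuclideanSpace ℝ (Fin N), ξ ≠ 0 := by simp [ae_iff]
    filter_upwards [this] with ξ hξ
    have hξ : 0 < ‖ξ‖ := norm_pos_iff.2 hξ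
    rw [hDeq]
    by_cases h : ξ ∈ B
    · rw [indicator_of_mem h]
      have : ‖ξ‖ < R := by simpa [hB] using h
      have := Real.log_le_log hξ this.le
      nlinarith [hFV ξ]
    · rw [indicator_of_notMem h, sub_zero]
      have : R ≤ ‖ξ‖ := by simpa [hB] using h
      have := Real.log_le_log hR this
      exact mul_nonneg (hF0 ξ) (by linarith)
  -- Equality would force F = V in the open ball and F = 0 outside the closed one. Along a ray,
  -- continuity of F at the boundary point then gives V = 0.
  have hpos : 0 < ∫ ξ, D ξ := by
    refine lt_of_le_of_ne (integral_nonneg_of_ae hDnn) fun hzero => ?_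
    have hD0 := (integral_eq_zero_iff_of_nonneg_ae hDnn hDint).1 hzero.symm
    have hin : EqOn F (fun _ => V) B := by
      refine Measure.eqOn_open_of_ae_eq (μ := volume) ?_ Metric.isOpen_ball hc.continuousOn continuousOn_const
      refine (ae_restrict_iff' hBm).2 ?_
      have : ∀ᵐ ξ : EuclideanSpace ℝ (Fin N), ξ ≠ 0 := by simp [ae_iff]
      filter_upwards [hD0, this] with ξ h hξ hmem
      have hξ : 0 < ‖ξ‖ := norm_pos_iff.2 hξ
      rw [hDeq, indicator_of_mem hmem] at h
      have : ‖ξ‖ < R := by simpa [hB] using hmem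
      have := Real.log_lt_log hξ this
      rcases mul_eq_zero.1 h with h | h <;> linarith
    have hout : EqOn F (fun _ => 0) (Metric.closedBall 0 R)ᶜ := by
      refine Measure.eqOn_open_of_ae_eq (μ := volume) ?_ Metric.isClosed_closedBall.isOpen_compl
        hc.continuousOn continuousOn_const
      refine (ae_restrict_iff' Metric.isClosed_closedBall.measurableSet.compl).2 ?_
      filter_upwards [hD0] with ξ h hmem
      have hlt : R < ‖ξ‖ := by simpa using hmem
      have hmem' : ξ ∉ B := by simpa [hB] using hlt.le
      rw [hDeq, indicator_of_notMem hmem', sub_zero] at h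
      have := Real.log_lt_log hR hlt
      rcases mul_eq_zero.1 h with h | h <;> linarith
    obtain ⟨e, he⟩ := exists_norm_eq (EuclideanSpace ℝ (Fin N)) zero_le_one
    have hline : Continuous fun t : ℝ => F (t • e) := hc.comp (by fun_prop)
    have hl : ∀ t ∈ Ioo 0 R, F (t • e) = V := fun t ht => by
      refine hin ?_
      rw [hB, mem_ball_zero_iff, norm_smul, he, Real.norm_of_nonneg ht.1.le, mul_one]
      exact ht.2
    have hr : ∀ t ∈ Ioi R, F (t • e) = 0 := fun t ht => by
      have ht : R < t := ht
      refine hout ?_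
      rw [mem_compl_iff, mem_closedBall_zero_iff, norm_smul, he,
        Real.norm_of_nonneg (by linarith), mul_one]
      exact not_le.2 ht
    have h1 : F (R • e) = V := by
      refine tendsto_nhds_unique ((hline.tendsto R).mono_left nhdsWithin_le_nhds :
        Tendsto _ (𝓝[<] R) _) (tendsto_const_nhds.congr' ?_)
      filter_upwards [Ioo_mem_nhdsLT hR] with t ht
      exact (hl t ht).symm
    have h2 : F (R • e) = 0 := by
      refine tendsto_nhds_unique ((hline.tendsto R).mono_left nhdsWithin_le_nhds :
        Tendsto _ (𝓝[>] R) _) (tendsto_const_nhds.congr' ?_)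
      filter_upwards [self_mem_nhdsWithin] with t ht
      exact (hr t ht).symm
    linarith
  linarith

theorem dN_pos (hN : 1 ≤ N) : 0 < dN N := by
  have hN' : (0 : ℝ) < N := by exact_mod_cast hN
  have := Real.pi_pos
  have hb : 0 < volume.real (Metric.ball (0 : EuclideanSpace ℝ (Fin N)) 1) :=
    ENNReal.toReal_pos (Metric.measure_ball_pos _ _ one_pos).ne'
      Metric.isBounded_ball.measure_lt_top.ne
  rw [dN, sphereArea_eq]
  positivity

/-- The Berezin–Li–Yau inequality for the logarithmic Laplacian, with strict inequality. -/
theorem lt_sum_logForm (hN : 1 ≤ N) (hΩ : MeasurableSet Ω) (hb : Bornology.IsBounded Ω)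
    (hV : 0 < volume.real Ω) {k : ℕ} (hk : 1 ≤ k)
    {u : Fin k → EuclideanSpace ℝ (Fin N) → ℝ} (hu : ∀ i, MemH Ω (u i))
    (horth : ∀ i j, ∫ x in Ω, u i x * u j x = if i = j then 1 else 0) :
    k * (2 / N * Real.log (2 * k / (Real.exp 1 * N * dN N * volume.real Ω))) <
      ∑ i, logForm (u i) (u i) := by
  have : Nonempty (Fin N) := ⟨⟨0, hN⟩⟩
  have hN' : (0 : ℝ) < N := by exact_mod_cast hN
  have hk' : (0 : ℝ) < k := by exact_mod_cast hk
  have hpi := Real.pi_pos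
  set V := volume.real Ω with hVdef
  set b := volume.real (Metric.ball (0 : EuclideanSpace ℝ (Fin N)) 1) with hbdef
  have hb0 : 0 < b := ENNReal.toReal_pos (Metric.measure_ball_pos _ _ one_pos).ne'
      Metric.isBounded_ball.measure_lt_top.ne
  have hL2 : ∀ i, MemLp (u i) 2 := fun i => (hu i).memLp hN hΩ hb
  have hL1 : ∀ i, Integrable (u i) := fun i => (hu i).integrable hN hΩ hb
  have hsq : ∀ i, Integrable fun x => u i x ^ 2 := fun i => (hL2 i).integrable_sq
  have hone : ∀ i, ∫ x, u i x ^ 2 = 1 := fun i => by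
    have := horth i i
    rw [if_pos rfl, setIntegral_eq_of_eq_zero fun x hx => by rw [(hu i).eq_zero x hx, zero_mul]]
      at this
    simpa only [sq] using this
  have hFi := fun i => (hu i).integral_fourierSq hN (hL1 i) (hsq i)
  have hLi := fun i => (hu i).integrable_fourierSq_mul_log hN (hL1 i) (hsq i)
  set F : EuclideanSpace ℝ (Fin N) → ℝ := fun ξ => ∑ i, fourierSq (u i) ξ with hF
  have hFlog : (fun ξ => F ξ * Real.log ‖ξ‖) =
      fun ξ => ∑ i, fourierSq (u i) ξ * Real.log ‖ξ‖ := by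
    ext ξ; rw [hF, Finset.sum_mul]
  have hFlogint : Integrable fun ξ => F ξ * Real.log ‖ξ‖ := by
    rw [hFlog]; exact integrable_finsetSum _ fun i _ => hLi i
  have hFint : Integrable F := integrable_finsetSum _ fun i _ => (hFi i).1
  have hFmass : ∫ ξ, F ξ = k := by
    rw [hF, integral_finsetSum _ fun i _ => (hFi i).1]
    simp [fun i => (hFi i).2, hone]
  -- R is the radius for which V times the volume of the ball equals the total mass k.
  set R : ℝ := (k / (V * b)) ^ (1 / N : ℝ) with hRdef
  have hR : 0 < R := by positivity
  have hRN : R ^ N = k / (V * b) := by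
    rw [hRdef, ← Real.rpow_natCast, ← Real.rpow_mul (by positivity), one_div,
      inv_mul_cancel₀ hN'.ne', Real.rpow_one]
  have hball : volume.real (Metric.ball (0 : EuclideanSpace ℝ (Fin N)) R) = R ^ N * b := by
    rw [Measure.real, Measure.addHaar_ball volume _ hR.le, finrank_euclideanSpace_fin,
      ENNReal.toReal_mul, ENNReal.toReal_ofReal (by positivity)]
    rfl
  have hmass : V * (R ^ N * b) = k := by rw [hRN]; field_simp
  have hbath := bathtub_log_lt hN (continuous_finsetSum _ fun i _ => continuous_fourierSq (hL1 i))
    (fun ξ => Finset.sum_nonneg fun i _ => fourierSq_nonneg (u i) ξ) hV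
    (sum_fourierSq_le hb hL2 (fun i => (hu i).eq_zero) horth) hFint hFlogint hR
    (by rw [hball, hmass]; exact hFmass)
  rw [setIntegral_ball_log_norm hN hR, ← hbdef] at hbath
  have hlow : 2 * Real.log (2 * Real.pi) * k + 2 * ∫ ξ, F ξ * Real.log ‖ξ‖ ≤
      ∑ i, logForm (u i) (u i) := by
    have hval : ∀ i, ∫ ξ, fourierSq (u i) ξ * (2 * Real.log (2 * Real.pi) + 2 * Real.log ‖ξ‖) =
        2 * Real.log (2 * Real.pi) + 2 * ∫ ξ, fourierSq (u i) ξ * Real.log ‖ξ‖ := by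
      intro i
      have e : (fun ξ => fourierSq (u i) ξ * (2 * Real.log (2 * Real.pi) + 2 * Real.log ‖ξ‖)) =
          fun ξ => 2 * Real.log (2 * Real.pi) * fourierSq (u i) ξ +
            2 * (fourierSq (u i) ξ * Real.log ‖ξ‖) := by ext ξ; ring
      rw [e, integral_add ((hFi i).1.const_mul _) ((hLi i).const_mul _), integral_const_mul,
        integral_const_mul, (hFi i).2, hone, mul_one]
    have h := Finset.sum_le_sum fun i (_ : i ∈ Finset.univ) =>
      (hu i).integral_fourierSq_mul_log_le_logForm hN (hL1 i) (hsq i)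
    simp only [hval, Finset.sum_add_distrib, Finset.sum_const, Finset.card_univ, Fintype.card_fin,
      nsmul_eq_mul, ← Finset.mul_sum] at h
    rw [hFlog, integral_finsetSum _ fun i _ => hLi i]
    linarith
  -- Since N d_N = 2b/(2π)^N, the argument of the logarithm is (2πR)^N / e. The factor e comes from
  -- the -1/N in the mean of log|ξ| over the ball.
  have hlogR : Real.log (2 * k / (Real.exp 1 * N * dN N * V)) =
      N * (Real.log (2 * Real.pi) + Real.log R) - 1 := by
    have e : 2 * k / (Real.exp 1 * N * dN N * V) = (2 * Real.pi * R) ^ N / Real.exp 1 := by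
      rw [mul_pow, hRN, dN, sphereArea_eq, ← hbdef]
      field_simp
    rw [e, Real.log_div (by positivity) (by positivity), Real.log_exp, Real.log_pow,
      Real.log_mul (by positivity) hR.ne']
  rw [hlogR]
  have hk2 : V * (b * R ^ N * (Real.log R - 1 / N)) = k * (Real.log R - 1 / N) := by
    rw [← hmass]; ring
  have e : k * (2 / N * (N * (Real.log (2 * Real.pi) + Real.log R) - 1)) =
      2 * Real.log (2 * Real.pi) * k + 2 * (k * (Real.log R - 1 / N)) := by
    field_simp; ring
  rw [e]
  linarith

/-! ### Abstract spectral theory of coercive forms with compact embedding. -/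

section Abstract

variable {V H : Type*} [NormedAddCommGroup V] [InnerProductSpace ℝ V] [CompleteSpace V]
  [NormedAddCommGroup H] [InnerProductSpace ℝ H] [CompleteSpace H]

/-- A coercive symmetric form whose domain embeds compactly, with infinite-dimensional range, has
orthonormal families of weak eigenvectors of every finite length. -/
theorem exists_orthonormal_weak_eigenvectors (ι : V →L[ℝ] H) (hι : IsCompactOperator ι)
    (B : V →L[ℝ] V →L[ℝ] ℝ) (hB : IsCoercive B) (hsymm : ∀ v w, B v w = B w v)
    (hinf : ¬ FiniteDimensional ℝ (LinearMap.range (ι : V →ₗ[ℝ] H))) (k : ℕ) :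
    ∃ (m : Fin k → ℝ) (v : Fin k → V),
      (∀ i w, B (v i) w = m i * inner ℝ (ι (v i)) (ι w)) ∧ Orthonormal ℝ fun i => ι (v i) := by
  set A := hB.continuousLinearEquivOfBilin with hA
  have hAB : ∀ v w, inner ℝ (A v) w = B v w := hB.continuousLinearEquivOfBilin_apply
  set ιs : H →L[ℝ] V := ContinuousLinearMap.adjoint ι with hιs
  have hadj : ∀ f w, inner ℝ (ιs f) w = inner ℝ f (ι w) := fun f w =>
    ContinuousLinearMap.adjoint_inner_left ι w f
  -- `R` is the solution operator of the weak problem B(Rf, w) = ⟨f, ιw⟩. Then T = ιR is compact and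
  -- symmetric on H, and a nonzero eigenvalue c of T corresponds to the weak eigenvalue 1/c.
  set R : H →L[ℝ] V := (A.symm : V →L[ℝ] V).comp ιs with hR
  have hBR : ∀ f w, B (R f) w = inner ℝ f (ι w) := fun f w => by
    rw [← hAB, ← hadj, hR]; simp
  set T : H →L[ℝ] H := ι.comp R with hT
  have hTapp : ∀ f, T f = ι (R f) := fun f => rfl
  have hTc : IsCompactOperator T := hι.comp_clm R
  have hTs : (T : H →ₗ[ℝ] H).IsSymmetric := by
    intro f g
    change inner ℝ (T f) g = inner ℝ f (T g)
    rw [hTapp g, ← hBR, hsymm, hBR, real_inner_comm, hTapp]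
  induction k with
  | zero => exact ⟨Fin.elim0, Fin.elim0, fun i => i.elim0, by simp⟩
  | succ k ih =>
    obtain ⟨m, v, hmv, ho⟩ := ih
    set F : Submodule ℝ H := Submodule.span ℝ (range fun i => ι (v i)) with hF
    -- The vectors already found are eigenvectors of T, so T preserves the orthogonal complement of
    -- their span, where the next one is sought.
    have hTv : ∀ i, ∃ c : ℝ, T (ι (v i)) = c • ι (v i) := by
      intro i
      have h1 : v i = m i • R (ι (v i)) := by
        have : A (v i) = A (m i • R (ι (v i))) := by
          refine ext_inner_right ℝ fun w => ?_
          rw [hAB, hmv, map_smul, inner_smul_left, hAB, hBR]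
          simp
        exact A.injective this
      have h2 : ι (v i) = m i • T (ι (v i)) := by
        conv_lhs => rw [h1, map_smul]
        rw [hTapp]
      have hm : m i ≠ 0 := by
        intro h0
        rw [h0, zero_smul] at h2
        exact ho.ne_zero i h2
      exact ⟨(m i)⁻¹, by conv_rhs => rw [h2, smul_smul, inv_mul_cancel₀ hm, one_smul]⟩
    have hmemK : ∀ h : H, h ∈ Fᗮ ↔ ∀ i, inner ℝ (ι (v i)) h = 0 := by
      intro h
      rw [Submodule.mem_orthogonal]
      refine ⟨fun H i => H _ (Submodule.subset_span ⟨i, rfl⟩), fun H x hx => ?_⟩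
      induction hx using Submodule.span_induction with
      | mem x hx => obtain ⟨i, rfl⟩ := hx; exact H i
      | zero => simp
      | add x y _ _ hx hy => rw [inner_add_left, hx, hy, add_zero]
      | smul c x _ hx => rw [inner_smul_left, hx, mul_zero]
    have hinv : ∀ h ∈ Fᗮ, (T : H →ₗ[ℝ] H) h ∈ Fᗮ := by
      intro h hh
      rw [hmemK] at hh ⊢
      intro i
      obtain ⟨c, hc⟩ := hTv i
      have := hTs (ι (v i)) h
      change inner ℝ (T (ι (v i))) h = _ at this
      rw [← this, hc, inner_smul_left, hh, mul_zero]
    have hFfin : FiniteDimensional ℝ F := FiniteDimensional.span_of_finite ℝ (finite_range _)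
    let S : Fᗮ →L[ℝ] Fᗮ := T.restrict hinv
    have hSc : IsCompactOperator S := hTc.restrict' hinv
    have hSs : (S : Fᗮ →ₗ[ℝ] Fᗮ).IsSymmetric := hTs.restrict_invariant hinv
    -- If T vanished on the complement, coercivity would make R, hence the adjoint of ι, vanish
    -- there. The range of ι would then lie in the finite-dimensional span.
    have hS0 : S ≠ 0 := by
      intro h0
      refine hinf ?_
      have hker : ∀ h ∈ Fᗮ, ιs h = 0 := by
        intro h hh
        have hTh : T h = 0 := by
          have : S ⟨h, hh⟩ = 0 := by rw [h0]; rfl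
          exact congrArg Subtype.val this
        have hRh : R h = 0 := by
          obtain ⟨C, hC, hcoer⟩ := hB
          have h1 := hcoer (R h)
          rw [hBR, ← hTapp, hTh, inner_zero_right] at h1
          by_contra hne
          have : 0 < ‖R h‖ := norm_pos_iff.2 hne
          have : 0 < C * ‖R h‖ * ‖R h‖ := by positivity
          linarith
        refine ext_inner_right ℝ fun w => ?_
        rw [hadj, ← hBR, hRh]
        simp
      have hle : LinearMap.range (ι : V →ₗ[ℝ] H) ≤ F := by
        rintro _ ⟨x, rfl⟩
        change ι x ∈ F
        obtain ⟨y, hy, z, hz, hyz⟩ := F.exists_add_mem_mem_orthogonal (ι x)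
        have hyr : y ∈ LinearMap.range (ι : V →ₗ[ℝ] H) := by
          refine (Submodule.span_le.2 ?_) hy
          rintro _ ⟨i, rfl⟩
          exact ⟨v i, rfl⟩
        obtain ⟨x', hx'⟩ := hyr
        have hx' : ι x' = y := hx'
        have hzi : z = ι (x - x') := by rw [map_sub, hx', hyz]; abel
        have hz0 : z = 0 := by
          rw [← inner_self_eq_zero (𝕜 := ℝ)]
          nth_rw 2 [hzi]
          rw [← hadj, hker z hz, inner_zero_left]
        rw [hyz, hz0, add_zero]
        exact hy
      exact Submodule.finiteDimensional_of_le hle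
    obtain ⟨c, hc, hc0⟩ : ∃ c, Module.End.HasEigenvalue (S : Module.End ℝ Fᗮ) c ∧ c ≠ 0 := by
      by_contra! hcon
      exact hS0 ((ContinuousLinearMap.eq_zero_of_forall_hasEigenvalue_eq_zero hSc hSs).1 hcon)
    obtain ⟨f, hf⟩ := hc.exists_hasEigenvector
    have hfn : ‖(f : H)‖ ≠ 0 := by
      have := hf.2
      simpa using this
    set g : H := (‖(f : H)‖)⁻¹ • (f : H) with hg
    have hgK : g ∈ Fᗮ := Submodule.smul_mem _ _ f.2
    have hTf : T f = c • (f : H) := congrArg Subtype.val hf.apply_eq_smul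
    have hTg : T g = c • g := by rw [hg, map_smul, hTf, smul_comm]
    have hgn : ‖g‖ = 1 := by rw [hg, norm_smul, norm_inv, norm_norm, inv_mul_cancel₀ hfn]
    -- Since ιRg = Tg = cg, this rescaling makes ιv' exactly the unit vector g.
    set v' : V := c⁻¹ • R g with hv'
    have hιv' : ι v' = g := by
      rw [hv', map_smul, ← hTapp, hTg, smul_smul, inv_mul_cancel₀ hc0, one_smul]
    refine ⟨Fin.cons c⁻¹ m, Fin.cons v' v, ?_, ?_⟩
    · intro i w
      induction i using Fin.cases with
      | zero =>
        simp only [Fin.cons_zero]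
        rw [hιv', hv', map_smul, smul_apply, hBR, smul_eq_mul]
      | succ i => simpa using hmv i w
    · rw [orthonormal_iff_ite] at ho ⊢
      rw [hmemK] at hgK
      intro i j
      induction i using Fin.cases with
      | zero =>
        induction j using Fin.cases with
        | zero => simp [hιv', hgn]
        | succ j =>
          simp only [Fin.cons_zero, Fin.cons_succ, hιv']
          rw [real_inner_comm, hgK]
          simp [(Fin.succ_ne_zero j).symm]
      | succ i =>
        induction j using Fin.cases with
        | zero =>
          simp only [Fin.cons_zero, Fin.cons_succ, hιv']
          rw [hgK]
          simp [Fin.succ_ne_zero]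
        | succ j => simpa using ho i j

end Abstract

/-! ### The energy space as a Hilbert space of almost everywhere classes. -/

/-- The weighted difference `(u(x) - u(y)) |x - y|^{-N/2}`. -/
def diffQuot (u : EuclideanSpace ℝ (Fin N) → ℝ)
    (p : EuclideanSpace ℝ (Fin N) × EuclideanSpace ℝ (Fin N)) : ℝ :=
  (u p.1 - u p.2) * Real.sqrt (1 / ‖p.1 - p.2‖ ^ N)

theorem diffQuot_mul (p : EuclideanSpace ℝ (Fin N) × EuclideanSpace ℝ (Fin N)) :
    diffQuot u p * diffQuot w p = (u p.1 - u p.2) * (w p.1 - w p.2) / ‖p.1 - p.2‖ ^ N := by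
  have h : Real.sqrt (1 / ‖p.1 - p.2‖ ^ N) * Real.sqrt (1 / ‖p.1 - p.2‖ ^ N) =
      1 / ‖p.1 - p.2‖ ^ N := Real.mul_self_sqrt (by positivity)
  unfold diffQuot
  linear_combination (u p.1 - u p.2) * (w p.1 - w p.2) * h

theorem measurable_diffQuot (hu : Measurable u) : Measurable (diffQuot u) := by
  unfold diffQuot; fun_prop

theorem diffQuot_congr_ae (h : u =ᵐ[volume] w) :
    diffQuot u =ᵐ[volume.restrict (nearPairs N)] diffQuot w := by
  refine ae_restrict_of_ae ?_
  have h1 := Measure.quasiMeasurePreserving_fst (μ := (volume : Measure (EuclideanSpace ℝ (Fin N))))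
    (ν := (volume : Measure (EuclideanSpace ℝ (Fin N)))) |>.ae_eq_comp h
  have h2 := Measure.quasiMeasurePreserving_snd (μ := (volume : Measure (EuclideanSpace ℝ (Fin N))))
    (ν := (volume : Measure (EuclideanSpace ℝ (Fin N)))) |>.ae_eq_comp h
  filter_upwards [h1, h2] with p e1 e2
  simp only [Function.comp_apply] at e1 e2
  rw [diffQuot, diffQuot, e1, e2]

theorem memH_iff : MemH Ω u ↔ Measurable u ∧ (∀ x ∉ Ω, u x = 0) ∧
    MemLp (diffQuot u) 2 (volume.restrict (nearPairs N)) := by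
  have key : ∀ hu : Measurable u, MemLp (diffQuot u) 2 (volume.restrict (nearPairs N)) ↔
      IntegrableOn (fun p : EuclideanSpace ℝ (Fin N) × EuclideanSpace ℝ (Fin N) =>
        (u p.1 - u p.2) ^ 2 / ‖p.1 - p.2‖ ^ N) (nearPairs N) := fun hu => by
    rw [memLp_two_iff_integrable_sq (measurable_diffQuot hu).aestronglyMeasurable]
    refine integrable_congr (.of_forall fun p => ?_)
    simp only
    rw [sq, diffQuot_mul, ← sq]
  exact ⟨fun h => ⟨h.measurable, h.eq_zero, (key h.measurable).2 h.finite_energy⟩,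
    fun h => ⟨h.1, h.2.1, (key h.1).1 h.2.2⟩⟩

/-- Square integrable functions on `ℝ^N`. -/
abbrev L2Space (N : ℕ) := Lp ℝ 2 (volume : Measure (EuclideanSpace ℝ (Fin N)))

/-- Square integrable functions on the near pairs. -/
abbrev L2Near (N : ℕ) := Lp ℝ 2 ((volume : Measure (EuclideanSpace ℝ (Fin N) ×
  EuclideanSpace ℝ (Fin N))).restrict (nearPairs N))

/-- The energy space as a subspace of a product of `L²` spaces: pairs of a function vanishing
outside `Ω` and its weighted difference. -/
def formDomain (Ω : Set (EuclideanSpace ℝ (Fin N))) :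
    Submodule ℝ (WithLp 2 (L2Space N × L2Near N)) where
  carrier := {x | (∀ᵐ y, y ∉ Ω → x.fst y = 0) ∧
    x.snd =ᵐ[volume.restrict (nearPairs N)] diffQuot x.fst}
  zero_mem' := by
    have h0 := Lp.coeFn_zero ℝ 2 (volume : Measure (EuclideanSpace ℝ (Fin N)))
    refine ⟨?_, ?_⟩
    · filter_upwards [h0] with y hy _
      exact hy
    · refine (Lp.coeFn_zero ℝ 2 _).trans (EventuallyEq.trans ?_ (diffQuot_congr_ae h0.symm))
      exact .of_forall fun p => by simp [diffQuot]
  add_mem' := by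
    rintro x y ⟨hx1, hx2⟩ ⟨hy1, hy2⟩
    have h0 := Lp.coeFn_add x.fst y.fst
    refine ⟨?_, ?_⟩
    · filter_upwards [h0, hx1, hy1] with z hz h1 h2 hzΩ
      rw [WithLp.add_fst, hz, Pi.add_apply, h1 hzΩ, h2 hzΩ, add_zero]
    · refine EventuallyEq.trans ?_ (diffQuot_congr_ae h0.symm)
      filter_upwards [Lp.coeFn_add x.snd y.snd, hx2, hy2] with p hp h1 h2
      rw [WithLp.add_snd, hp, Pi.add_apply, h1, h2]
      simp only [diffQuot, Pi.add_apply]; ring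
  smul_mem' := by
    rintro c x ⟨hx1, hx2⟩
    have h0 := Lp.coeFn_smul c x.fst
    refine ⟨?_, ?_⟩
    · filter_upwards [h0, hx1] with z hz h1 hzΩ
      rw [WithLp.smul_fst, hz, Pi.smul_apply, h1 hzΩ, smul_zero]
    · refine EventuallyEq.trans ?_ (diffQuot_congr_ae h0.symm)
      filter_upwards [Lp.coeFn_smul c x.snd, hx2] with p hp h1
      rw [WithLp.smul_snd, hp, Pi.smul_apply, h1]
      simp only [diffQuot, Pi.smul_apply, smul_eq_mul]; ring

/-- Convergence in L² gives almost everywhere convergence along a subsequence, taken successively in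
the two components. Both defining conditions pass to such limits, so the domain is complete. -/
theorem isClosed_formDomain :
    IsClosed (formDomain Ω : Set (WithLp 2 (L2Space N × L2Near N))) := by
  refine IsSeqClosed.isClosed fun x y hx hxy => ?_
  have h1 : Tendsto (fun n => (x n).fst) atTop (𝓝 y.fst) :=
    ((WithLp.continuous_fst 2 _ _).tendsto y).comp hxy
  have h2 : Tendsto (fun n => (x n).snd) atTop (𝓝 y.snd) :=
    ((WithLp.continuous_snd 2 _ _).tendsto y).comp hxy
  obtain ⟨φ, hφ, hφae⟩ := (tendstoInMeasure_of_tendsto_Lp h1).exists_seq_tendsto_ae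
  obtain ⟨ψ, hψ, hψae⟩ := (tendstoInMeasure_of_tendsto_Lp
    (h2.comp hφ.tendsto_atTop)).exists_seq_tendsto_ae
  have hx1 := ae_all_iff.2 fun n => (hx n).1
  have hx2 := ae_all_iff.2 fun n => (hx n).2
  refine ⟨?_, ?_⟩
  · filter_upwards [hφae, hx1] with z hz h0 hzΩ
    refine tendsto_nhds_unique hz (tendsto_const_nhds.congr fun n => ?_)
    rw [h0 (φ n) hzΩ]
  · have e1 := Measure.quasiMeasurePreserving_fst
      (μ := (volume : Measure (EuclideanSpace ℝ (Fin N))))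
      (ν := (volume : Measure (EuclideanSpace ℝ (Fin N)))) |>.ae hφae
    have e2 := Measure.quasiMeasurePreserving_snd
      (μ := (volume : Measure (EuclideanSpace ℝ (Fin N))))
      (ν := (volume : Measure (EuclideanSpace ℝ (Fin N)))) |>.ae hφae
    filter_upwards [hψae, hx2, ae_restrict_of_ae e1, ae_restrict_of_ae e2] with p hp h0 t1 t2
    refine tendsto_nhds_unique hp ?_
    have := ((t1.comp hψ.tendsto_atTop).sub (t2.comp hψ.tendsto_atTop)).mul_const
      (Real.sqrt (1 / ‖p.1 - p.2‖ ^ N))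
    refine this.congr fun n => ?_
    simp only [Function.comp_apply]
    rw [h0 (φ (ψ n)), diffQuot]

instance : CompleteSpace (formDomain Ω) := isClosed_formDomain.completeSpace_coe

/-- The embedding of the energy space into `L²`. -/
def formEmbedding (Ω : Set (EuclideanSpace ℝ (Fin N))) : formDomain Ω →L[ℝ] L2Space N :=
  (WithLp.fstL 2 ℝ (L2Space N) (L2Near N)).comp (formDomain Ω).subtypeL

/-- The weighted difference of an element of the energy space. -/
def formDiff (Ω : Set (EuclideanSpace ℝ (Fin N))) : formDomain Ω →L[ℝ] L2Near N :=
  (WithLp.sndL 2 ℝ (L2Space N) (L2Near N)).comp (formDomain Ω).subtypeL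

/-- The representative vanishing outside `Ω` of an element of the energy space. -/
def formRep (x : formDomain Ω) : EuclideanSpace ℝ (Fin N) → ℝ :=
  Ω.indicator (formEmbedding Ω x)

theorem formRep_ae_eq (x : formDomain Ω) : formRep x =ᵐ[volume] formEmbedding Ω x := by
  filter_upwards [x.2.1] with y hy
  by_cases h : y ∈ Ω
  · rw [formRep, indicator_of_mem h]
  · rw [formRep, indicator_of_notMem h]
    exact (hy h).symm

theorem formDiff_ae_eq (x : formDomain Ω) :
    formDiff Ω x =ᵐ[volume.restrict (nearPairs N)] diffQuot (formRep x) :=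
  EventuallyEq.trans x.2.2 (diffQuot_congr_ae (formRep_ae_eq x).symm)

theorem memH_formRep (hΩ : MeasurableSet Ω) (x : formDomain Ω) : MemH Ω (formRep x) := by
  refine memH_iff.2 ⟨(Lp.stronglyMeasurable _).measurable.indicator hΩ,
    fun y hy => indicator_of_notMem hy _, ?_⟩
  exact (memLp_congr_ae (formDiff_ae_eq x)).1 (Lp.memLp _)

theorem memLp_formRep (x : formDomain Ω) : MemLp (formRep x) 2 :=
  (memLp_congr_ae (formRep_ae_eq x)).2 (Lp.memLp _)

theorem MemH.exists_formDomain (hu : MemH Ω u) (hu2 : MemLp u 2) :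
    ∃ x : formDomain Ω, formEmbedding Ω x = hu2.toLp u ∧ formRep x =ᵐ[volume] u := by
  have hD := (memH_iff.1 hu).2.2
  obtain ⟨f, hf⟩ : ∃ f, f = hu2.toLp u := ⟨_, rfl⟩
  obtain ⟨g, hg⟩ : ∃ g, g = hD.toLp (diffQuot u) := ⟨_, rfl⟩
  have hfu : f =ᵐ[volume] u := hf ▸ hu2.coeFn_toLp
  have hgu : g =ᵐ[volume.restrict (nearPairs N)] diffQuot u := hg ▸ hD.coeFn_toLp
  have hmem : WithLp.toLp 2 (f, g) ∈ formDomain Ω := by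
    refine ⟨?_, hgu.trans (diffQuot_congr_ae hfu.symm)⟩
    filter_upwards [hfu] with y hy hyΩ
    exact hy.trans (hu.eq_zero y hyΩ)
  have hx : formEmbedding Ω ⟨_, hmem⟩ = f := rfl
  refine ⟨⟨_, hmem⟩, hx.trans hf, (formRep_ae_eq _).trans ?_⟩
  rw [hx]
  exact hfu

theorem norm_sq_formDomain (x : formDomain Ω) :
    ‖x‖ ^ 2 = ‖formEmbedding Ω x‖ ^ 2 + ‖formDiff Ω x‖ ^ 2 := by
  have h : ‖x‖ = ‖(x : WithLp 2 (L2Space N × L2Near N))‖ := rfl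
  rw [h, WithLp.prod_norm_sq_eq_of_L2]
  rfl

theorem inner_eq_integral_of_ae_eq {X : Type*} [MeasurableSpace X] {μ : Measure X}
    {f g : Lp ℝ 2 μ} {u w : X → ℝ} (hu : f =ᵐ[μ] u) (hw : g =ᵐ[μ] w) :
    inner ℝ f g = ∫ x, u x * w x ∂μ := by
  rw [L2.inner_def]
  refine integral_congr_ae ?_
  filter_upwards [hu, hw] with x h1 h2
  rw [h1, h2]
  simp [mul_comm]

theorem inner_formEmbedding (x y : formDomain Ω) :
    inner ℝ (formEmbedding Ω x) (formEmbedding Ω y) = ∫ z, formRep x z * formRep y z :=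
  inner_eq_integral_of_ae_eq (formRep_ae_eq x).symm (formRep_ae_eq y).symm

theorem energy_formRep (x y : formDomain Ω) :
    energy (formRep x) (formRep y) = cN N / 2 * inner ℝ (formDiff Ω x) (formDiff Ω y) := by
  rw [inner_eq_integral_of_ae_eq (formDiff_ae_eq x) (formDiff_ae_eq y)]
  simp only [diffQuot_mul, energy]

/-! ### Compactness of the embedding into L². -/

/-- Composing ι with the orthogonal projections onto the finite-dimensional spaces W gives
finite-rank operators converging to ι in norm. -/
theorem isCompactOperator_of_small_on_finite_codim {V H : Type*} [NormedAddCommGroup V]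
    [InnerProductSpace ℝ V] [CompleteSpace V] [NormedAddCommGroup H] [InnerProductSpace ℝ H]
    [CompleteSpace H] (ι : V →L[ℝ] H)
    (h : ∀ ε > 0, ∃ W : Submodule ℝ V, FiniteDimensional ℝ W ∧ ∀ x ∈ Wᗮ, ‖ι x‖ ≤ ε * ‖x‖) :
    IsCompactOperator ι := by
  choose W hW hWε using fun n : ℕ => h (1 / ((n : ℝ) + 1)) Nat.one_div_pos_of_nat
  refine isCompactOperator_of_tendsto (l := atTop)
    (F := fun n => (ι ∘L (W n).subtypeL) ∘L (W n).orthogonalProjectionOnto) ?_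
    (.of_forall fun n => ?_)
  · refine tendsto_iff_norm_sub_tendsto_zero.2 (squeeze_zero (fun n => norm_nonneg _) (fun n => ?_)
      tendsto_one_div_add_atTop_nhds_zero_nat)
    refine ContinuousLinearMap.opNorm_le_bound _ Nat.one_div_pos_of_nat.le fun x => ?_
    have h1 := hWε n _ (Submodule.sub_starProjection_mem_orthogonal (K := W n) x)
    have h2 : ‖x - (W n).starProjection x‖ ≤ ‖x‖ := by
      have := (W n)ᗮ.norm_starProjection_apply_le x
      rwa [Submodule.starProjection_orthogonal_val] at this
    have h3 : ((ι ∘L (W n).subtypeL) ∘L (W n).orthogonalProjectionOnto - ι) x =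
        -(ι (x - (W n).starProjection x)) := by
      rw [map_sub, neg_sub]; rfl
    rw [h3, norm_neg]
    exact h1.trans (mul_le_mul_of_nonneg_left h2 Nat.one_div_pos_of_nat.le)
  · have : ProperSpace (W n) := FiniteDimensional.proper ℝ (W n)
    exact (isCompactOperator_of_locallyCompactSpace_dom (W n).orthogonalProjectionOnto).clm_comp
      (ι ∘L (W n).subtypeL)

/-- Cauchy–Schwarz, obtained by integrating (|u| - m)² over Ω with m = ∫|u| / (1 + |Ω|). Using 1 +
|Ω| avoids division by zero when Ω is null. -/
theorem sq_integral_norm_le (hb : Bornology.IsBounded Ω) (hu : MemLp u 2)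
    (h0 : ∀ x ∉ Ω, u x = 0) :
    (∫ x, ‖u x‖) ^ 2 ≤ (1 + volume.real Ω) * ∫ x, u x ^ 2 := by
  have : IsFiniteMeasure (volume.restrict Ω) := ⟨by simpa using hb.measure_lt_top⟩
  have hV : 0 ≤ volume.real Ω := measureReal_nonneg
  set V := volume.real Ω with hVdef
  have h1 := integrable_of_memLp_two hb hu h0
  have h2 := hu.integrable_sq
  set m := (∫ x, ‖u x‖) / (1 + V) with hm
  have e1 : ∫ x in Ω, ‖u x‖ = ∫ x, ‖u x‖ :=
    setIntegral_eq_of_eq_zero fun x hx => by rw [h0 x hx, norm_zero]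
  have e2 : ∫ x in Ω, u x ^ 2 = ∫ x, u x ^ 2 :=
    setIntegral_eq_of_eq_zero fun x hx => by rw [h0 x hx]; ring
  have h3 : 0 ≤ ∫ x in Ω, (u x ^ 2 - 2 * m * ‖u x‖ + m ^ 2) := by
    refine integral_nonneg fun x => ?_
    have : u x ^ 2 = ‖u x‖ ^ 2 := by rw [Real.norm_eq_abs, sq_abs]
    simp only [Pi.zero_apply]
    nlinarith [sq_nonneg (‖u x‖ - m)]
  have i1 : Integrable (fun x => u x ^ 2 - 2 * m * ‖u x‖) (volume.restrict Ω) :=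
    h2.integrableOn.sub (h1.norm.integrableOn.const_mul _)
  rw [integral_add i1 (integrable_const _), integral_sub h2.integrableOn
    (h1.norm.integrableOn.const_mul _), integral_const_mul, e1, e2] at h3
  simp only [integral_const, measureReal_restrict_apply_univ, smul_eq_mul] at h3
  rw [← hVdef] at h3
  have hJ : ∫ x, ‖u x‖ = m * (1 + V) := by rw [hm]; field_simp
  rw [hJ] at h3 ⊢
  nlinarith [mul_nonneg (sq_nonneg m) hV, sq_nonneg m]

theorem MemH.deficit_nonneg (hN : 1 ≤ N) (hu : MemH Ω u) (hu1 : Integrable u)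
    (hu2 : Integrable fun x => u x ^ 2) {s : ℝ} (hs : 0 < s) : 0 ≤ deficit u s := by
  obtain ⟨hF, hFint⟩ := hu.integral_fourierSq hN hu1 hu2
  rw [deficit, ← hFint, sub_nonneg]
  refine integral_mono (integrable_fourierSq_mul_exp hu1 hs) hF fun ξ => ?_
  refine mul_le_of_le_one_right (fourierSq_nonneg u ξ) ?_
  rw [Real.exp_le_one_iff, neg_div]
  have : 0 ≤ Real.pi ^ 2 * ‖ξ‖ ^ 2 / s := by positivity
  linarith

/-- The deficit is antitone and ∫₁^S ds/s = log S, so its value at S is at most its integral over s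
> 1 divided by log S. Thus it is small for large S, uniformly on bounded sets of the energy space.
-/
theorem MemH.log_mul_deficit_le (hN : 1 ≤ N) (hu : MemH Ω u) (hu1 : Integrable u)
    (hu2 : Integrable fun x => u x ^ 2) {S : ℝ} (hS : 1 < S) :
    Real.log S * deficit u S ≤ energy u u + cN N * (∫ x, ‖u x‖) ^ 2 +
      (∫ x, u x ^ 2) * ∫ s in Ioi 1, s⁻¹ * gammaTail ((N : ℝ) / 2) s := by
  have hmeas := hu.measurable
  obtain ⟨h1, h2⟩ := hu.integral_inv_mul_deficit hN hu1 hu2 one_pos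
  have h3 : Real.log S * deficit u S ≤ ∫ s in Ioi 1, s⁻¹ * deficit u s := by
    have hint : IntegrableOn (fun s : ℝ => s⁻¹) (Ioc 1 S) := by
      refine ContinuousOn.integrableOn_Icc (a := 1) ?_ |>.mono_set Ioc_subset_Icc_self
      exact continuousOn_inv₀.mono fun s hs => (by have := hs.1; simp; linarith)
    calc Real.log S * deficit u S = ∫ s in Ioc 1 S, s⁻¹ * deficit u S := by
          rw [integral_mul_const, ← intervalIntegral.integral_of_le hS.le,
            integral_inv_of_pos one_pos (by linarith), div_one]
      _ ≤ ∫ s in Ioc 1 S, s⁻¹ * deficit u s := by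
          refine setIntegral_mono_on (hint.mul_const _) (h1.mono_set Ioc_subset_Ioi_self)
            measurableSet_Ioc fun s hs => ?_
          have h0 : 0 < s := one_pos.trans hs.1
          exact mul_le_mul_of_nonneg_left
            (antitoneOn_deficit hu1 h0 (h0.trans_le hs.2) hs.2) (inv_nonneg.2 h0.le)
      _ ≤ _ := by
          refine setIntegral_mono_set h1 ((ae_restrict_iff' measurableSet_Ioi).2
            (.of_forall fun s hs => ?_)) Ioc_subset_Ioi_self.eventuallyLE
          have h0 : 0 < s := one_pos.trans hs
          exact mul_nonneg (inv_nonneg.2 h0.le) (hu.deficit_nonneg hN hu1 hu2 h0)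
  have hne : ∀ p ∈ farPairs N, p.1 = p.2 → False := fun p hp h => by
      have hp : 1 ≤ ‖p.1 - p.2‖ := hp
      simp [h] at hp
      linarith
  have hi2 := integrableOn_farPairs hu1.norm hu1.norm
  obtain ⟨f1, f2⟩ := integral_inv_mul_setIntegral_gaussKernel hN (measurableSet_farPairs N)
    (Φ := fun p => ‖u p.1‖ * ‖u p.2‖) (by fun_prop) (fun p hp h => (hne p hp h).elim) hi2
  have hJ : ∫ p in farPairs N, ‖u p.1‖ * ‖u p.2‖ / ‖p.1 - p.2‖ ^ N ≤ (∫ x, ‖u x‖) ^ 2 := by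
    have hprod : Integrable (fun p : EuclideanSpace ℝ (Fin N) × EuclideanSpace ℝ (Fin N) =>
      ‖u p.1‖ * ‖u p.2‖) := hu1.norm.mul_prod hu1.norm
    calc _ ≤ ∫ p in farPairs N, ‖u p.1‖ * ‖u p.2‖ := by
          refine setIntegral_mono_on hi2 hprod.integrableOn (measurableSet_farPairs N)
            fun p hp => ?_
          have hp : 1 ≤ ‖p.1 - p.2‖ := hp
          exact div_le_self (by positivity) (one_le_pow₀ hp)
      _ ≤ ∫ p : EuclideanSpace ℝ (Fin N) × EuclideanSpace ℝ (Fin N), ‖u p.1‖ * ‖u p.2‖ :=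
          setIntegral_le_integral hprod (.of_forall fun p => by positivity)
      _ = _ := by
          rw [Measure.volume_eq_prod, integral_prod_mul (fun x => ‖u x‖) fun x => ‖u x‖, sq]
  have h4 : -(∫ s in Ioi 1, s⁻¹ * ∫ p in farPairs N,
      u p.1 * u p.2 * gaussKernel N s (p.1 - p.2)) ≤ cN N * (∫ x, ‖u x‖) ^ 2 := by
    rw [← integral_neg]
    calc _ ≤ ∫ s in Ioi 1, s⁻¹ * ∫ p in farPairs N,
            ‖u p.1‖ * ‖u p.2‖ * gaussKernel N s (p.1 - p.2) := by
          obtain ⟨g1, -⟩ := integral_inv_mul_setIntegral_gaussKernel hN (measurableSet_farPairs N)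
            (Φ := fun p => u p.1 * u p.2) (by fun_prop) (fun p hp h => (hne p hp h).elim)
            (integrableOn_farPairs hu1 hu1)
          refine setIntegral_mono_on (g1.mono_set (Ioi_subset_Ioi zero_le_one)).neg
            (f1.mono_set (Ioi_subset_Ioi zero_le_one)) measurableSet_Ioi fun s hs => ?_
          have h0 : 0 < s := one_pos.trans hs
          rw [← mul_neg, ← integral_neg]
          refine mul_le_mul_of_nonneg_left ?_ (inv_nonneg.2 h0.le)
          refine integral_mono (integrable_mul_mul_gaussKernel hu1 h0).integrableOn.neg
            ?_ fun p => ?_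
          · refine (integrable_congr (.of_forall fun p => ?_)).1
              (integrable_mul_mul_gaussKernel hu1 h0).integrableOn.norm
            simp only [norm_mul, Real.norm_of_nonneg (gaussKernel_nonneg h0.le _)]
          · simp only
            rw [← neg_mul]
            refine mul_le_mul_of_nonneg_right ?_ (gaussKernel_nonneg h0.le _)
            rw [← norm_mul]
            exact neg_le_abs _
      _ ≤ ∫ s in Ioi 0, s⁻¹ * ∫ p in farPairs N,
            ‖u p.1‖ * ‖u p.2‖ * gaussKernel N s (p.1 - p.2) := by
          refine setIntegral_mono_set f1 ((ae_restrict_iff' measurableSet_Ioi).2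
            (.of_forall fun s hs => ?_)) (Ioi_subset_Ioi zero_le_one).eventuallyLE
          have h0 : 0 < s := hs
          exact mul_nonneg (inv_nonneg.2 h0.le) (integral_nonneg fun p =>
            mul_nonneg (by positivity) (gaussKernel_nonneg h0.le _))
      _ = _ := f2
      _ ≤ _ := by gcongr; exact (cN_pos hN).le
  linarith

theorem exists_simpleFunc_dist_lt (hb : Bornology.IsBounded Ω) {r : ℝ} (hr : 0 < r) :
    ∃ c : SimpleFunc (EuclideanSpace ℝ (Fin N)) (EuclideanSpace ℝ (Fin N)),
      ∀ x ∈ Ω, dist (c x) x < r := by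
  let e := TopologicalSpace.denseSeq (EuclideanSpace ℝ (Fin N))
  obtain ⟨t, ht⟩ := hb.isCompact_closure.elim_finite_subcover (fun k => Metric.ball (e k) r)
    (fun k => Metric.isOpen_ball) fun x _ => by
      obtain ⟨k, hk⟩ := (TopologicalSpace.denseRange_denseSeq _).exists_dist_lt x hr
      exact mem_iUnion.2 ⟨k, by simpa using hk⟩
  refine ⟨SimpleFunc.nearestPt e (t.sup id), fun x hx => ?_⟩
  obtain ⟨k, hk, hxk⟩ := mem_iUnion₂.1 (ht (subset_closure hx))
  have h1 := SimpleFunc.edist_nearestPt_le e x (Finset.le_sup (f := id) hk)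
  rw [edist_dist, edist_dist, ENNReal.ofReal_le_ofReal_iff dist_nonneg] at h1
  rw [Metric.mem_ball'] at hxk
  exact h1.trans_lt hxk

theorem uniformContinuous_gaussKernel {s : ℝ} (hs : 0 < s) :
    UniformContinuous (gaussKernel N s) := by
  have hc : Continuous (gaussKernel N s) := by unfold gaussKernel; fun_prop
  refine hc.uniformContinuous_of_tendsto_cocompact (x := 0) ?_
  have h1 : Tendsto (fun z : EuclideanSpace ℝ (Fin N) => s * ‖z‖ ^ 2)
      (cocompact (EuclideanSpace ℝ (Fin N))) atTop :=
    ((tendsto_pow_atTop two_ne_zero).comp tendsto_norm_cocompact_atTop).const_mul_atTop hs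
  have h2 := (Real.tendsto_exp_neg_atTop_nhds_zero.comp h1).const_mul ((s / Real.pi) ^ ((N : ℝ) / 2))
  rw [mul_zero] at h2
  refine h2.congr fun z => ?_
  simp [gaussKernel]

/-- With y replaced by the cell centre c(y) the double integral vanishes, since `u` has mean zero on
each fibre of `c`. The replacement changes the kernel by less than η for y in Ω. -/
theorem integral_mul_mul_gaussKernel_le (hu : Integrable u) (h0 : ∀ x ∉ Ω, u x = 0)
    {s r η : ℝ} (hs : 0 < s)
    (hr : ∀ z z' : EuclideanSpace ℝ (Fin N), dist z z' < r →
      dist (gaussKernel N s z) (gaussKernel N s z') < η)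
    (c : SimpleFunc (EuclideanSpace ℝ (Fin N)) (EuclideanSpace ℝ (Fin N)))
    (hc : ∀ x ∈ Ω, dist (c x) x < r) (hu0 : ∀ p ∈ c.range, ∫ x in c ⁻¹' {p}, u x = 0) :
    ∫ p : EuclideanSpace ℝ (Fin N) × EuclideanSpace ℝ (Fin N),
      u p.1 * u p.2 * gaussKernel N s (p.1 - p.2) ≤ η * (∫ x, ‖u x‖) ^ 2 := by
  have hq : Measurable (gaussKernel N s) := by unfold gaussKernel; fun_prop
  have huq : ∀ y, Integrable fun x => u x * gaussKernel N s (x - y) := fun y => by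
    refine hu.mul_bdd (c := (s / Real.pi) ^ ((N : ℝ) / 2))
      (Measurable.aestronglyMeasurable (by fun_prop)) (.of_forall fun x => ?_)
    rw [Real.norm_of_nonneg (gaussKernel_nonneg hs.le _)]
    exact gaussKernel_le hs.le _
  have hterm : ∀ y, Integrable fun p : EuclideanSpace ℝ (Fin N) × EuclideanSpace ℝ (Fin N) =>
      (u p.1 * gaussKernel N s (p.1 - y)) * (c ⁻¹' {y}).indicator u p.2 := fun y =>
    (huq y).mul_prod (hu.indicator (c.measurableSet_fiber y))
  have hsum : ∀ p : EuclideanSpace ℝ (Fin N) × EuclideanSpace ℝ (Fin N),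
      ∑ y ∈ c.range, (u p.1 * gaussKernel N s (p.1 - y)) * (c ⁻¹' {y}).indicator u p.2 =
        u p.1 * u p.2 * gaussKernel N s (p.1 - c p.2) := fun p => by
    rw [Finset.sum_eq_single (c p.2)]
    · rw [indicator_of_mem (by simp)]; ring
    · intro y _ hy
      rw [indicator_of_notMem (by simpa using hy.symm), mul_zero]
    · intro h
      exact (h (c.mem_range_self p.2)).elim
  have hi := integrable_finsetSum c.range fun y _ => hterm y
  have hz : ∫ p : EuclideanSpace ℝ (Fin N) × EuclideanSpace ℝ (Fin N),
      u p.1 * u p.2 * gaussKernel N s (p.1 - c p.2) = 0 := by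
    simp only [← hsum]
    rw [integral_finsetSum _ fun y _ => hterm y]
    refine Finset.sum_eq_zero fun y hy => ?_
    rw [Measure.volume_eq_prod, integral_prod_mul (fun x => u x * gaussKernel N s (x - y)),
      integral_indicator (c.measurableSet_fiber y), hu0 y hy, mul_zero]
  simp only [hsum] at hi
  rw [← sub_zero (∫ p : EuclideanSpace ℝ (Fin N) × EuclideanSpace ℝ (Fin N), _), ← hz,
    ← integral_sub (integrable_mul_mul_gaussKernel hu hs) hi, sq, ← integral_prod_mul,
    ← integral_const_mul, Measure.volume_eq_prod]
  refine integral_mono ((integrable_mul_mul_gaussKernel hu hs).sub hi)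
    ((hu.norm.mul_prod hu.norm).const_mul η) fun p => ?_
  simp only
  by_cases hp : p.2 ∈ Ω
  · have h1 := hr (p.1 - p.2) (p.1 - c p.2) (by
      rw [dist_sub_left]; rw [dist_comm]; exact hc _ hp)
    rw [Real.dist_eq] at h1
    rw [← mul_sub, ← norm_mul]
    refine (le_abs_self _).trans ?_
    rw [abs_mul, mul_comm, Real.norm_eq_abs]
    exact mul_le_mul_of_nonneg_right h1.le (abs_nonneg _)
  · simp [h0 _ hp]

/-- Vanishing of finitely many integrals is orthogonality to the images of indicators under the
adjoint of T, hence a condition of finite codimension. -/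
theorem isCompactOperator_of_small_of_setIntegral_eq_zero {V X ι : Type*} [NormedAddCommGroup V]
    [InnerProductSpace ℝ V] [CompleteSpace V] [MeasurableSpace X] {μ : Measure X}
    (T : V →L[ℝ] Lp ℝ 2 μ)
    (h : ∀ ε > 0, ∃ (F : Finset ι) (A : ι → Set X), (∀ i, MeasurableSet (A i)) ∧
      (∀ i, μ (A i) ≠ ⊤) ∧
      ∀ x, (∀ i ∈ F, ∫ z in A i, T x z ∂μ = 0) → ‖T x‖ ≤ ε * ‖x‖) :
    IsCompactOperator T := by
  refine isCompactOperator_of_small_on_finite_codim _ fun ε hε => ?_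
  obtain ⟨F, A, hA, hA', hT⟩ := h ε hε
  let y : ι → V := fun i =>
    ContinuousLinearMap.adjoint T (indicatorConstLp 2 (hA i) (hA' i) (1 : ℝ))
  refine ⟨Submodule.span ℝ (y '' F),
    FiniteDimensional.span_of_finite ℝ (F.finite_toSet.image y), fun x hx => hT x fun i hi => ?_⟩
  have h := (Submodule.mem_orthogonal _ _).1 hx _ (Submodule.subset_span (mem_image_of_mem y hi))
  rwa [ContinuousLinearMap.adjoint_inner_left, L2.inner_indicatorConstLp_one] at h

/-- ∫u² is the deficit at S plus the Gaussian double integral. A large S makes the first small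
relative to the energy norm; then fine cells make the second at most half of ∫u². The number D
stands for the squared norm of the weighted difference. -/
theorem MemH.exists_simpleFunc_integral_sq_le (hN : 1 ≤ N) (hΩ : MeasurableSet Ω)
    (hb : Bornology.IsBounded Ω) {δ : ℝ} (hδ : 0 < δ) :
    ∃ c : SimpleFunc (EuclideanSpace ℝ (Fin N)) (EuclideanSpace ℝ (Fin N)),
      ∀ u, MemH Ω u → (∀ p ∈ c.range, ∫ z in c ⁻¹' {p}, u z = 0) →
        ∀ D, 0 ≤ D → energy u u = cN N / 2 * D → ∫ x, u x ^ 2 ≤ δ * ((∫ x, u x ^ 2) + D) := by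
  set V := volume.real Ω with hV
  have hV0 : 0 ≤ V := measureReal_nonneg
  have hc0 := cN_pos hN
  set G := ∫ s in Ioi 1, s⁻¹ * gammaTail ((N : ℝ) / 2) s with hG
  set C := cN N / 2 + cN N * (1 + V) + |G| with hC
  have hCpos : 0 < C := by positivity
  -- Only log S ≥ 2C/δ matters: with the loss of a factor 2 from the double integral it gives the
  -- ratio δ.
  set S := Real.exp (1 + 2 * C / δ) with hS
  have hS1 : 1 < S := Real.one_lt_exp_iff.2 (by positivity)
  have hS0 : 0 < S := one_pos.trans hS1
  -- Combined with Cauchy–Schwarz, this oscillation bound makes the double integral at most ∫u²/2.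
  have hη : 0 < 1 / (2 * (1 + V)) := by positivity
  obtain ⟨r, hr, hrη⟩ := Metric.uniformContinuous_iff.1
    (uniformContinuous_gaussKernel (N := N) hS0) _ hη
  obtain ⟨c, hc⟩ := exists_simpleFunc_dist_lt hb hr
  refine ⟨c, fun u hm hz D a2 hD => ?_⟩
  have hL := hm.memLp hN hΩ hb
  have h1 : Integrable u := hm.integrable hN hΩ hb
  have h2 := hL.integrable_sq
  have k1 := integral_mul_mul_gaussKernel_le h1 hm.eq_zero hS0 (fun z z' h => hrη h) c hc hz
  have k2 := sq_integral_norm_le hb hL hm.eq_zero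
  have k3 := hm.log_mul_deficit_le hN h1 h2 hS1
  rw [deficit, integral_fourierSq_mul_exp h1 hS0, hD, hS, Real.log_exp, ← hS, ← hG] at k3
  have a1 : 0 ≤ ∫ x, u x ^ 2 := integral_nonneg fun x => sq_nonneg _
  rw [← hV] at k2
  generalize ∫ p : EuclideanSpace ℝ (Fin N) × EuclideanSpace ℝ (Fin N),
    u p.1 * u p.2 * gaussKernel N S (p.1 - p.2) = Q at k1 k3
  generalize ∫ z, ‖u z‖ = J at k1 k2 k3
  generalize ∫ x, u x ^ 2 = I at *
  have b1 : Q ≤ I / 2 := by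
    refine k1.trans ((mul_le_mul_of_nonneg_left k2 hη.le).trans_eq ?_)
    field_simp
  have b2 : (2 * C / δ) * (I / 2) ≤ C * (I + D) := by
    have e1 : (1 + 2 * C / δ) * (I / 2) ≤ (1 + 2 * C / δ) * (I - Q) :=
      mul_le_mul_of_nonneg_left (by linarith) (by positivity)
    have e2 : I * G ≤ I * |G| := mul_le_mul_of_nonneg_left (le_abs_self G) a1
    have e3 : cN N * J ^ 2 ≤ cN N * ((1 + V) * I) := mul_le_mul_of_nonneg_left k2 hc0.le
    have e4 : 0 ≤ D * (cN N * (1 + V) + |G|) := by positivity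
    have e5 : 0 ≤ cN N / 2 * I := by positivity
    have e6 : C * (I + D) = cN N / 2 * I + cN N / 2 * D + cN N * ((1 + V) * I) + I * |G| +
        D * (cN N * (1 + V) + |G|) := by rw [hC]; ring
    linarith
  have b3 : (2 * C / δ) * (I / 2) = C * (I / δ) := by ring
  rw [b3, mul_le_mul_iff_right₀ hCpos, div_le_iff₀ hδ] at b2
  linarith

theorem norm_sq_formEmbedding (x : formDomain Ω) :
    ‖formEmbedding Ω x‖ ^ 2 = ∫ z, formRep x z ^ 2 := by
  rw [← real_inner_self_eq_norm_sq, inner_formEmbedding]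
  simp only [sq]

theorem norm_formEmbedding_le (hΩ : MeasurableSet Ω) {ε : ℝ} (hε : 0 < ε)
    {c : SimpleFunc (EuclideanSpace ℝ (Fin N)) (EuclideanSpace ℝ (Fin N))}
    (hc : ∀ u, MemH Ω u → (∀ p ∈ c.range, ∫ z in c ⁻¹' {p}, u z = 0) →
      ∀ D, 0 ≤ D → energy u u = cN N / 2 * D → ∫ x, u x ^ 2 ≤ ε ^ 2 * ((∫ x, u x ^ 2) + D))
    (x : formDomain Ω) (hx : ∀ p ∈ c.range, ∫ z in c ⁻¹' {p} ∩ Ω, formEmbedding Ω x z = 0) :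
    ‖formEmbedding Ω x‖ ≤ ε * ‖x‖ := by
  have h1 := hc (formRep x) (memH_formRep hΩ x) (fun p hp => by
    rw [formRep, setIntegral_indicator hΩ]
    exact hx p hp) (‖formDiff Ω x‖ ^ 2) (sq_nonneg _) (by
    rw [energy_formRep, real_inner_self_eq_norm_sq])
  rw [← norm_sq_formEmbedding] at h1
  rw [← norm_sq_formDomain] at h1
  rw [← mul_pow] at h1
  exact abs_le_of_sq_le_sq' h1 (mul_nonneg hε.le (norm_nonneg x)) |>.2

theorem isCompactOperator_formEmbedding (hN : 1 ≤ N) (hΩ : MeasurableSet Ω)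
    (hb : Bornology.IsBounded Ω) : IsCompactOperator (formEmbedding Ω) := by
  choose c hc using fun (ε : ℝ) (hε : 0 < ε) =>
    MemH.exists_simpleFunc_integral_sq_le hN hΩ hb (δ := ε ^ 2) (pow_pos hε 2)
  refine isCompactOperator_of_small_of_setIntegral_eq_zero (formEmbedding Ω) fun ε hε =>
    ⟨(c ε hε).range, fun p => c ε hε ⁻¹' {p} ∩ Ω,
      fun p => ((c ε hε).measurableSet_fiber p).inter hΩ,
      fun p => ((measure_mono inter_subset_right).trans_lt hb.measure_lt_top).ne, fun x hx => ?_⟩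
  exact norm_formEmbedding_le hΩ hε (hc ε hε) x hx

/-! ### Weak eigenvectors of the logarithmic form. -/

theorem exists_continuousLinearMap_of_symmetric {V : Type*} [NormedAddCommGroup V]
    [NormedSpace ℝ V] (f : V → V → ℝ) (hadd : ∀ x x' y, f (x + x') y = f x y + f x' y)
    (hsmul : ∀ (c : ℝ) x y, f (c • x) y = c * f x y) (hsymm : ∀ x y, f x y = f y x) {C : ℝ}
    (hC : ∀ x y, |f x y| ≤ C * ‖x‖ * ‖y‖) :
    ∃ B : V →L[ℝ] V →L[ℝ] ℝ, ∀ x y, B x y = f x y :=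
  ⟨(LinearMap.mk₂ ℝ f hadd hsmul (fun x y y' => by rw [hsymm, hadd, hsymm y, hsymm y'])
    (fun c x y => by rw [hsymm, hsmul, hsymm y, smul_eq_mul])).mkContinuous₂ C hC, fun _ _ => rfl⟩

/-- A form that is a positive square plus terms controlled by a compact embedding has orthonormal
families of weak eigenvectors of every finite length. -/
theorem exists_orthonormal_weak_eigenvectors_of_perturbation {V H H' : Type*}
    [NormedAddCommGroup V] [InnerProductSpace ℝ V] [CompleteSpace V]
    [NormedAddCommGroup H] [InnerProductSpace ℝ H] [CompleteSpace H]
    [NormedAddCommGroup H'] [InnerProductSpace ℝ H'] (ι : V →L[ℝ] H) (δ : V →L[ℝ] H')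
    (hι : IsCompactOperator ι) (hnorm : ∀ x, ‖x‖ ^ 2 = ‖ι x‖ ^ 2 + ‖δ x‖ ^ 2)
    (hinf : ¬ FiniteDimensional ℝ (LinearMap.range (ι : V →ₗ[ℝ] H)))
    {F : V → V → ℝ} (hadd : ∀ x x' y, F (x + x') y = F x y + F x' y)
    (hsmul : ∀ (c : ℝ) x y, F (c • x) y = c * F x y) (hsymm : ∀ x y, F x y = F y x) {M : ℝ}
    (hM : 0 ≤ M) (hF : ∀ x y, |F x y| ≤ M * (‖ι x‖ * ‖ι y‖)) {a b : ℝ} (ρ : ℝ) (ha : 0 < a)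
    (hb : 0 ≤ b) (k : ℕ) :
    ∃ (m : Fin k → ℝ) (v : Fin k → V),
      (∀ i w, a * inner ℝ (δ (v i)) (δ w) - b * F (v i) w + ρ * inner ℝ (ι (v i)) (ι w) =
        m i * inner ℝ (ι (v i)) (ι w)) ∧ Orthonormal ℝ fun i => ι (v i) := by
  have hιle : ∀ x, ‖ι x‖ ≤ ‖x‖ := fun x => by
    refine (abs_le_of_sq_le_sq' ?_ (norm_nonneg x)).2
    rw [hnorm]
    exact le_add_of_nonneg_right (sq_nonneg _)
  have hδle : ∀ x, ‖δ x‖ ≤ ‖x‖ := fun x => by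
    refine (abs_le_of_sq_le_sq' ?_ (norm_nonneg x)).2
    rw [hnorm]
    exact le_add_of_nonneg_left (sq_nonneg _)
  -- Shifting the form by C absorbs ρ and the far interaction and leaves at least ‖ιx‖², so the
  -- shifted form is coercive with constant min a 1. The shift is undone in the eigenvalues at the
  -- end.
  set C := 1 + |ρ| + b * M with hC
  have hC0 : 0 ≤ ρ + C := by
    have := neg_abs_le ρ
    have := mul_nonneg hb hM
    linarith
  obtain ⟨B, hB⟩ := exists_continuousLinearMap_of_symmetric
    (fun x y => a * inner ℝ (δ x) (δ y) - b * F x y + (ρ + C) * inner ℝ (ι x) (ι y))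
    (fun x x' y => by
      simp only [map_add, inner_add_left, hadd]
      ring)
    (fun c x y => by
      simp only [map_smul, real_inner_smul_left, hsmul]
      ring)
    (fun x y => by
      rw [hsymm x, real_inner_comm (ι x), real_inner_comm (δ x)])
    (C := a + b * M + (ρ + C)) (fun x y => by
      have hE : ‖ι x‖ * ‖ι y‖ ≤ ‖x‖ * ‖y‖ :=
        mul_le_mul (hιle x) (hιle y) (norm_nonneg _) (norm_nonneg _)
      have hD : ‖δ x‖ * ‖δ y‖ ≤ ‖x‖ * ‖y‖ :=
        mul_le_mul (hδle x) (hδle y) (norm_nonneg _) (norm_nonneg _)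
      have h1 : |a * inner ℝ (δ x) (δ y)| ≤ a * (‖x‖ * ‖y‖) := by
        rw [abs_mul, abs_of_pos ha]
        exact mul_le_mul_of_nonneg_left ((abs_real_inner_le_norm _ _).trans hD) ha.le
      have h2 : |b * F x y| ≤ b * (M * (‖x‖ * ‖y‖)) := by
        rw [abs_mul, abs_of_nonneg hb]
        exact mul_le_mul_of_nonneg_left ((hF x y).trans (mul_le_mul_of_nonneg_left hE hM)) hb
      have h3 : |(ρ + C) * inner ℝ (ι x) (ι y)| ≤ (ρ + C) * (‖x‖ * ‖y‖) := by
        rw [abs_mul, abs_of_nonneg hC0]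
        exact mul_le_mul_of_nonneg_left ((abs_real_inner_le_norm _ _).trans hE) hC0
      rw [abs_le] at h1 h2 h3 ⊢
      constructor <;> linarith [h1.1, h1.2, h2.1, h2.2, h3.1, h3.2])
  have hcoer : IsCoercive B := by
    refine ⟨min a 1, lt_min ha one_pos, fun x => ?_⟩
    have h1 := mul_le_mul_of_nonneg_left (abs_le.1 (hF x x)).2 hb
    have h2 : min a 1 * ‖δ x‖ ^ 2 ≤ a * ‖δ x‖ ^ 2 :=
      mul_le_mul_of_nonneg_right (min_le_left _ _) (sq_nonneg _)
    have h3 : min a 1 * ‖ι x‖ ^ 2 ≤ 1 * ‖ι x‖ ^ 2 :=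
      mul_le_mul_of_nonneg_right (min_le_right _ _) (sq_nonneg _)
    have h4 : 0 ≤ (ρ + |ρ|) * ‖ι x‖ ^ 2 :=
      mul_nonneg (by linarith [neg_abs_le ρ]) (sq_nonneg _)
    rw [hB, mul_assoc, ← sq, hnorm, real_inner_self_eq_norm_sq, real_inner_self_eq_norm_sq, hC]
    linarith
  obtain ⟨m, v, hmv, ho⟩ := exists_orthonormal_weak_eigenvectors ι hι B hcoer
    (fun x y => by
      rw [hB, hB, hsymm x, real_inner_comm (ι x), real_inner_comm (δ x)]) hinf k
  refine ⟨fun i => m i - C, v, fun i w => ?_, ho⟩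
  have h := hmv i w
  rw [hB] at h
  linear_combination h

/-- The interaction of the far pairs in the form of the logarithmic Laplacian. -/
def farIntegral (u w : EuclideanSpace ℝ (Fin N) → ℝ) : ℝ :=
  ∫ p in farPairs N, u p.1 * w p.2 / ‖p.1 - p.2‖ ^ N

theorem farIntegral_congr {u' w' : EuclideanSpace ℝ (Fin N) → ℝ} (hu : u =ᵐ[volume] u')
    (hw : w =ᵐ[volume] w') : farIntegral u w = farIntegral u' w' := by
  refine integral_congr_ae (ae_restrict_of_ae ?_)
  have h1 := Measure.quasiMeasurePreserving_fst (μ := (volume : Measure (EuclideanSpace ℝ (Fin N))))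
    (ν := (volume : Measure (EuclideanSpace ℝ (Fin N)))) |>.ae_eq_comp hu
  have h2 := Measure.quasiMeasurePreserving_snd (μ := (volume : Measure (EuclideanSpace ℝ (Fin N))))
    (ν := (volume : Measure (EuclideanSpace ℝ (Fin N)))) |>.ae_eq_comp hw
  filter_upwards [h1, h2] with p e1 e2
  simp only [Function.comp_apply] at e1 e2
  rw [e1, e2]

theorem farIntegral_comm (u w : EuclideanSpace ℝ (Fin N) → ℝ) :
    farIntegral u w = farIntegral w u := by
  have h := (Measure.measurePreserving_swap (μ := (volume : Measure (EuclideanSpace ℝ (Fin N))))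
    (ν := (volume : Measure (EuclideanSpace ℝ (Fin N))))).setIntegral_preimage_emb
    MeasurableEquiv.prodComm.measurableEmbedding
    (fun p => w p.1 * u p.2 / ‖p.1 - p.2‖ ^ N) (farPairs N)
  have hs : Prod.swap ⁻¹' farPairs N = farPairs N := by
    ext p
    simp [farPairs, norm_sub_rev]
  rw [hs] at h
  rw [farIntegral, farIntegral, Measure.volume_eq_prod, ← h]
  refine integral_congr_ae (.of_forall fun p => ?_)
  simp only [Prod.fst_swap, Prod.snd_swap]
  rw [norm_sub_rev, mul_comm]

theorem farIntegral_add_left {u' : EuclideanSpace ℝ (Fin N) → ℝ} (hu : Integrable u)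
    (hu' : Integrable u') (hw : Integrable w) :
    farIntegral (u + u') w = farIntegral u w + farIntegral u' w := by
  rw [farIntegral, farIntegral, farIntegral,
    ← integral_add (integrableOn_farPairs hu hw) (integrableOn_farPairs hu' hw)]
  refine integral_congr_ae (.of_forall fun p => ?_)
  simp only [Pi.add_apply]
  ring

theorem farIntegral_smul_left (c : ℝ) (u w : EuclideanSpace ℝ (Fin N) → ℝ) :
    farIntegral (c • u) w = c * farIntegral u w := by
  rw [farIntegral, farIntegral, ← integral_const_mul]
  refine integral_congr_ae (.of_forall fun p => ?_)
  simp only [Pi.smul_apply, smul_eq_mul]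
  ring

theorem abs_farIntegral_le (hu : Integrable u) (hw : Integrable w) :
    |farIntegral u w| ≤ (∫ x, ‖u x‖) * ∫ x, ‖w x‖ := by
  have hprod : Integrable (fun p : EuclideanSpace ℝ (Fin N) × EuclideanSpace ℝ (Fin N) =>
    ‖u p.1‖ * ‖w p.2‖) := hu.norm.mul_prod hw.norm
  calc |farIntegral u w| ≤ ∫ p in farPairs N, ‖u p.1 * w p.2 / ‖p.1 - p.2‖ ^ N‖ := by
        rw [← Real.norm_eq_abs, farIntegral]
        exact norm_integral_le_integral_norm _
    _ ≤ ∫ p in farPairs N, ‖u p.1‖ * ‖w p.2‖ := by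
        refine setIntegral_mono_on (integrableOn_farPairs hu hw).norm hprod.integrableOn
          (measurableSet_farPairs N) fun p hp => ?_
        have hp : 1 ≤ ‖p.1 - p.2‖ := hp
        rw [norm_div, norm_mul, norm_pow, norm_norm]
        exact div_le_self (by positivity) (one_le_pow₀ hp)
    _ ≤ ∫ p : EuclideanSpace ℝ (Fin N) × EuclideanSpace ℝ (Fin N), ‖u p.1‖ * ‖w p.2‖ :=
        setIntegral_le_integral hprod (.of_forall fun p => by positivity)
    _ = _ := by
        rw [Measure.volume_eq_prod, integral_prod_mul (fun x => ‖u x‖) fun x => ‖w x‖]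

theorem energy_comm (u w : EuclideanSpace ℝ (Fin N) → ℝ) : energy u w = energy w u := by
  unfold energy
  simp only [mul_comm]

theorem logForm_comm (u w : EuclideanSpace ℝ (Fin N) → ℝ) : logForm u w = logForm w u := by
  have h := farIntegral_comm u w
  rw [farIntegral, farIntegral] at h
  rw [logForm, logForm, energy_comm, h]
  simp only [mul_comm]

theorem logForm_congr {u' w' : EuclideanSpace ℝ (Fin N) → ℝ} (hu : u =ᵐ[volume] u')
    (hw : w =ᵐ[volume] w') : logForm u w = logForm u' w' := by
  have h1 := farIntegral_congr hu hw
  have h2 : energy u w = energy u' w' := by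
    unfold energy
    congr 1
    refine integral_congr_ae ?_
    filter_upwards [diffQuot_congr_ae hu, diffQuot_congr_ae hw] with p e1 e2
    rw [← diffQuot_mul, ← diffQuot_mul, e1, e2]
  have h3 : ∫ x, u x * w x = ∫ x, u' x * w' x := by
    refine integral_congr_ae ?_
    filter_upwards [hu, hw] with x e1 e2
    rw [e1, e2]
  rw [farIntegral, farIntegral] at h1
  rw [logForm, logForm, h1, h2, h3]

theorem formRep_add_ae_eq (x y : formDomain Ω) :
    formRep (x + y) =ᵐ[volume] formRep x + formRep y := by
  have h : formEmbedding Ω (x + y) = formEmbedding Ω x + formEmbedding Ω y := map_add _ _ _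
  have h0 := Lp.coeFn_add (formEmbedding Ω x) (formEmbedding Ω y)
  rw [← h] at h0
  exact (formRep_ae_eq _).trans (h0.trans ((formRep_ae_eq x).symm.add (formRep_ae_eq y).symm))

theorem formRep_smul_ae_eq (c : ℝ) (x : formDomain Ω) :
    formRep (c • x) =ᵐ[volume] c • formRep x := by
  have h : formEmbedding Ω (c • x) = c • formEmbedding Ω x := map_smul _ _ _
  have h0 := Lp.coeFn_smul c (formEmbedding Ω x)
  rw [← h] at h0
  exact (formRep_ae_eq _).trans (h0.trans ((formRep_ae_eq x).symm.const_smul c))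

theorem integrable_formRep (hN : 1 ≤ N) (hΩ : MeasurableSet Ω) (hb : Bornology.IsBounded Ω)
    (x : formDomain Ω) : Integrable (formRep x) :=
  (memH_formRep hΩ x).integrable hN hΩ hb

theorem integral_norm_formRep_le (hb : Bornology.IsBounded Ω) (hΩ : MeasurableSet Ω)
    (x : formDomain Ω) :
    ∫ z, ‖formRep x z‖ ≤ Real.sqrt (1 + volume.real Ω) * ‖formEmbedding Ω x‖ := by
  have h := sq_integral_norm_le hb (memLp_formRep x) (memH_formRep hΩ x).eq_zero
  rw [← norm_sq_formEmbedding] at h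
  have hV : 0 ≤ volume.real Ω := measureReal_nonneg
  refine (abs_le_of_sq_le_sq' ?_ (by positivity)).2
  rwa [mul_pow, Real.sq_sqrt (by positivity)]

theorem abs_farIntegral_formRep_le (hN : 1 ≤ N) (hb : Bornology.IsBounded Ω)
    (hΩ : MeasurableSet Ω) (x y : formDomain Ω) :
    |farIntegral (formRep x) (formRep y)| ≤
      (1 + volume.real Ω) * (‖formEmbedding Ω x‖ * ‖formEmbedding Ω y‖) := by
  have hV : 0 ≤ volume.real Ω := measureReal_nonneg
  have hs := Real.mul_self_sqrt (show 0 ≤ 1 + volume.real Ω by positivity)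
  calc _ ≤ _ := abs_farIntegral_le (integrable_formRep hN hΩ hb x) (integrable_formRep hN hΩ hb y)
    _ ≤ (Real.sqrt (1 + volume.real Ω) * ‖formEmbedding Ω x‖) *
        (Real.sqrt (1 + volume.real Ω) * ‖formEmbedding Ω y‖) :=
      mul_le_mul (integral_norm_formRep_le hb hΩ x) (integral_norm_formRep_le hb hΩ y)
        (integral_nonneg fun z => norm_nonneg _) (by positivity)
    _ = _ := by linear_combination (‖formEmbedding Ω x‖ * ‖formEmbedding Ω y‖) * hs

theorem logForm_formRep (x y : formDomain Ω) :
    logForm (formRep x) (formRep y) = cN N / 2 * inner ℝ (formDiff Ω x) (formDiff Ω y) -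
      cN N * farIntegral (formRep x) (formRep y) +
      rhoN N * inner ℝ (formEmbedding Ω x) (formEmbedding Ω y) := by
  have h1 := energy_formRep x y
  have h2 := (inner_formEmbedding x y).symm
  exact congrArg₂ (· + ·) (congrArg (· - cN N * farIntegral (formRep x) (formRep y)) h1)
    (congrArg (rhoN N * ·) h2)

theorem exists_weak_eigenvectors_logForm (hN : 1 ≤ N) (hb : Bornology.IsBounded Ω)
    (hΩ : MeasurableSet Ω)
    (hinf : ¬ FiniteDimensional ℝ (LinearMap.range (formEmbedding Ω : formDomain Ω →ₗ[ℝ] L2Space N)))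
    (k : ℕ) :
    ∃ (m : Fin k → ℝ) (v : Fin k → formDomain Ω),
      (∀ i (w : formDomain Ω), logForm (formRep (v i)) (formRep w) = m i * ∫ z, formRep (v i) z * formRep w z) ∧
      ∀ i j, ∫ z, formRep (v i) z * formRep (v j) z = if i = j then 1 else 0 := by
  have hc := cN_pos hN
  obtain ⟨m, v, h1, h2⟩ := exists_orthonormal_weak_eigenvectors_of_perturbation
    (formEmbedding Ω) (formDiff Ω) (isCompactOperator_formEmbedding hN hΩ hb) norm_sq_formDomain
    hinf (F := fun x y => farIntegral (formRep x) (formRep y))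
    (fun x x' y => (farIntegral_congr (formRep_add_ae_eq x x') (EventuallyEq.refl _ _)).trans
      (farIntegral_add_left (integrable_formRep hN hΩ hb x) (integrable_formRep hN hΩ hb x')
        (integrable_formRep hN hΩ hb y)))
    (fun c x y => (farIntegral_congr (formRep_smul_ae_eq c x) (EventuallyEq.refl _ _)).trans
      (farIntegral_smul_left c _ _))
    (fun x y => farIntegral_comm _ _) (add_nonneg zero_le_one measureReal_nonneg)
    (abs_farIntegral_formRep_le hN hb hΩ) (rhoN N) (half_pos hc) hc.le k
  refine ⟨m, v, fun i w => ?_, fun i j => ?_⟩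
  · exact (logForm_formRep (v i) w).trans
      ((h1 i w).trans (congrArg (m i * ·) (inner_formEmbedding (v i) w)))
  · exact (inner_formEmbedding (v i) (v j)).symm.trans (orthonormal_iff_ite.1 h2 i j)

/-! ### Tents: the energy space is infinite-dimensional. -/

theorem integrableOn_norm_sq_div_norm_pow (hN : 1 ≤ N) (r : ℝ) :
    IntegrableOn (fun z : EuclideanSpace ℝ (Fin N) => ‖z‖ ^ 2 / ‖z‖ ^ N) (Metric.ball 0 r) := by
  have : Nonempty (Fin N) := ⟨⟨0, hN⟩⟩
  rw [integrableOn_fun_norm_addHaar volume (f := fun y => y ^ 2 / y ^ N), finrank_euclideanSpace_fin]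
  have h : IntegrableOn (fun y : ℝ => y) (Ioo 0 r) :=
    (continuous_id.integrableOn_Icc (a := 0) (b := r)).mono_set Ioo_subset_Icc_self
  refine h.congr_fun (fun y hy => ?_) measurableSet_Ioo
  have hy0 : y ≠ 0 := hy.1.ne'
  obtain ⟨n, rfl⟩ := Nat.exists_eq_add_of_le' hN
  simp only [smul_eq_mul, Nat.add_sub_cancel]
  field_simp
  ring

/-- The Lipschitz bound reduces the kernel to |z|^{2-N}, which is integrable near 0. At least one
point of each contributing pair lies in Ω, so the integrand is dominated by (1_Ω(x) + 1_Ω(y)) g(x -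
y). -/
theorem memH_of_lipschitz (hN : 1 ≤ N) (hΩ : MeasurableSet Ω) (hb : Bornology.IsBounded Ω)
    (hu : Measurable u) (h0 : ∀ x ∉ Ω, u x = 0) (hL : ∀ x y, |u x - u y| ≤ ‖x - y‖) :
    MemH Ω u := by
  refine ⟨hu, h0, ?_⟩
  set f : EuclideanSpace ℝ (Fin N) → ℝ := Ω.indicator fun _ => 1 with hf
  set g : EuclideanSpace ℝ (Fin N) → ℝ :=
    (Metric.ball 0 2).indicator fun z => ‖z‖ ^ 2 / ‖z‖ ^ N with hg
  have hfi : Integrable f := (integrable_indicator_iff hΩ).2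
    (integrableOn_const hb.measure_lt_top.ne)
  have hgi : Integrable g := (integrable_indicator_iff Metric.isOpen_ball.measurableSet).2
    (integrableOn_norm_sq_div_norm_pow hN 2)
  have hf0 : ∀ x, 0 ≤ f x := fun x => indicator_nonneg (fun _ _ => zero_le_one) x
  have h1 := Integrable.convolution_integrand (ContinuousLinearMap.mul ℝ ℝ) hfi hgi
  have h2 := h1.swap
  simp only [ContinuousLinearMap.mul_apply'] at h1 h2
  refine ((h1.add h2).integrableOn (s := nearPairs N)).mono'
    (Measurable.aestronglyMeasurable (by fun_prop))
    ((ae_restrict_iff' (measurableSet_nearPairs N)).2 (.of_forall fun p hp => ?_))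
  have hp : ‖p.1 - p.2‖ ≤ 1 := hp
  have hg1 : g (p.1 - p.2) = ‖p.1 - p.2‖ ^ 2 / ‖p.1 - p.2‖ ^ N := by
    rw [hg, indicator_of_mem]
    rw [mem_ball_zero_iff]
    linarith
  have hg2 : g (p.2 - p.1) = ‖p.1 - p.2‖ ^ 2 / ‖p.1 - p.2‖ ^ N := by
    rw [hg, indicator_of_mem, norm_sub_rev]
    rw [mem_ball_zero_iff, norm_sub_rev]
    linarith
  rw [Real.norm_of_nonneg (by positivity)]
  simp only [Pi.add_apply, Function.comp_apply, Prod.fst_swap, Prod.snd_swap]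
  rw [hg1, hg2, ← add_mul, ← mul_div_assoc]
  refine div_le_div_of_nonneg_right ?_ (by positivity)
  by_cases hx : p.1 ∈ Ω ∨ p.2 ∈ Ω
  · have h3 : 1 ≤ f p.2 + f p.1 := by
      rcases hx with hx | hx
      · have : f p.1 = 1 := indicator_of_mem hx _
        linarith [hf0 p.2]
      · have : f p.2 = 1 := indicator_of_mem hx _
        linarith [hf0 p.1]
    have h4 : (u p.1 - u p.2) ^ 2 ≤ ‖p.1 - p.2‖ ^ 2 := by
      rw [← sq_abs]
      exact pow_le_pow_left₀ (abs_nonneg _) (hL _ _) 2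
    nlinarith [sq_nonneg ‖p.1 - p.2‖]
  · rw [not_or] at hx
    rw [h0 _ hx.1, h0 _ hx.2]
    have := add_nonneg (hf0 p.2) (hf0 p.1)
    have : 0 ≤ (f p.2 + f p.1) * ‖p.1 - p.2‖ ^ 2 := by positivity
    simpa using this

/-- The tent of slope one over a ball. -/
def tent (x₀ : EuclideanSpace ℝ (Fin N)) (r : ℝ) (x : EuclideanSpace ℝ (Fin N)) : ℝ :=
  max (r - ‖x - x₀‖) 0

theorem tent_eq_zero {x₀ : EuclideanSpace ℝ (Fin N)} {r : ℝ} {x : EuclideanSpace ℝ (Fin N)}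
    (hx : x ∉ Metric.ball x₀ r) : tent x₀ r x = 0 := by
  rw [mem_ball_iff_norm, not_lt] at hx
  exact max_eq_right (by linarith)

theorem memH_tent (hN : 1 ≤ N) (hΩ : MeasurableSet Ω) (hb : Bornology.IsBounded Ω)
    {x₀ : EuclideanSpace ℝ (Fin N)} {r : ℝ} (h : Metric.ball x₀ r ⊆ Ω) :
    MemH Ω (tent x₀ r) := by
  refine memH_of_lipschitz hN hΩ hb (by unfold tent; fun_prop)
    (fun x hx => tent_eq_zero fun h' => hx (h h')) fun x y => ?_
  refine (abs_max_sub_max_le_abs _ _ _).trans ?_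
  have h1 : r - ‖x - x₀‖ - (r - ‖y - x₀‖) = -(‖x - x₀‖ - ‖y - x₀‖) := by ring
  rw [h1, abs_neg]
  refine (abs_norm_sub_norm_le _ _).trans_eq ?_
  rw [sub_sub_sub_cancel_right]

theorem integral_tent_sq_pos {x₀ : EuclideanSpace ℝ (Fin N)} {r : ℝ} (hr : 0 < r) :
    0 < ∫ x, tent x₀ r x * tent x₀ r x := by
  have hc : Continuous (tent x₀ r) := by unfold tent; fun_prop
  refine (hc.mul hc).integral_pos_of_hasCompactSupport_nonneg_nonzero (x := x₀) ?_ ?_ ?_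
  · refine HasCompactSupport.intro (isCompact_closedBall x₀ r) fun x hx => ?_
    have : tent x₀ r x = 0 := tent_eq_zero fun h => hx (Metric.ball_subset_closedBall h)
    simp [this]
  · exact fun x => mul_self_nonneg _
  · simp [tent, hr.le, hr.ne']

theorem exists_disjoint_balls (hN : 1 ≤ N) (hΩ : IsOpen Ω) (hne : Ω.Nonempty) :
    ∃ (x : ℕ → EuclideanSpace ℝ (Fin N)) (r : ℕ → ℝ), (∀ i, 0 < r i) ∧
      (∀ i, Metric.ball (x i) (r i) ⊆ Ω) ∧
      Pairwise fun i j => Disjoint (Metric.ball (x i) (r i)) (Metric.ball (x j) (r j)) := by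
  have : Nonempty (Fin N) := ⟨⟨0, hN⟩⟩
  obtain ⟨x₀, hx₀⟩ := hne
  have : Infinite Ω := (infinite_of_mem_nhds x₀ (hΩ.mem_nhds hx₀)).to_subtype
  obtain ⟨U, hU, hUo, hUd⟩ := exists_seq_infinite_isOpen_pairwise_disjoint (X := Ω)
  choose y hy using fun i => (hU i).nonempty
  have hopen : ∀ i, IsOpen (Subtype.val '' U i) := fun i => hΩ.isOpenMap_subtype_val _ (hUo i)
  choose r hr hrU using fun i => Metric.isOpen_iff.1 (hopen i) (y i) (mem_image_of_mem _ (hy i))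
  refine ⟨fun i => y i, r, hr, fun i => (hrU i).trans (Subtype.coe_image_subset _ _),
    fun i j hij => ?_⟩
  exact ((disjoint_image_iff Subtype.val_injective).2 (hUd hij)).mono (hrU i) (hrU j)

theorem not_finiteDimensional_of_orthogonal {V H : Type*} [NormedAddCommGroup V]
    [NormedSpace ℝ V] [NormedAddCommGroup H] [InnerProductSpace ℝ H] (ι : V →L[ℝ] H) (v : ℕ → V)
    (h0 : ∀ i, inner ℝ (ι (v i)) (ι (v i)) ≠ 0)
    (h : ∀ i j, i ≠ j → inner ℝ (ι (v i)) (ι (v j)) = 0) :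
    ¬ FiniteDimensional ℝ (LinearMap.range (ι : V →ₗ[ℝ] H)) := by
  intro hfin
  have h1 : LinearIndependent ℝ fun i => ι (v i) :=
    linearIndependent_of_ne_zero_of_inner_eq_zero
      (fun i hi => h0 i (by rw [hi, inner_zero_left])) fun i j hij => h i j hij
  have h2 : LinearIndependent ℝ fun i =>
      (⟨ι (v i), LinearMap.mem_range_self _ (v i)⟩ : LinearMap.range (ι : V →ₗ[ℝ] H)) :=
    LinearIndependent.of_comp (LinearMap.range (ι : V →ₗ[ℝ] H)).subtype h1
  exact not_finite_iff_infinite.2 inferInstance h2.finite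

/-- Tents over infinitely many disjoint balls in Ω are nonzero and mutually orthogonal. -/
theorem not_finiteDimensional_range_formEmbedding (hN : 1 ≤ N) (hΩ : IsOpen Ω)
    (hne : Ω.Nonempty) (hb : Bornology.IsBounded Ω) :
    ¬ FiniteDimensional ℝ (LinearMap.range (formEmbedding Ω : formDomain Ω →ₗ[ℝ] L2Space N)) := by
  obtain ⟨x, r, hr, hsub, hd⟩ := exists_disjoint_balls hN hΩ hne
  have hm : ∀ i, MemH Ω (tent (x i) (r i)) := fun i => memH_tent hN hΩ.measurableSet hb (hsub i)
  choose v _ hv using fun i => (hm i).exists_formDomain ((hm i).memLp hN hΩ.measurableSet hb)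
  have key : ∀ i j, inner ℝ (formEmbedding Ω (v i)) (formEmbedding Ω (v j)) =
      ∫ z, tent (x i) (r i) z * tent (x j) (r j) z := fun i j =>
    inner_eq_integral_of_ae_eq ((formRep_ae_eq (v i)).symm.trans (hv i))
      ((formRep_ae_eq (v j)).symm.trans (hv j))
  refine not_finiteDimensional_of_orthogonal (formEmbedding Ω) v (fun i => ?_) fun i j hij => ?_
  · exact (key i i).trans_ne (integral_tent_sq_pos (hr i)).ne'
  · refine (key i j).trans (integral_eq_zero_of_ae (.of_forall fun z => ?_))
    by_cases hz : z ∈ Metric.ball (x i) (r i)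
    · simp [tent_eq_zero (disjoint_left.1 (hd hij) hz)]
    · simp [tent_eq_zero hz]

/-! ### Eigenfunctions, and attainment of the eigenvalue. -/

theorem not_ae_eq_zero_of_setIntegral_eq_one {f : EuclideanSpace ℝ (Fin N) → ℝ}
    (h : ∫ x in Ω, f x * f x = 1) : ¬ f =ᵐ[volume] 0 := by
  intro h0
  have : ∫ x in Ω, f x * f x = 0 := by
    refine integral_eq_zero_of_ae ?_
    filter_upwards [ae_restrict_of_ae h0] with x hx
    simp [hx]
  linarith

/-- Makes the set whose infimum is `eigenvalue Ω k` nonempty; for an empty set `sInf` would return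
the meaningless value 0. -/
theorem exists_hasEigenvaluesBelow (hN : 1 ≤ N) (hΩ : IsOpen Ω) (hne : Ω.Nonempty)
    (hb : Bornology.IsBounded Ω) (k : ℕ) : ∃ t, HasEigenvaluesBelow Ω k t := by
  have hm := hΩ.measurableSet
  obtain ⟨m, v, h1, h2⟩ := exists_weak_eigenvectors_logForm hN hb hm
    (not_finiteDimensional_range_formEmbedding hN hΩ hne hb) k
  have h0 : ∀ i (f : EuclideanSpace ℝ (Fin N) → ℝ),
      ∫ x in Ω, formRep (v i) x * f x = ∫ x, formRep (v i) x * f x := fun i f =>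
    setIntegral_eq_of_eq_zero fun x hx => by rw [(memH_formRep hm (v i)).eq_zero x hx, zero_mul]
  obtain ⟨t, ht⟩ := (finite_range m).bddAbove
  refine ⟨t, m, fun i => formRep (v i), fun i => ⟨memH_formRep hm (v i), ?_, fun φ hφ => ?_⟩,
    fun i => ht (mem_range_self i), fun i j => (h0 i _).trans (h2 i j)⟩
  · exact not_ae_eq_zero_of_setIntegral_eq_one ((h0 i _).trans ((h2 i i).trans (if_pos rfl)))
  · obtain ⟨y, -, hy⟩ := hφ.exists_formDomain (hφ.memLp hN hm hb)
    rw [h0, ← logForm_congr (EventuallyEq.refl _ (formRep (v i))) hy, h1 i y]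
    congr 1
    refine integral_congr_ae ?_
    filter_upwards [hy] with x hx
    rw [hx]

theorem MemH.const_smul (hu : MemH Ω u) (c : ℝ) : MemH Ω (c • u) := by
  refine ⟨hu.measurable.const_smul c, fun x hx => by simp [hu.eq_zero x hx], ?_⟩
  refine (hu.finite_energy.const_mul (c ^ 2)).congr (.of_forall fun p => ?_)
  simp only [Pi.smul_apply, smul_eq_mul]
  ring

theorem logForm_smul_left (c : ℝ) (u w : EuclideanSpace ℝ (Fin N) → ℝ) :
    logForm (c • u) w = c * logForm u w := by
  have h1 := farIntegral_smul_left c u w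
  rw [farIntegral, farIntegral] at h1
  have h2 : energy (c • u) w = c * energy u w := by
    rw [energy, energy, mul_left_comm c, ← integral_const_mul c]
    congr 1
    refine integral_congr_ae (.of_forall fun p => ?_)
    simp only [Pi.smul_apply, smul_eq_mul]
    ring
  have h3 : ∫ x, (c • u) x * w x = c * ∫ x, u x * w x := by
    rw [← integral_const_mul]
    refine integral_congr_ae (.of_forall fun x => ?_)
    simp only [Pi.smul_apply, smul_eq_mul]
    ring
  rw [logForm, logForm, h1, h2, h3]
  ring

theorem IsEigenfunction.integral_sq_pos {lam : ℝ} (hN : 1 ≤ N) (hΩ : MeasurableSet Ω)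
    (hb : Bornology.IsBounded Ω) (hu : IsEigenfunction Ω lam u) : 0 < ∫ x in Ω, u x * u x := by
  have hi : Integrable fun x => u x * u x := by
    simpa only [sq] using (hu.memH.memLp hN hΩ hb).integrable_sq
  rw [setIntegral_eq_of_eq_zero fun x hx => by rw [hu.memH.eq_zero x hx, zero_mul],
    integral_pos_iff_support_of_nonneg (fun x => mul_self_nonneg _) hi, pos_iff_ne_zero]
  intro h
  refine hu.ne_zero ?_
  have : volume {x | ¬ u x = 0} = 0 := by
    rw [← h]
    congr 1
    ext x
    simp
  exact this

theorem IsEigenfunction.exists_normalized {lam : ℝ} (hN : 1 ≤ N) (hΩ : MeasurableSet Ω)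
    (hb : Bornology.IsBounded Ω) (hu : IsEigenfunction Ω lam u) :
    ∃ v, IsEigenfunction Ω lam v ∧ ∫ x in Ω, v x * v x = 1 := by
  have hpos := hu.integral_sq_pos hN hΩ hb
  set I := ∫ x in Ω, u x * u x with hI
  have hs := Real.sqrt_pos.2 hpos
  have hsm : ∀ φ : EuclideanSpace ℝ (Fin N) → ℝ, ∫ x in Ω, ((Real.sqrt I)⁻¹ • u) x * φ x =
      (Real.sqrt I)⁻¹ * ∫ x in Ω, u x * φ x := fun φ => by
    rw [← integral_const_mul]
    simp only [Pi.smul_apply, smul_eq_mul, mul_assoc]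
  have h1 : ∫ x in Ω, ((Real.sqrt I)⁻¹ • u) x * ((Real.sqrt I)⁻¹ • u) x = 1 := by
    rw [hsm]
    have : ∫ x in Ω, u x * ((Real.sqrt I)⁻¹ • u) x = (Real.sqrt I)⁻¹ * I := by
      rw [← hsm u]
      simp only [mul_comm]
    rw [this]
    have h2 := Real.mul_self_sqrt hpos.le
    field_simp
    rw [sq, h2]
  refine ⟨(Real.sqrt I)⁻¹ • u, ⟨hu.memH.const_smul _, not_ae_eq_zero_of_setIntegral_eq_one h1,
    fun φ hφ => ?_⟩, h1⟩
  rw [logForm_smul_left, hu.weak_eq φ hφ, hsm]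
  ring

theorem IsEigenfunction.integral_mul_eq_zero {lam mu : ℝ} (hu : IsEigenfunction Ω lam u)
    (hw : IsEigenfunction Ω mu w) (hne : lam ≠ mu) : ∫ x in Ω, u x * w x = 0 := by
  have h1 := hu.weak_eq w hw.memH
  have h2 := hw.weak_eq u hu.memH
  rw [logForm_comm, h1] at h2
  have h3 : ∫ x in Ω, w x * u x = ∫ x in Ω, u x * w x := by simp only [mul_comm]
  rw [h3, ← sub_eq_zero, ← sub_mul] at h2
  exact (mul_eq_zero.1 h2).resolve_left (sub_ne_zero.2 hne)

theorem log_lt_sum_eigenvalues (hN : 1 ≤ N) (hΩ : IsOpen Ω) (hne : Ω.Nonempty)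
    (hb : Bornology.IsBounded Ω) {k : ℕ} (hk : 1 ≤ k) {lam : Fin k → ℝ}
    {u : Fin k → EuclideanSpace ℝ (Fin N) → ℝ} (hu : ∀ i, IsEigenfunction Ω (lam i) (u i))
    (ho : ∀ i j, ∫ x in Ω, u i x * u j x = if i = j then 1 else 0) :
    k * (2 / N * Real.log (2 * k / (Real.exp 1 * N * dN N * volume.real Ω))) < ∑ i, lam i := by
  have hV : 0 < volume.real Ω :=
    ENNReal.toReal_pos (hΩ.measure_pos volume hne).ne' hb.measure_lt_top.ne
  refine (lt_sum_logForm hN hΩ.measurableSet hb hV hk (fun i => (hu i).memH) ho).trans_eq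
    (Finset.sum_congr rfl fun i _ => ?_)
  rw [(hu i).weak_eq _ (hu i).memH, ho, if_pos rfl, mul_one]

theorem log_lt_of_hasEigenvaluesBelow (hN : 1 ≤ N) (hΩ : IsOpen Ω) (hne : Ω.Nonempty)
    (hb : Bornology.IsBounded Ω) {k : ℕ} (hk : 1 ≤ k) {t : ℝ} (h : HasEigenvaluesBelow Ω k t) :
    2 / N * Real.log (2 * k / (Real.exp 1 * N * dN N * volume.real Ω)) < t := by
  obtain ⟨lam, u, hu, hlam, ho⟩ := h
  have h1 := log_lt_sum_eigenvalues hN hΩ hne hb hk hu ho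
  have h2 : ∑ i, lam i ≤ k * t := by
    refine (Finset.sum_le_sum fun i _ => hlam i).trans_eq ?_
    simp
  have hk0 : (0 : ℝ) < k := by exact_mod_cast hk
  exact lt_of_mul_lt_mul_left (h1.trans_le h2) hk0.le

/-- Eigenfunctions for distinct eigenvalues are orthogonal. Infinitely many below t would give
orthonormal families of every size n, against a lower bound growing like (2/N) log n. -/
theorem finite_eigenvalues_le (hN : 1 ≤ N) (hΩ : IsOpen Ω) (hne : Ω.Nonempty)
    (hb : Bornology.IsBounded Ω) (t : ℝ) :
    {lam : ℝ | lam ≤ t ∧ ∃ u, IsEigenfunction Ω lam u}.Finite := by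
  by_contra hinf
  set f := Set.Infinite.natEmbedding _ hinf
  choose u hu using fun i => (f i).2.2
  choose v hv hv1 using fun i => (hu i).exists_normalized hN hΩ.measurableSet hb
  have hV : 0 < volume.real Ω :=
    ENNReal.toReal_pos (hΩ.measure_pos volume hne).ne' hb.measure_lt_top.ne
  have hN0 : (0 : ℝ) < N := by exact_mod_cast hN
  have hd := dN_pos hN
  set D := Real.exp 1 * N * dN N * volume.real Ω with hD
  have hD0 : 0 < D := by positivity
  -- For this n the lower bound (2/N) log(2n/D) is already at least t.
  obtain ⟨n, hn⟩ := exists_nat_ge (D / 2 * Real.exp (t * N / 2))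
  have hn0 : (0 : ℝ) < n := lt_of_lt_of_le (by positivity) hn
  have hn1 : 1 ≤ n := by exact_mod_cast hn0
  have h := log_lt_of_hasEigenvaluesBelow hN hΩ hne hb hn1 (t := t)
    ⟨fun i : Fin n => f i, fun i => v i, fun i => hv i, fun i => (f i).2.1, fun i j => by
      split_ifs with hij
      · rw [hij]
        exact hv1 j
      · refine (hv i).integral_mul_eq_zero (hv j) fun h => hij ?_
        exact Fin.ext (f.injective (Subtype.ext h))⟩
  rw [← hD] at h
  have h2 : t * N / 2 ≤ Real.log (2 * n / D) := by
    rw [Real.le_log_iff_exp_le (by positivity), le_div_iff₀ hD0]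
    linarith
  have h3 : t ≤ 2 / N * Real.log (2 * n / D) := by
    refine le_trans (le_of_eq ?_) (mul_le_mul_of_nonneg_left h2 (by positivity))
    field_simp
  linarith

/-- An admissible level can be lowered to the largest of its k eigenvalues, itself an eigenvalue.
Only finitely many candidates lie below a fixed level, so the infimum is a minimum, and the strict
lower bound reaches λ_k without weakening. -/
theorem hasEigenvaluesBelow_eigenvalue (hN : 1 ≤ N) (hΩ : IsOpen Ω) (hne : Ω.Nonempty)
    (hb : Bornology.IsBounded Ω) {k : ℕ} (hk : 1 ≤ k) :
    HasEigenvaluesBelow Ω k (eigenvalue Ω k) := by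
  have : Nonempty (Fin k) := ⟨⟨0, hk⟩⟩
  obtain ⟨t₀, ht₀⟩ := exists_hasEigenvaluesBelow hN hΩ hne hb k
  have hmax : ∀ t, HasEigenvaluesBelow Ω k t → ∃ s ≤ t, HasEigenvaluesBelow Ω k s ∧
      ∃ u, IsEigenfunction Ω s u := by
    rintro t ⟨lam, u, hu, hlam, ho⟩
    obtain ⟨i, hi⟩ := Finite.exists_max lam
    exact ⟨lam i, hlam i, ⟨lam, u, hu, hi, ho⟩, u i, hu i⟩
  obtain ⟨s₀, hs₀, hs₀', hs₀''⟩ := hmax t₀ ht₀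
  obtain ⟨s, ⟨hs, hs'⟩, hmin⟩ := Set.exists_min_image
    ({lam : ℝ | lam ≤ t₀ ∧ ∃ u, IsEigenfunction Ω lam u} ∩ {s | HasEigenvaluesBelow Ω k s}) id
    ((finite_eigenvalues_le hN hΩ hne hb t₀).inter_of_left _) ⟨s₀, ⟨hs₀, hs₀''⟩, hs₀'⟩
  have hleast : IsLeast {t | HasEigenvaluesBelow Ω k t} s := by
    refine ⟨hs', fun t ht => ?_⟩
    obtain ⟨r, hr, hr', hr''⟩ := hmax t ht
    rcases le_total r t₀ with h | h
    · exact (hmin r ⟨⟨h, hr''⟩, hr'⟩).trans hr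
    · exact hs.1.trans (h.trans hr)
  rw [eigenvalue, hleast.csInf_eq]
  exact hs'

theorem log_lt_eigenvalue (hN : 1 ≤ N) (hΩ : IsOpen Ω) (hne : Ω.Nonempty)
    (hb : Bornology.IsBounded Ω) {k : ℕ} (hk : 1 ≤ k) :
    2 / N * Real.log (2 * k / (Real.exp 1 * N * dN N * volume.real Ω)) < eigenvalue Ω k :=
  log_lt_of_hasEigenvaluesBelow hN hΩ hne hb hk
    (hasEigenvaluesBelow_eigenvalue hN hΩ hne hb hk)

end LogLaplacian

end

/-! ### The two bounds for λ_k. -/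

theorem mainTheorem6 (N : ℕ) (hN : 1 ≤ N) (Ω : Set (EuclideanSpace ℝ (Fin N)))
    (hopen : IsOpen Ω) (hconn : IsConnected Ω) (hbdd : Bornology.IsBounded Ω) (k : ℕ) :
    (Real.exp 1 * N * LogLaplacian.dN N / 2 * volume.real Ω ≤ k →
      0 < LogLaplacian.eigenvalue Ω k) ∧
    (Real.exp (Real.exp 1 + 1) * N * LogLaplacian.dN N / 2 * volume.real Ω ≤ k →
      2 / (N : ℝ) * (Real.log k
          + Real.log (2 / (Real.exp 1 * N * LogLaplacian.dN N * volume.real Ω))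
          - Real.log (Real.log
              (2 * k / (Real.exp 1 * N * LogLaplacian.dN N * volume.real Ω))))
        ≤ LogLaplacian.eigenvalue Ω k) := by
  have hne := hconn.nonempty
  have hV : 0 < volume.real Ω :=
    ENNReal.toReal_pos (hopen.measure_pos volume hne).ne' hbdd.measure_lt_top.ne
  have hN0 : (0 : ℝ) < N := by exact_mod_cast hN
  have hd := LogLaplacian.dN_pos hN
  set D := Real.exp 1 * N * LogLaplacian.dN N * volume.real Ω with hD
  have hD0 : 0 < D := by positivity
  have key : (0 : ℝ) < k → 2 / N * Real.log (2 * k / D) < LogLaplacian.eigenvalue Ω k := fun hk =>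
    LogLaplacian.log_lt_eigenvalue hN hopen hne hbdd (by exact_mod_cast hk)
  refine ⟨fun h => ?_, fun h => ?_⟩
  · have h1 : D / 2 ≤ k := by rw [hD]; linarith
    -- The threshold is positive, so it forces k ≥ 1; `k = 0` needs no separate treatment.
    have hk : (0 : ℝ) < k := lt_of_lt_of_le (by positivity) h1
    -- At the threshold itself the logarithm may be 0; positivity then comes from the strictness of
    -- `key`.
    refine lt_of_le_of_lt (mul_nonneg (by positivity) (Real.log_nonneg ?_)) (key hk)
    rw [le_div_iff₀ hD0]
    linarith
  · have h1 : Real.exp (Real.exp 1) * D / 2 ≤ k := by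
      rw [Real.exp_add] at h
      rw [hD]
      linarith
    have hk : (0 : ℝ) < k := lt_of_lt_of_le (by positivity) h1
    have h2 : Real.exp 1 ≤ Real.log (2 * k / D) := by
      rw [Real.le_log_iff_exp_le (by positivity), le_div_iff₀ hD0]
      linarith
    -- The second threshold gives log(2k/D) ≥ e ≥ 1, so the iterated logarithm is nonnegative and
    -- subtracting it only weakens `key`.
    have h3 : 0 ≤ Real.log (Real.log (2 * k / D)) :=
      Real.log_nonneg ((Real.one_le_exp zero_le_one).trans h2)
    have h4 : Real.log k + Real.log (2 / D) = Real.log (2 * k / D) := by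
      rw [← Real.log_mul hk.ne' (by positivity)]
      congr 1
      ring
    rw [h4]
    exact (mul_le_mul_of_nonneg_left (sub_le_self _ h3) (by positivity)).trans (key hk).le
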